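/- There are a single deterministic random access machine program and constants $C$ and $K$ such that the following holds. Let $G$ be a finite simple undirected graph with vertex set $\{0,\dots,n-1\}$ and $m$ edges, let $F\subseteq E(G)$, and let $s$ and $t$ be vertices of $G$. Given $n$, $m$, $s$, $t$ and a list of the edges of $G$ (each edge occurring once, in any order, as its two endpoints together with a bit telling whether it belongs to $F$), the program halts after at most $C\cdot(m\log n+1)$ steps, that is, in time $O(m\log n)$ as soon as $G$ has an edge. If $G$ has an $s$-$t$-path (without repeated vertices) that uses an odd number of edges from $F$, then it outputs the vertex sequence of such a path; otherwise it outputs the empty list, correctly reporting that no such path exists. Here the machine is a word RAM with word size $w$, for any $w\ge\log_2(n+m+1)+K$: registers and memory cells hold integers in $\{0,\dots,2^w-1\}$; memory and registers not holding the input are initially zero; and each of the following takes one step: loading a constant, copying a register, adding (modulo $2^w$) or subtracting (truncated at $0$) two registers, reading or writing the memory cell whose address is in a register, doing nothing, and testing two registers for $<$ or $=$ in a conditional or a while loop. -/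

import Mathlib

/-! ## Word random access machine

Words are natural numbers below `2 ^ w`, where `w` is the word size. A state consists of registers
(a program mentions only finitely many of them) and of a random access memory addressed by words.
The programs are RAM programs with structured control flow. Every elementary instruction and every
evaluation of a test takes one step. -/

namespace RAM

/-- A state: the contents of the registers and of the memory cells. -/
structure State where
  reg : ℕ → ℕ
  mem : ℕ → ℕ

namespace State

/-- Write `x` into register `d`. -/
def setReg (σ : State) (d x : ℕ) : State := { σ with reg := Function.update σ.reg d x }

/-- Write `x` into the memory cell with address `a`. -/
def setMem (σ : State) (a x : ℕ) : State := { σ with mem := Function.update σ.mem a x }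

/-- The output of a final state: register `0` holds its length and register `1` the address in
memory at which it starts. -/
def output (σ : State) : List ℕ := (List.range (σ.reg 0)).map fun i => σ.mem (σ.reg 1 + i)

/-- The initial state on a given input: the input is written to the memory cells `0, 1, 2, …`, and
all other cells and all registers are zero. -/
def init (input : List ℕ) : State where
  reg := fun _ => 0
  mem := fun i => input.getD i 0

end State

/-- Tests: comparison of the contents of two registers. -/
inductive Test where
  | lt (a b : ℕ)
  | eq (a b : ℕ)

/-- The truth value of a test in a state. -/
def Test.Holds (σ : State) : Test → Prop
  | .lt a b => σ.reg a < σ.reg b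
  | .eq a b => σ.reg a = σ.reg b

/-- Elementary instructions; the arguments are register numbers, except for the literal `c`. -/
inductive Instr where
  | const (d c : ℕ)
  | move (d a : ℕ)
  | add (d a b : ℕ)
  | sub (d a b : ℕ)
  | load (d a : ℕ)
  | store (a b : ℕ)

/-- The effect of an elementary instruction on a machine with word size `w`. Literals and sums are
reduced modulo `2 ^ w`, and subtraction is truncated at zero. -/
def Instr.apply (w : ℕ) (σ : State) : Instr → State
  | .const d c => σ.setReg d (c % 2 ^ w)
  | .move d a => σ.setReg d (σ.reg a)
  | .add d a b => σ.setReg d ((σ.reg a + σ.reg b) % 2 ^ w)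
  | .sub d a b => σ.setReg d (σ.reg a - σ.reg b)
  | .load d a => σ.setReg d (σ.mem (σ.reg a))
  | .store a b => σ.setMem (σ.reg a) (σ.reg b)

/-- Programs. -/
inductive Program where
  | skip
  | instr (i : Instr)
  | seq (p q : Program)
  | cond (b : Test) (p q : Program)
  | loop (b : Test) (p : Program)

/-- `Runs w p σ T τ`: on a machine with word size `w`, the program `p` started in the state `σ`
halts after exactly `T` steps in the state `τ`. -/
inductive Runs (w : ℕ) : Program → State → ℕ → State → Prop
  | skip (σ : State) : Runs w .skip σ 1 σ
  | instr (i : Instr) (σ : State) : Runs w (.instr i) σ 1 (i.apply w σ)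
  | seq {p q : Program} {σ τ υ : State} {T U : ℕ} :
      Runs w p σ T τ → Runs w q τ U υ → Runs w (.seq p q) σ (T + U) υ
  | cond_true {b : Test} {p q : Program} {σ τ : State} {T : ℕ} :
      b.Holds σ → Runs w p σ T τ → Runs w (.cond b p q) σ (1 + T) τ
  | cond_false {b : Test} {p q : Program} {σ τ : State} {T : ℕ} :
      ¬ b.Holds σ → Runs w q σ T τ → Runs w (.cond b p q) σ (1 + T) τ
  | loop_true {b : Test} {p : Program} {σ τ υ : State} {T U : ℕ} :
      b.Holds σ → Runs w p σ T τ → Runs w (.loop b p) τ U υ →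
      Runs w (.loop b p) σ (1 + T + U) υ
  | loop_false {b : Test} {p : Program} {σ : State} :
      ¬ b.Holds σ → Runs w (.loop b p) σ 1 σ

/-- The machine is deterministic: running time and final state are unique. -/
theorem Runs.deterministic {w : ℕ} {p : Program} {σ τ : State} {T : ℕ} (h : Runs w p σ T τ) :
    ∀ {T' : ℕ} {τ' : State}, Runs w p σ T' τ' → T = T' ∧ τ = τ' := by
  induction h with
  | skip σ => intro T' τ' h'; cases h'; exact ⟨rfl, rfl⟩
  | instr i σ => intro T' τ' h'; cases h'; exact ⟨rfl, rfl⟩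
  | seq _ _ ih₁ ih₂ =>
    intro T' τ' h'
    cases h' with
    | seq h₁ h₂ =>
      obtain ⟨rfl, rfl⟩ := ih₁ h₁
      obtain ⟨rfl, rfl⟩ := ih₂ h₂
      exact ⟨rfl, rfl⟩
  | cond_true hb _ ih =>
    intro T' τ' h'
    cases h' with
    | cond_true _ h₁ => obtain ⟨rfl, rfl⟩ := ih h₁; exact ⟨rfl, rfl⟩
    | cond_false hb' _ => exact absurd hb hb'
  | cond_false hb _ ih =>
    intro T' τ' h'
    cases h' with
    | cond_true hb' _ => exact absurd hb' hb
    | cond_false _ h₁ => obtain ⟨rfl, rfl⟩ := ih h₁; exact ⟨rfl, rfl⟩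
  | loop_true hb _ _ ih₁ ih₂ =>
    intro T' τ' h'
    cases h' with
    | loop_true _ h₁ h₂ =>
      obtain ⟨rfl, rfl⟩ := ih₁ h₁
      obtain ⟨rfl, rfl⟩ := ih₂ h₂
      exact ⟨rfl, rfl⟩
    | loop_false hb' => exact absurd hb hb'
  | loop_false hb =>
    intro T' τ' h'
    cases h' with
    | loop_true hb' _ _ => exact absurd hb' hb
    | loop_false _ => exact ⟨rfl, rfl⟩

end RAM

/-! ## Paths with an odd number of edges from `F`, and their computation -/

/-- `p` is a path (without repeated vertices) that uses an odd number of edges from `F`. -/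
def IsOddPath {V : Type*} [DecidableEq V] {G : SimpleGraph V} {s t : V} (F : Finset (Sym2 V))
    (p : G.Walk s t) : Prop :=
  p.IsPath ∧ Odd (F.filter fun e => e ∈ p.edges).card

/-- `edges` lists every edge of `G` exactly once, in any order and with its two endpoints in either
order. -/
def IsEdgeList {V : Type*} (G : SimpleGraph V) (edges : List (V × V)) : Prop :=
  (edges.map fun e => s(e.1, e.2)).Nodup ∧
    ∀ e : Sym2 V, e ∈ edges.map (fun e => s(e.1, e.2)) ↔ e ∈ G.edgeSet

/-- The input: the number of vertices, the number of edges, `s`, `t`, and then for every edge its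
two endpoints followed by a flag that tells whether the edge belongs to `F`. -/
def encodeInput {n : ℕ} (edges : List (Fin n × Fin n)) (F : Finset (Sym2 (Fin n)))
    (s t : Fin n) : List ℕ :=
  [n, edges.length, s.val, t.val] ++
    edges.flatMap fun e => [e.1.val, e.2.val, if s(e.1, e.2) ∈ F then 1 else 0]

/-- The correct outputs: the list of the vertices, from `s` to `t`, of an `s`-`t`-path that uses an
odd number of edges from `F`, or the empty list if there is no such path. -/
def IsCorrectOutput {n : ℕ} (G : SimpleGraph (Fin n)) (F : Finset (Sym2 (Fin n)))
    (s t : Fin n) (out : List ℕ) : Prop :=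
  (∃ p : G.Walk s t, IsOddPath F p ∧ out = p.support.map Fin.val) ∨
    ((¬ ∃ p : G.Walk s t, IsOddPath F p) ∧ out = [])

/-!
An odd path is found in linear time, by means of one depth-first search and a bipolar order.

Add a virtual edge `ts` and grow a depth-first search tree from `t` that begins with this edge and
does not otherwise leave `t`. An `s`-`t`-path never enters a subtree that is attached to the rest of
the graph in a single vertex, because it could not return (`Bipolar.exit_subtree`,
`root_not_mem_subtree_walk`). What is left when these subtrees are removed is the set `S` of the
vertices `v` all of whose ancestors `c` (other than `s` and `t`), and `v` itself, have a lowpoint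
strictly above the parent of `c`; all `s`-`t`-paths run in `S`. The set `S` has a bipolar order with
minimum `s` and maximum `t`, in which every other vertex has a smaller and a greater neighbour.
Tarjan's signs compute it: `v` is placed next to its parent, on the side of the parent on which the
lowpoint of `v` lies. Here a position is a rational number, the vertex with number `k` having
distance `3⁻ᵏ` from its parent (`pos`). So the descendants of a vertex stay on its side of its
parent, and the order never has to be written down: each vertex `v` merely stores a smaller
neighbour `lo v` and a greater one `hi v` (`Bipolar.ptr_spec`).

Let `a v` be the parity of the number of edges from `F` on the path `v, lo v, lo (lo v), …, s`, and
`b v` the parity on the path `v, hi v, hi (hi v), …, t`. For an edge `xy` in `S` with `x` before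
`y`, going from `s` up to `x`, along the edge, and from `y` up to `t` is a path, for it is
increasing. There are two cases.

* Some such path is odd. If `a v ≠ b v` for a vertex `v` other than `s` and `t`, then the path
  through the edge from `lo v` to `v` is odd (`Ordered.oddEdge_lo`). If `a = b` on `S`, but some
  edge `xy` in `S` has a label different from `a x + a y`, then the path through this edge is odd,
  once it is known which of `x` and `y` comes first. One of them is an ancestor of the other, and
  the answer is the side of the child of this ancestor that lies towards the other vertex
  (`orient_spec`).
* Otherwise `a` is a potential for the labels on `S`, with `a s = a t = 0`, so that every
  `s`-`t`-path is even (`countP_of_potential`).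

The algorithm is written in a small language with arrays (`Cmd`), for which weakest preconditions
(`wp`) and a rule for loops with a bound on the number of iterations (`Halts.loop`) give correctness
and the running time at once; `compile` translates it to the machine. Only vertices that the search
finds are handled after the input has been read, and there are at most `2 * m + 2` of them, so the
time is `O(m + 1)`. No array needs to be cleared, as the memory is zero initially.
-/


namespace OddPath

/-! ### A language of programs with arrays -/

/-- A state of the array language: variables `r` and arrays `A`, both numbered. -/
structure Store where
  r : ℕ → ℕ
  A : ℕ → ℕ → ℕ

/-- Commands of the array language. Arguments are numbers of variables and of arrays (`j`), except
for the literal `c`: `get d j i` stands for `d := j[i]` and `put j i a` for `j[i] := a`. -/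
inductive Cmd where
  | skip
  | const (d c : ℕ)
  | move (d a : ℕ)
  | add (d a b : ℕ)
  | sub (d a b : ℕ)
  | get (d j i : ℕ)
  | put (j i a : ℕ)
  | seq (p q : Cmd)
  | cond (b : RAM.Test) (p q : Cmd)
  | loop (b : RAM.Test) (p : Cmd)

/-- Sequential composition of commands. -/
infixr:60 " ;; " => Cmd.seq

/-- The number of arrays in use. -/
abbrev numArrays : ℕ := 22

/-- Variable `x` lives in register `2 * x`. -/
def compileTest : RAM.Test → RAM.Test
  | .lt a b => .lt (2 * a) (2 * b)
  | .eq a b => .eq (2 * a) (2 * b)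

/-- Translation to the machine: variable `x` lives in register `2 * x`, register `2 * j + 3` holds
the address of array `j`, and register `1` is used for computing addresses. -/
def compile : Cmd → RAM.Program
  | .skip => .skip
  | .const d c => .instr (.const (2 * d) c)
  | .move d a => .instr (.move (2 * d) (2 * a))
  | .add d a b => .instr (.add (2 * d) (2 * a) (2 * b))
  | .sub d a b => .instr (.sub (2 * d) (2 * a) (2 * b))
  | .get d j i => .seq (.instr (.add 1 (2 * j + 3) (2 * i))) (.instr (.load (2 * d) 1))
  | .put j i a => .seq (.instr (.add 1 (2 * j + 3) (2 * i))) (.instr (.store 1 (2 * a)))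
  | .seq p q => .seq (compile p) (compile q)
  | .cond b p q => .cond (compileTest b) (compile p) (compile q)
  | .loop b p => .loop (compileTest b) (compile p)

namespace Store

/-- Assign `x` to the variable `d`. -/
def set (H : Store) (d x : ℕ) : Store := ⟨Function.update H.r d x, H.A⟩

/-- Assign `x` to the entry `i` of the array `j`. -/
def put (H : Store) (j i x : ℕ) : Store :=
  ⟨H.r, Function.update H.A j (Function.update (H.A j) i x)⟩

@[simp] theorem set_r (H : Store) (d x y : ℕ) : (H.set d x).r y = if y = d then x else H.r y := by
  simp [set, Function.update_apply]

@[simp] theorem set_A (H : Store) (d x : ℕ) : (H.set d x).A = H.A := rfl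

@[simp] theorem put_r (H : Store) (j i x : ℕ) : (H.put j i x).r = H.r := rfl

@[simp] theorem put_A (H : Store) (j i x k : ℕ) :
    (H.put j i x).A k = if k = j then Function.update (H.A j) i x else H.A k := by
  by_cases h : k = j <;> simp [put, h]

end Store

/-- The truth value of a test. -/
def Holds (H : Store) : RAM.Test → Prop
  | .lt a b => H.r a < H.r b
  | .eq a b => H.r a = H.r b

/-- The machine state `σ` represents the store `H`, where every array occupies `U` cells. -/
structure Rep (U : ℕ) (H : Store) (σ : RAM.State) : Prop where
  reg : ∀ x, σ.reg (2 * x) = H.r x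
  base : ∀ j < numArrays, σ.reg (2 * j + 3) = j * U
  mem : ∀ j < numArrays, ∀ i < U, σ.mem (j * U + i) = H.A j i

variable {U w : ℕ}

theorem Rep.set {H : Store} {σ : RAM.State} (h : Rep U H σ) (d x : ℕ) :
    Rep U (H.set d x) (σ.setReg (2 * d) x) where
  reg y := by simp [RAM.State.setReg, Function.update_apply, h.reg]
  base j hj := by
    have : 2 * j + 3 ≠ 2 * d := by omega
    simp [RAM.State.setReg, this, h.base j hj]
  mem j hj i hi := by simp [RAM.State.setReg, h.mem j hj i hi]

theorem Rep.setTmp {H : Store} {σ : RAM.State} (h : Rep U H σ) (x : ℕ) :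
    Rep U H (σ.setReg 1 x) where
  reg y := by
    have : 2 * y ≠ 1 := by omega
    simp [RAM.State.setReg, h.reg, this]
  base j hj := by simp [RAM.State.setReg, h.base j hj]
  mem j hj i hi := by simp [RAM.State.setReg, h.mem j hj i hi]

theorem address_inj {j i k l : ℕ} (hi : i < U) (hl : l < U) (h : k * U + l = j * U + i) :
    k = j ∧ l = i := by
  have hU : 0 < U := by omega
  have h1 : (k * U + l) / U = (j * U + i) / U := by rw [h]
  rw [Nat.mul_comm k, Nat.mul_comm j, Nat.mul_add_div hU, Nat.mul_add_div hU,
    Nat.div_eq_of_lt hi, Nat.div_eq_of_lt hl] at h1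
  simp only [Nat.add_zero] at h1
  subst h1
  exact ⟨rfl, by omega⟩

theorem Rep.setMem {H : Store} {σ : RAM.State} (h : Rep U H σ) {j i : ℕ} (hi : i < U)
    (x : ℕ) : Rep U (H.put j i x) (σ.setMem (j * U + i) x) where
  reg y := by simp [RAM.State.setMem, h.reg]
  base j hj := by simp [RAM.State.setMem, h.base j hj]
  mem k hk l hl := by
    by_cases hkl : k = j ∧ l = i
    · obtain ⟨rfl, rfl⟩ := hkl
      simp [RAM.State.setMem]
    · have : k * U + l ≠ j * U + i := fun h => hkl (address_inj hi hl h)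
      simp only [RAM.State.setMem, Function.update_apply, this, if_false, h.mem k hk l hl,
        Store.put_A]
      by_cases hk' : k = j
      · subst hk'
        have : l ≠ i := fun h => hkl ⟨rfl, h⟩
        simp [this]
      · simp [hk']

theorem Rep.holds {H : Store} {σ : RAM.State} (h : Rep U H σ) (b : RAM.Test) :
    (compileTest b).Holds σ ↔ Holds H b := by
  cases b <;> simp [compileTest, RAM.Test.Holds, Holds, h.reg]

/-- Started in the store `H`, the command `c` halts within `T` steps of the machine in a store that
satisfies `Q`. -/
def Halts (U w : ℕ) (c : Cmd) (H : Store) (T : ℕ) (Q : Store → Prop) : Prop :=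
  ∃ H', Q H' ∧ ∀ σ, Rep U H σ → ∃ T' ≤ T, ∃ σ', RAM.Runs w (compile c) σ T' σ' ∧ Rep U H' σ'

theorem Halts.mono {c : Cmd} {H : Store} {T T' : ℕ} {Q Q' : Store → Prop}
    (h : Halts U w c H T Q) (hT : T ≤ T') (hQ : ∀ H', Q H' → Q' H') : Halts U w c H T' Q' := by
  obtain ⟨H', hq, h⟩ := h
  refine ⟨H', hQ _ hq, fun σ hσ => ?_⟩
  obtain ⟨T1, h1, h2⟩ := h σ hσ
  exact ⟨T1, h1.trans hT, h2⟩

theorem Halts.seq {p q : Cmd} {H : Store} {T₁ T₂ : ℕ} {Q : Store → Prop}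
    (h : Halts U w p H T₁ fun H₁ => Halts U w q H₁ T₂ Q) :
    Halts U w (p ;; q) H (T₁ + T₂) Q := by
  obtain ⟨H₁, ⟨H₂, hq, h₂⟩, h₁⟩ := h
  refine ⟨H₂, hq, fun σ hσ => ?_⟩
  obtain ⟨t₁, ht₁, σ₁, r₁, hσ₁⟩ := h₁ σ hσ
  obtain ⟨t₂, ht₂, σ₂, r₂, hσ₂⟩ := h₂ σ₁ hσ₁
  exact ⟨t₁ + t₂, by omega, σ₂, .seq r₁ r₂, hσ₂⟩

theorem Halts.cond {b : RAM.Test} {p q : Cmd} {H : Store} {T : ℕ} {Q : Store → Prop}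
    (hp : Holds H b → Halts U w p H T Q) (hq : ¬ Holds H b → Halts U w q H T Q) :
    Halts U w (.cond b p q) H (1 + T) Q := by
  by_cases hb : Holds H b
  · obtain ⟨H', hQ, h⟩ := hp hb
    refine ⟨H', hQ, fun σ hσ => ?_⟩
    obtain ⟨t, ht, σ', r, hσ'⟩ := h σ hσ
    exact ⟨1 + t, by omega, σ', .cond_true ((hσ.holds b).2 hb) r, hσ'⟩
  · obtain ⟨H', hQ, h⟩ := hq hb
    refine ⟨H', hQ, fun σ hσ => ?_⟩
    obtain ⟨t, ht, σ', r, hσ'⟩ := h σ hσ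
    exact ⟨1 + t, by omega, σ', .cond_false (fun h => hb ((hσ.holds b).1 h)) r, hσ'⟩

/-- The rule for loops: `I k H` is an invariant in which `k` bounds the number of iterations that
are left. -/
theorem Halts.loop {b : RAM.Test} {p : Cmd} {T : ℕ} {I : ℕ → Store → Prop}
    (hp : ∀ k H, I k H → Holds H b → Halts U w p H T fun H' => ∃ k' < k, I k' H') :
    ∀ k H, I k H →
      Halts U w (.loop b p) H (k * (T + 1) + 1) fun H' => (∃ k', I k' H') ∧ ¬ Holds H' b := by
  intro k
  induction k using Nat.strong_induction_on with
  | _ k ih =>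
    intro H hI
    by_cases hb : Holds H b
    · obtain ⟨H₁, ⟨k', hk', hI'⟩, h₁⟩ := hp k H hI hb
      obtain ⟨H₂, hQ, h₂⟩ := ih k' hk' H₁ hI'
      refine ⟨H₂, hQ, fun σ hσ => ?_⟩
      obtain ⟨t₁, ht₁, σ₁, r₁, hσ₁⟩ := h₁ σ hσ
      obtain ⟨t₂, ht₂, σ₂, r₂, hσ₂⟩ := h₂ σ₁ hσ₁
      refine ⟨1 + t₁ + t₂, ?_, σ₂, .loop_true ((hσ.holds b).2 hb) r₁ r₂, hσ₂⟩
      have : (k' + 1) * (T + 1) ≤ k * (T + 1) := Nat.mul_le_mul_right _ hk'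
      rw [Nat.add_mul] at this
      omega
    · exact ⟨H, ⟨⟨k, hI⟩, hb⟩, fun σ hσ =>
        ⟨1, by omega, σ, .loop_false (fun h => hb ((hσ.holds b).1 h)), hσ⟩⟩

/-- The weakest precondition of a command without loops, including that no literal, sum, or address
leaves the range of the machine. The programs use only literals below `8`. -/
def wp (U : ℕ) : Cmd → (Store → Prop) → Store → Prop
  | .skip, Q, H => Q H
  | .const d c, Q, H => c < 8 ∧ Q (H.set d c)
  | .move d a, Q, H => Q (H.set d (H.r a))
  | .add d a b, Q, H => H.r a + H.r b < numArrays * U ∧ Q (H.set d (H.r a + H.r b))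
  | .sub d a b, Q, H => Q (H.set d (H.r a - H.r b))
  | .get d j i, Q, H => (j < numArrays ∧ H.r i < U) ∧ Q (H.set d (H.A j (H.r i)))
  | .put j i a, Q, H => (j < numArrays ∧ H.r i < U) ∧ Q (H.put j (H.r i) (H.r a))
  | .seq p q, Q, H => wp U p (wp U q Q) H
  | .cond b p q, Q, H => (Holds H b → wp U p Q H) ∧ (¬ Holds H b → wp U q Q H)
  | .loop _ _, _, _ => False

theorem wp.mono {c : Cmd} {Q Q' : Store → Prop} (hQ : ∀ H, Q H → Q' H) :
    ∀ {H : Store}, wp U c Q H → wp U c Q' H := by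
  induction c generalizing Q Q' with
  | skip => exact hQ _
  | const d c => exact fun h => ⟨h.1, hQ _ h.2⟩
  | move d a => exact hQ _
  | add d a b => exact fun h => ⟨h.1, hQ _ h.2⟩
  | sub d a b => exact hQ _
  | get d j i => exact fun h => ⟨h.1, hQ _ h.2⟩
  | put j i a => exact fun h => ⟨h.1, hQ _ h.2⟩
  | seq p q ihp ihq => exact ihp fun _ => ihq hQ
  | cond b p q ihp ihq => exact fun h => ⟨fun hb => ihp hQ (h.1 hb), fun hb => ihq hQ (h.2 hb)⟩
  | loop b p => exact id

/-- A bound on the number of steps of a command without loops. -/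
def cost : Cmd → ℕ
  | .skip => 1
  | .const _ _ => 1
  | .move _ _ => 1
  | .add _ _ _ => 1
  | .sub _ _ _ => 1
  | .get _ _ _ => 2
  | .put _ _ _ => 2
  | .seq p q => cost p + cost q
  | .cond _ p q => 1 + (cost p + cost q)
  | .loop _ _ => 0

/-- Assumptions on the word size that exclude overflows. -/
structure Fits (U w : ℕ) : Prop where
  pos : 0 < U
  le : numArrays * U ≤ 2 ^ w

theorem address_lt {j i : ℕ} (hj : j < numArrays) (hi : i < U) : j * U + i < numArrays * U := by
  have : (j + 1) * U ≤ numArrays * U := Nat.mul_le_mul_right _ hj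
  rw [Nat.add_mul] at this
  omega

theorem Rep.address (hU : Fits U w) {H : Store} {σ : RAM.State} (h : Rep U H σ) {j i : ℕ}
    (hj : j < numArrays) (hi : H.r i < U) :
    RAM.Instr.apply w σ (.add 1 (2 * j + 3) (2 * i)) = σ.setReg 1 (j * U + H.r i) := by
  simp only [RAM.Instr.apply, h.base j hj, h.reg]
  rw [Nat.mod_eq_of_lt ((address_lt hj hi).trans_le hU.le)]

theorem halts_of_wp (hU : Fits U w) (c : Cmd) :
    ∀ (H : Store) (Q : Store → Prop), wp U c Q H → Halts U w c H (cost c) Q := by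
  induction c with
  | skip => exact fun H Q h => ⟨H, h, fun σ hσ => ⟨1, le_rfl, σ, .skip σ, hσ⟩⟩
  | const d c =>
    rintro H Q ⟨hc, h⟩
    refine ⟨_, h, fun σ hσ => ⟨1, le_rfl, _, .instr _ σ, ?_⟩⟩
    have : c < 2 ^ w := by
      have h1 := hU.le
      have h2 := hU.pos
      have : numArrays * 1 ≤ numArrays * U := Nat.mul_le_mul_left _ h2
      simp only [numArrays] at *
      omega
    simpa [RAM.Instr.apply, Nat.mod_eq_of_lt this] using hσ.set d c
  | move d a =>
    intro H Q h
    refine ⟨_, h, fun σ hσ => ⟨1, le_rfl, _, .instr _ σ, ?_⟩⟩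
    simpa [RAM.Instr.apply, hσ.reg] using hσ.set d (H.r a)
  | add d a b =>
    rintro H Q ⟨hc, h⟩
    refine ⟨_, h, fun σ hσ => ⟨1, le_rfl, _, .instr _ σ, ?_⟩⟩
    have : H.r a + H.r b < 2 ^ w := hc.trans_le hU.le
    simpa [RAM.Instr.apply, hσ.reg, Nat.mod_eq_of_lt this] using hσ.set d (H.r a + H.r b)
  | sub d a b =>
    intro H Q h
    refine ⟨_, h, fun σ hσ => ⟨1, le_rfl, _, .instr _ σ, ?_⟩⟩
    simpa [RAM.Instr.apply, hσ.reg] using hσ.set d (H.r a - H.r b)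
  | get d j i =>
    rintro H Q ⟨⟨hj, hi⟩, h⟩
    refine ⟨_, h, fun σ hσ => ⟨2, le_rfl, _, .seq (.instr _ σ) (.instr _ _), ?_⟩⟩
    rw [hσ.address hU hj hi]
    have h1 : (σ.setReg 1 (j * U + H.r i)).mem (j * U + H.r i) = H.A j (H.r i) :=
      (hσ.setTmp _).mem j hj _ hi
    have h2 : (σ.setReg 1 (j * U + H.r i)).reg 1 = j * U + H.r i := by simp [RAM.State.setReg]
    simpa only [RAM.Instr.apply, h2, h1] using (hσ.setTmp _).set d (H.A j (H.r i))
  | put j i a =>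
    rintro H Q ⟨⟨hj, hi⟩, h⟩
    refine ⟨_, h, fun σ hσ => ⟨2, le_rfl, _, .seq (.instr _ σ) (.instr _ _), ?_⟩⟩
    rw [hσ.address hU hj hi]
    have h1 : (σ.setReg 1 (j * U + H.r i)).reg (2 * a) = H.r a := (hσ.setTmp _).reg a
    have h2 : (σ.setReg 1 (j * U + H.r i)).reg 1 = j * U + H.r i := by simp [RAM.State.setReg]
    simpa only [RAM.Instr.apply, h2, h1] using (hσ.setTmp (j * U + H.r i)).setMem (j := j) hi
        (H.r a)
  | seq p q ihp ihq =>
    intro H Q h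
    exact Halts.seq ((ihp H _ h).mono le_rfl fun H' h' => ihq H' _ h')
  | cond b p q ihp ihq =>
    rintro H Q ⟨h₁, h₂⟩
    exact Halts.cond (fun hb => (ihp H Q (h₁ hb)).mono (by omega) fun _ h => h)
      (fun hb => (ihq H Q (h₂ hb)).mono (by omega) fun _ h => h)
  | loop b p => exact fun H Q h => h.elim

end OddPath

namespace OddPath

/-! ### Depth-first search trees -/

/-- `Anc par t c v`: `c` is `v` or an ancestor of `v` in the tree with root `t` and parents `par`.
-/
inductive Anc (par : ℕ → ℕ) (t c : ℕ) : ℕ → Prop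
  | refl : Anc par t c c
  | step {v : ℕ} : v ≠ t → Anc par t c (par v) → Anc par t c v

section Anc

variable {par : ℕ → ℕ} {s t : ℕ}

theorem Anc.trans {b c v : ℕ} (h : Anc par t b c) (h' : Anc par t c v) : Anc par t b v := by
  induction h' with
  | refl => exact h
  | step hv _ ih => exact .step hv ih

theorem Anc.eq_or {c v : ℕ} (h : Anc par t c v) : c = v ∨ (v ≠ t ∧ Anc par t c (par v)) := by
  cases h with
  | refl => exact .inl rfl
  | step hv h => exact .inr ⟨hv, h⟩

theorem Anc.par_of_ne {c v : ℕ} (h : Anc par t c v) (hne : c ≠ v) : Anc par t c (par v) :=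
  (h.eq_or.resolve_left hne).2

theorem Anc.eq_root {c : ℕ} (h : Anc par t c t) : c = t :=
  h.eq_or.resolve_right fun h => h.1 rfl

/-- A proper ancestor `u` of `w` has a child towards `w`. -/
theorem Anc.exists_child {u w : ℕ} (h : Anc par t u w) (hne : u ≠ w) :
    ∃ c, c ≠ t ∧ par c = u ∧ Anc par t c w := by
  induction h with
  | refl => exact absurd rfl hne
  | @step v hv h ih =>
    by_cases hu : u = par v
    · exact ⟨v, hv, hu.symm, .refl⟩
    · obtain ⟨c, hc, hp, ha⟩ := ih hu
      exact ⟨c, hc, hp, .step hv ha⟩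

end Anc

/-- An undirected graph on natural numbers with edge labels. -/
structure Labelled (Adj : ℕ → ℕ → Prop) (L : ℕ → ℕ → ℕ) : Prop where
  symm : ∀ u v, Adj u v → Adj v u
  irrefl : ∀ u, ¬ Adj u u
  lsymm : ∀ u v, L u v = L v u
  le_one : ∀ u v, L u v ≤ 1

/-- A (possibly unfinished) depth-first search tree with root `t` that starts with a virtual tree
edge from `t` to `s`. The vertices with `vis v = 1` have been found, `cnt` many in the order `ord`,
the vertex `v` being number `pre v`; `par v` is its parent and `lab v` is the label of the edge
joining the two. -/
structure Tree (Adj : ℕ → ℕ → Prop) (L : ℕ → ℕ → ℕ) (s t : ℕ) (vis pre par ord lab : ℕ → ℕ)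
    (cnt : ℕ) : Prop where
  ne : s ≠ t
  vis_t : vis t = 1
  vis_s : vis s = 1
  par_s : par s = t
  pre_t : pre t = 0
  pre_s : pre s = 1
  vis_par : ∀ v, vis v = 1 → v ≠ t → vis (par v) = 1
  pre_par : ∀ v, vis v = 1 → v ≠ t → pre (par v) < pre v
  par_ne : ∀ v, vis v = 1 → v ≠ t → v ≠ s → par v ≠ t
  adj : ∀ v, vis v = 1 → v ≠ t → v ≠ s → Adj (par v) v
  lab_eq : ∀ v, vis v = 1 → v ≠ t → v ≠ s → lab v = L (par v) v
  ord_pre : ∀ v, vis v = 1 → ord (pre v) = v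
  pre_lt : ∀ v, vis v = 1 → pre v < cnt
  vis_ord : ∀ i < cnt, vis (ord i) = 1
  pre_ord : ∀ i < cnt, pre (ord i) = i
  /-- All edges join vertices of which one is an ancestor of the other. -/
  anc : ∀ u v, vis u = 1 → vis v = 1 → Adj u v → pre u < pre v → Anc par t u v
  /-- The vertices of a subtree are consecutive. -/
  contig : ∀ c v y, vis v = 1 → vis y = 1 → Anc par t c v → pre c ≤ pre y → pre y ≤ pre v →
    Anc par t c y

section Tree

variable {Adj : ℕ → ℕ → Prop} {L : ℕ → ℕ → ℕ} {s t : ℕ} {vis pre par ord lab : ℕ → ℕ} {cnt : ℕ}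

namespace Tree

variable (T : Tree Adj L s t vis pre par ord lab cnt)
include T

theorem pre_inj {u v : ℕ} (hu : vis u = 1) (hv : vis v = 1) (h : pre u = pre v) : u = v := by
  rw [← T.ord_pre u hu, ← T.ord_pre v hv, h]

theorem vis_anc {c v : ℕ} (h : Anc par t c v) (hv : vis v = 1) : vis c = 1 := by
  induction h with
  | refl => exact hv
  | step hne _ ih => exact ih (T.vis_par _ hv hne)

theorem pre_le_anc {c v : ℕ} (h : Anc par t c v) (hv : vis v = 1) : pre c ≤ pre v := by
  induction h with
  | refl => exact le_rfl
  | step hne _ ih => exact (ih (T.vis_par _ hv hne)).trans (T.pre_par _ hv hne).le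

theorem pre_lt_anc {c v : ℕ} (h : Anc par t c v) (hv : vis v = 1) (hne : c ≠ v) :
    pre c < pre v :=
  lt_of_le_of_ne (T.pre_le_anc h hv) fun h' => hne (T.pre_inj (T.vis_anc h hv) hv h')

theorem root_anc (v : ℕ) : ∀ (_ : vis v = 1), Anc par t t v := by
  induction hk : pre v using Nat.strong_induction_on generalizing v with
  | _ k ih =>
    intro hv
    by_cases hne : v = t
    · exact hne ▸ .refl
    · exact .step hne (ih _ (hk ▸ T.pre_par v hv hne) _ rfl (T.vis_par v hv hne))

/-- The ancestors of a vertex form a chain. -/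
theorem anc_of_anc {c d v : ℕ} (hv : vis v = 1) (hc : Anc par t c v) (hd : Anc par t d v)
    (h : pre c ≤ pre d) : Anc par t c d :=
  T.contig c v d hv (T.vis_anc hd hv) hc h (T.pre_le_anc hd hv)

theorem anc_s {c : ℕ} (h : Anc par t c s) : c = s ∨ c = t := by
  rcases h.eq_or with h | ⟨_, h⟩
  · exact .inl h
  · rw [T.par_s] at h
    exact .inr h.eq_root

end Tree

/-! ### Lowpoints -/

/-- `low v` is the number of the first vertex that is reachable from `v` along tree edges away from
the root and one further edge, which is not the tree edge above its end. A path that attains `low v`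
starts with the vertex `dn v`, and the sum of its labels is `g v` modulo `2`. -/
structure Low (Adj : ℕ → ℕ → Prop) (L : ℕ → ℕ → ℕ) (s t : ℕ) (vis pre par lab : ℕ → ℕ)
    (low dn g : ℕ → ℕ) : Prop where
  attained : ∀ v, vis v = 1 → v ≠ t → v ≠ s → low v < pre v →
    (vis (dn v) = 1 ∧ Adj v (dn v) ∧ pre (dn v) = low v ∧ g v = L v (dn v)) ∨
    (vis (dn v) = 1 ∧ dn v ≠ t ∧ dn v ≠ s ∧ par (dn v) = v ∧ low (dn v) = low v ∧
      g v = (g (dn v) + lab (dn v)) % 2)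
  back : ∀ v u, vis v = 1 → vis u = 1 → v ≠ t → v ≠ s → Adj v u → pre u < pre v → u ≠ par v →
    low v ≤ pre u
  child : ∀ c, vis c = 1 → c ≠ t → c ≠ s → par c ≠ s → low (par c) ≤ low c

variable {low dn g : ℕ → ℕ}

namespace Low

variable (hG : Labelled Adj L) (T : Tree Adj L s t vis pre par ord lab cnt)
  (hL : Low Adj L s t vis pre par lab low dn g)
include hG T hL

theorem anc_ord {v : ℕ} : ∀ (_ : vis v = 1) (_ : v ≠ t) (_ : v ≠ s) (_ : low v < pre v),
    Anc par t (ord (low v)) v := by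
  induction hk : cnt - pre v using Nat.strong_induction_on generalizing v with
  | _ k ih =>
    intro hv ht hs hlt
    rcases hL.attained v hv ht hs hlt with ⟨hd, ha, hp, -⟩ | ⟨hd, hdt, hds, hp, hl, -⟩
    · have := T.ord_pre _ hd
      rw [hp] at this
      rw [this]
      refine T.anc _ _ hd hv ?_ (by omega)
      exact hG.symm _ _ ha
    · have h1 := T.pre_par _ hd hdt
      have h2 := T.pre_lt _ hd
      rw [hp] at h1
      have h3 := ih _ (by omega) rfl hd hdt hds (by omega)
      rw [hl] at h3
      have h4 := h3.par_of_ne (fun h => by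
        have := T.pre_ord (low v) (by omega)
        rw [h] at this
        omega)
      rwa [hp] at h4

omit hG in
theorem le_of_anc {c v : ℕ} (h : Anc par t c v) (hv : vis v = 1) (hct : c ≠ t) (hcs : c ≠ s) :
    low c ≤ low v := by
  induction h with
  | refl => exact le_rfl
  | @step v hne h ih =>
    have hs : v ≠ s := fun h' => by
      rcases h.eq_or with h1 | h1
      · rw [h', T.par_s] at h1
        exact hct h1
      · rw [h', T.par_s] at h1
        exact h1.1 rfl
    refine (ih (T.vis_par v hv hne)).trans (hL.child v hv hne hs fun h' => ?_)
    rw [h'] at h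
    rcases T.anc_s h with h | h
    · exact hcs h
    · exact hct h

end Low

end Tree

end OddPath

namespace OddPath

/-! ### Bipolar orders -/

/-- The set of the vertices `v` with `inS v = 1` contains all `s`-`t`-paths. It is arranged in an
order with minimum `s` and maximum `t` such that every other vertex `v` has a smaller neighbour `lo
v` and a greater neighbour `hi v`. Along these, `s` and `t` are reached by paths whose sums of
labels are `a v` and `b v` modulo `2`. The order is given by `sd v`, which is `1` if `v` precedes
its parent, and `0` if `v` follows it. -/
structure Bipolar (s t : ℕ) (vis pre par ord lab : ℕ → ℕ) (low dn g : ℕ → ℕ)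
    (inS sd lo hi a b : ℕ → ℕ) : Prop where
  root : inS t = 1
  source : inS s = 1
  found : ∀ v, inS v = 1 → vis v = 1
  iff : ∀ v, vis v = 1 → v ≠ t → v ≠ s → (inS v = 1 ↔ inS (par v) = 1 ∧ low v < pre (par v))
  ptr : ∀ v, inS v = 1 → v ≠ t → v ≠ s →
    (sd v = 1 ∧ hi v = par v ∧ lo v = dn v ∧ b v = (b (par v) + lab v) % 2 ∧
      a v = (a (ord (low v)) + g v) % 2) ∨
    (sd v = 0 ∧ lo v = par v ∧ hi v = dn v ∧ a v = (a (par v) + lab v) % 2 ∧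
      b v = (b (ord (low v)) + g v) % 2)
  /-- The path from `v` through `dn v` leads to the other side of `v` than its parent: `v` lies
  between its parent and the vertex in which that path ends. -/
  side : ∀ v c, inS v = 1 → v ≠ t → v ≠ s → c ≠ t → Anc par t c (par v) → par c = ord (low v) →
    (sd v = 1 ↔ sd c ≠ 1)
  sd_s : sd s = 1
  a_s : a s = 0
  a_t : a t = 0
  b_t : b t = 0

section Pos

open Classical in
/-- The position of a vertex in the bipolar order: the vertex number `k` is placed at distance
`3⁻ᵏ` from its parent, on the side that `sd` prescribes. So its descendants are on that side too. -/
noncomputable def pos (par ord sd : ℕ → ℕ) (t cnt v : ℕ) : ℚ :=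
  ∑ k ∈ (Finset.range cnt).filter (fun k => ord k ≠ t ∧ Anc par t (ord k) v),
    (if sd (ord k) = 1 then -1 else 1) * (1 / 3) ^ k

variable {Adj : ℕ → ℕ → Prop} {L : ℕ → ℕ → ℕ} {s t : ℕ} {vis pre par ord lab : ℕ → ℕ} {cnt : ℕ}
variable {low dn g inS sd lo hi a b : ℕ → ℕ}

section

variable (T : Tree Adj L s t vis pre par ord lab cnt)
include T

theorem pos_eq {v : ℕ} (hv : vis v = 1) (hne : v ≠ t) :
    pos par ord sd t cnt v =
      pos par ord sd t cnt (par v) + (if sd v = 1 then -1 else 1) * (1 / 3) ^ pre v := by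
  classical
  have h1 : (Finset.range cnt).filter (fun k => ord k ≠ t ∧ Anc par t (ord k) v) =
      insert (pre v)
        ((Finset.range cnt).filter (fun k => ord k ≠ t ∧ Anc par t (ord k) (par v))) := by
    ext k
    simp only [Finset.mem_filter, Finset.mem_range, Finset.mem_insert]
    constructor
    · rintro ⟨hk, h2, h3⟩
      rcases h3.eq_or with h | h
      · left
        rw [← h, T.pre_ord k hk]
      · exact .inr ⟨hk, h2, h.2⟩
    · rintro (rfl | ⟨hk, h2, h3⟩)
      · rw [T.ord_pre v hv]
        exact ⟨T.pre_lt v hv, hne, .refl⟩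
      · exact ⟨hk, h2, .step hne h3⟩
  have h2 : pre v ∉
      (Finset.range cnt).filter (fun k => ord k ≠ t ∧ Anc par t (ord k) (par v)) := by
    simp only [Finset.mem_filter, T.ord_pre v hv, not_and]
    intro _ _ h
    have := T.pre_le_anc h (T.vis_par v hv hne)
    have := T.pre_par v hv hne
    omega
  rw [pos, h1, Finset.sum_insert h2, T.ord_pre v hv, add_comm]
  rfl

theorem pos_near {c y : ℕ} (h : Anc par t c y) (hy : vis y = 1) :
    |pos par ord sd t cnt y - pos par ord sd t cnt c| ≤
      ((1 / 3) ^ pre c - (1 / 3) ^ pre y) / 2 := by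
  induction h with
  | refl => simp
  | @step y hne h ih =>
    have h1 := ih (T.vis_par y hy hne)
    rw [pos_eq T hy hne]
    have h2 : ((1 : ℚ) / 3) ^ pre y ≤ (1 / 3) ^ pre (par y) / 3 := by
      have h3 : ((1 : ℚ) / 3) ^ pre y ≤ (1 / 3) ^ (pre (par y) + 1) :=
        pow_le_pow_of_le_one (by norm_num) (by norm_num) (T.pre_par y hy hne)
      rw [pow_succ] at h3
      linarith
    rw [abs_le] at h1 ⊢
    have h4 : (0 : ℚ) ≤ (1 / 3) ^ pre y := by positivity
    split_ifs <;> constructor <;> linarith [h1.1, h1.2]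

/-- The subtree of `c` lies on one side of the parent of `c`. -/
theorem pos_lt_par {c y : ℕ} (h : Anc par t c y) (hy : vis y = 1) (hne : c ≠ t) (hs : sd c = 1) :
    pos par ord sd t cnt y < pos par ord sd t cnt (par c) := by
  have h1 := pos_near (sd := sd) T h hy
  have h2 := pos_eq (sd := sd) T (T.vis_anc h hy) hne
  rw [if_pos hs] at h2
  have h3 : (0 : ℚ) < (1 / 3) ^ pre c := by positivity
  have h4 : (0 : ℚ) < (1 / 3) ^ pre y := by positivity
  rw [abs_le] at h1
  linarith [h1.1, h1.2]

theorem par_lt_pos {c y : ℕ} (h : Anc par t c y) (hy : vis y = 1) (hne : c ≠ t) (hs : sd c ≠ 1) :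
    pos par ord sd t cnt (par c) < pos par ord sd t cnt y := by
  have h1 := pos_near (sd := sd) T h hy
  have h2 := pos_eq (sd := sd) T (T.vis_anc h hy) hne
  rw [if_neg hs] at h2
  have h3 : (0 : ℚ) < (1 / 3) ^ pre c := by positivity
  have h4 : (0 : ℚ) < (1 / 3) ^ pre y := by positivity
  rw [abs_le] at h1
  linarith [h1.1, h1.2]

end

namespace Bipolar

variable (hG : Labelled Adj L) (T : Tree Adj L s t vis pre par ord lab cnt)
  (hL : Low Adj L s t vis pre par lab low dn g)
  (B : Bipolar s t vis pre par ord lab low dn g inS sd lo hi a b)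

include T B in
theorem inS_par {v : ℕ} (hv : inS v = 1) (hne : v ≠ t) : inS (par v) = 1 := by
  by_cases hs : v = s
  · rw [hs, T.par_s]
    exact B.root
  · exact ((B.iff v (B.found v hv) hne hs).1 hv).1

include T B in
theorem inS_anc {c v : ℕ} (h : Anc par t c v) (hv : inS v = 1) : inS c = 1 := by
  induction h with
  | refl => exact hv
  | step hne _ ih => exact ih (B.inS_par T hv hne)

include T B in
theorem pos_lt_root {v : ℕ} (hv : vis v = 1) (hne : v ≠ t) :
    pos par ord sd t cnt v < pos par ord sd t cnt t := by
  obtain ⟨c, hc, hp, ha⟩ := (T.root_anc v hv).exists_child (Ne.symm hne)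
  have hcs : c = s := by
    by_contra h
    exact T.par_ne c (T.vis_anc ha hv) hc h hp
  have h := pos_lt_par (sd := sd) T ha hv hc (by rw [hcs, B.sd_s])
  rwa [hp] at h

section

include hG T hL B

/-- The neighbour `dn v` lies on the other side of `v` than the parent of `v`. -/
theorem dn_spec {v : ℕ} (hv : inS v = 1) (ht : v ≠ t) (hs : v ≠ s) :
    inS (dn v) = 1 ∧ Adj v (dn v) ∧
      (sd v = 1 → pos par ord sd t cnt (dn v) < pos par ord sd t cnt v) ∧
      (sd v ≠ 1 → pos par ord sd t cnt v < pos par ord sd t cnt (dn v)) ∧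
      (sd v = 1 → a v = (a (ord (low v)) + g v) % 2 → (a v + a (dn v) + L v (dn v)) % 2 = 0) ∧
      (sd v ≠ 1 → b v = (b (ord (low v)) + g v) % 2 →
        (b v + b (dn v) + L v (dn v)) % 2 = 0) := by
  have hvis := B.found v hv
  obtain ⟨hq, hlow⟩ := (B.iff v hvis ht hs).1 hv
  have hqvis := B.found _ hq
  have hpq := T.pre_par v hvis ht
  have hlt : low v < pre v := by omega
  have hxo := T.pre_ord (low v) (by have := T.pre_lt v hvis; omega)
  have hxv := hL.anc_ord hG T hvis ht hs hlt
  have hxq : Anc par t (ord (low v)) (par v) := hxv.par_of_ne fun h => by rw [h] at hxo; omega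
  obtain ⟨c, hct, hcp, hcq⟩ := hxq.exists_child fun h => by rw [h] at hxo; omega
  have hcv : Anc par t c v := .step ht hcq
  have hcS := B.inS_anc T hcv hv
  have hside := B.side v c hv ht hs hct hcq hcp
  have hxS : inS (ord (low v)) = 1 := hcp ▸ B.inS_par T hcS hct
  rcases hL.attained v hvis ht hs hlt with ⟨hd, hda, hdp, hdg⟩ | ⟨hd, hdt, hds, hdp, hdl, hdg⟩
  · have hx : ord (low v) = dn v := by rw [← hdp, T.ord_pre _ hd]
    rw [hx] at hxS hcp
    rw [hx]
    refine ⟨hxS, hda, fun h => ?_, fun h => ?_, fun h h' => ?_, fun h h' => ?_⟩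
    · rw [← hcp]
      exact par_lt_pos T hcv hvis hct (hside.1 h)
    · rw [← hcp]
      exact pos_lt_par T hcv hvis hct (by_contra fun h' => h (hside.2 h'))
    · clear * - h' hdg
      omega
    · clear * - h' hdg
      omega
  · have hdS : inS (dn v) = 1 := (B.iff _ hd hdt hds).2 ⟨by rw [hdp]; exact hv, by
      rw [hdp, hdl]; exact hlt⟩
    have hside' := B.side (dn v) c hdS hdt hds hct (by rwa [hdp]) (by rw [hdl, hcp])
    have hadj := T.adj _ hd hdt hds
    have hlab' := T.lab_eq _ hd hdt hds
    have hptr := B.ptr _ hdS hdt hds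
    rw [hdp] at hadj hlab'
    rw [hdl] at hptr
    refine ⟨hdS, hadj, fun h => ?_, fun h => ?_, fun h h' => ?_, fun h h' => ?_⟩
    · have := pos_lt_par (sd := sd) T (.refl (c := dn v)) hd hdt (hside'.2 (hside.1 h))
      rwa [hdp] at this
    · have := par_lt_pos (sd := sd) T (.refl (c := dn v)) hd hdt
        fun h' => h (hside.2 (hside'.1 h'))
      rwa [hdp] at this
    · have h1 : sd (dn v) = 1 := hside'.2 (hside.1 h)
      rcases hptr with ⟨-, -, -, -, h2⟩ | ⟨h2, -⟩
      · clear * - h2 h' hdg hlab'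
        omega
      · omega
    · have h1 : sd (dn v) ≠ 1 := fun h' => h (hside.2 (hside'.1 h'))
      rcases hptr with ⟨h2, -⟩ | ⟨-, -, -, -, h2⟩
      · exact absurd h2 h1
      · clear * - h2 h' hdg hlab'
        omega

/-- The pointers `lo` and `hi` go down and up in the bipolar order, along edges that change `a` and
`b` by their labels. -/
theorem ptr_spec {v : ℕ} (hv : inS v = 1) (ht : v ≠ t) (hs : v ≠ s) :
    (inS (lo v) = 1 ∧ Adj (lo v) v ∧ pos par ord sd t cnt (lo v) < pos par ord sd t cnt v ∧
      (a v + a (lo v) + L (lo v) v) % 2 = 0) ∧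
    (inS (hi v) = 1 ∧ Adj v (hi v) ∧ pos par ord sd t cnt v < pos par ord sd t cnt (hi v) ∧
      (b v + b (hi v) + L v (hi v)) % 2 = 0) := by
  have hvis := B.found v hv
  have hq := ((B.iff v hvis ht hs).1 hv).1
  have hqadj := T.adj v hvis ht hs
  have hlab := T.lab_eq v hvis ht hs
  obtain ⟨h1, h2, h3, h4, h5, h6⟩ := B.dn_spec hG T hL hv ht hs
  have hl := hG.lsymm v (par v)
  have hl' := hG.lsymm v (dn v)
  rcases B.ptr v hv ht hs with ⟨hsd, hhi, hlo, hb, ha⟩ | ⟨hsd, hlo, hhi, ha, hb⟩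
  · rw [hhi, hlo]
    have h7 := h5 hsd ha
    refine ⟨⟨h1, hG.symm _ _ h2, h3 hsd, ?_⟩,
      ⟨hq, hG.symm _ _ hqadj, pos_lt_par T .refl hvis ht hsd, ?_⟩⟩
    · rw [← hl']
      exact h7
    · clear * - hb hlab hl
      omega
  · have hsd' : sd v ≠ 1 := by omega
    rw [hhi, hlo]
    refine ⟨⟨hq, hqadj, par_lt_pos T .refl hvis ht hsd', ?_⟩, ⟨h1, h2, h4 hsd', h6 hsd' hb⟩⟩
    clear * - ha hlab
    omega

end

include hG T hL in
/-- An edge that leaves a subtree whose lowpoint is not above the parent of its root ends in that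
parent. -/
theorem exit_subtree {c y z : ℕ} (hy : vis y = 1) (hz : vis z = 1) (hct : c ≠ t) (hcs : c ≠ s)
    (hlow : pre (par c) ≤ low c) (hcy : Anc par t c y) (hyz : Adj y z) :
    Anc par t c z ∨ z = par c := by
  have hyt : y ≠ t := fun h => hct (by rw [h] at hcy; exact hcy.eq_root)
  have hys : y ≠ s := fun h => by
    rw [h] at hcy
    exact (T.anc_s hcy).elim hcs hct
  rcases lt_trichotomy (pre y) (pre z) with h | h | h
  · exact .inl (hcy.trans (T.anc y z hy hz hyz h))
  · rw [T.pre_inj hy hz h] at hyz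
    exact (hG.irrefl _ hyz).elim
  · have hzy := T.anc z y hz hy (hG.symm _ _ hyz) h
    have hc := T.vis_anc hcy hy
    rcases le_or_gt (pre c) (pre z) with h' | h'
    · exact .inl (T.anc_of_anc hy hcy hzy h')
    · right
      have hzc := T.anc_of_anc hy hzy hcy h'.le
      have hzp := hzc.par_of_ne fun h => by rw [h] at h'; exact lt_irrefl _ h'
      by_contra hne
      have h1 := T.pre_lt_anc hzp (T.vis_par c hc hct) hne
      have h2 := hL.le_of_anc T hcy hy hct hcs
      have h3 := hL.back y z hy hz hyt hys hyz h fun h4 => by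
        rcases hcy.eq_or with h5 | h5
        · rw [h5] at hne
          exact hne h4
        · rw [← h4] at h5
          have := T.pre_le_anc h5.2 hz
          omega
      omega

include T B in
/-- A found vertex outside the set lies in a subtree that hangs from a vertex of the set and has
no other connection to it. -/
theorem exists_hanging {y : ℕ} (hy : vis y = 1) (hyS : inS y ≠ 1) :
    ∃ c, Anc par t c y ∧ c ≠ t ∧ c ≠ s ∧ inS c ≠ 1 ∧ pre (par c) ≤ low c := by
  induction hk : pre y using Nat.strong_induction_on generalizing y with
  | _ k ih =>
    have hyt : y ≠ t := fun h => hyS (h ▸ B.root)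
    have hys : y ≠ s := fun h => hyS (h ▸ B.source)
    by_cases hp : inS (par y) = 1
    · refine ⟨y, .refl, hyt, hys, hyS, ?_⟩
      by_contra h
      exact hyS ((B.iff y hy hyt hys).2 ⟨hp, by omega⟩)
    · obtain ⟨c, hc, h⟩ := ih _ (hk ▸ T.pre_par y hy hyt) (T.vis_par y hy hyt) hp rfl
      exact ⟨c, .step hyt hc, h⟩

end Bipolar

end Pos

end OddPath

namespace OddPath

/-! ### Paths in the graph -/

variable {n : ℕ}

/-- Adjacency in `G` of vertices given as numbers. -/
def NatAdj (G : SimpleGraph (Fin n)) (u v : ℕ) : Prop :=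
  ∃ (hu : u < n) (hv : v < n), G.Adj ⟨u, hu⟩ ⟨v, hv⟩

open Classical in
/-- The label of a pair of vertices given as numbers: `1` for the edges from `F`. -/
noncomputable def natLabel (F : Finset (Sym2 (Fin n))) (u v : ℕ) : ℕ :=
  if ∃ (hu : u < n) (hv : v < n), s(⟨u, hu⟩, ⟨v, hv⟩) ∈ F then 1 else 0

theorem natAdj_val {G : SimpleGraph (Fin n)} {u v : Fin n} : NatAdj G u v ↔ G.Adj u v := by
  simp [NatAdj]

theorem natLabel_val {F : Finset (Sym2 (Fin n))} {u v : Fin n} :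
    natLabel F u v = if s(u, v) ∈ F then 1 else 0 := by
  simp [natLabel]

theorem labelled (G : SimpleGraph (Fin n)) (F : Finset (Sym2 (Fin n))) :
    Labelled (NatAdj G) (natLabel F) where
  symm := fun _ _ ⟨hu, hv, h⟩ => ⟨hv, hu, h.symm⟩
  irrefl := fun _ ⟨_, _, h⟩ => G.irrefl h
  lsymm u v := by
    have : (∃ (hu : u < n) (hv : v < n), s(⟨u, hu⟩, ⟨v, hv⟩) ∈ F) ↔
        ∃ (hv : v < n) (hu : u < n), s(⟨v, hv⟩, ⟨u, hu⟩) ∈ F :=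
      ⟨fun ⟨hu, hv, h⟩ => ⟨hv, hu, Sym2.eq_swap ▸ h⟩, fun ⟨hu, hv, h⟩ => ⟨hv, hu, Sym2.eq_swap ▸ h⟩⟩
    simp only [natLabel, this]
  le_one u v := by
    unfold natLabel
    split_ifs <;> simp

theorem isOddPath_iff {G : SimpleGraph (Fin n)} {F : Finset (Sym2 (Fin n))} {s t : Fin n}
    (p : G.Walk s t) : IsOddPath F p ↔ p.IsPath ∧ (p.edges.countP (· ∈ F)) % 2 = 1 := by
  unfold IsOddPath
  refine and_congr_right fun hp => ?_
  have h1 : F.filter (fun e => e ∈ p.edges) = (p.edges.filter (· ∈ F)).toFinset := by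
    ext e
    simp [and_comm]
  rw [h1, List.toFinset_card_of_nodup (hp.isTrail.edges_nodup.filter _),
    ← List.countP_eq_length_filter, Nat.odd_iff]

section

variable {G : SimpleGraph (Fin n)} {F : Finset (Sym2 (Fin n))} {s t : ℕ}
  {vis pre par ord lab : ℕ → ℕ} {cnt : ℕ} {low dn g inS sd lo hi a b : ℕ → ℕ}
  (T : Tree (NatAdj G) (natLabel F) s t vis pre par ord lab cnt)
  (hL : Low (NatAdj G) (natLabel F) s t vis pre par lab low dn g)
  (B : Bipolar s t vis pre par ord lab low dn g inS sd lo hi a b)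
  (hcl : ∀ v u, vis v = 1 → v ≠ t → NatAdj G v u → vis u = 1)

include T hL hcl in
theorem root_not_mem_subtree_walk {c : ℕ} (hct : c ≠ t) (hcs : c ≠ s)
    (hlow : pre (par c) ≤ low c) {y z : Fin n} (p : G.Walk y z) :
    ∀ (_ : vis y = 1) (_ : Anc par t c y) (_ : ∀ x ∈ p.support, (x : ℕ) ≠ par c),
      (z : ℕ) ≠ t := by
  induction p with
  | nil => exact fun _ hc _ h => hct (by rw [h] at hc; exact hc.eq_root)
  | @cons y x z hadj p ih =>
    intro hy hc hp
    have hyt : (y : ℕ) ≠ t := fun h => hct (by rw [h] at hc; exact hc.eq_root)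
    have hadj' := natAdj_val.2 hadj
    have hx := hcl _ _ hy hyt hadj'
    rcases Bipolar.exit_subtree (labelled G F) T hL hy hx hct hcs hlow hc hadj' with h | h
    · exact ih hx h fun x hx => hp x (by simp [hx])
    · exact absurd h (hp x (by simp))

include T hL B hcl in
/-- If `a` is a potential for the labels on the set of the bipolar order, then the parity of a path
to `t` that starts in this set is given by `a`: the path cannot leave the set, because it could
return only through the vertex in which it left. -/
theorem countP_of_potential
    (hpot : ∀ u v, inS u = 1 → inS v = 1 → NatAdj G u v → (a u + a v + natLabel F u v) % 2 = 0)
    {x z : Fin n} (p : G.Walk x z) :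
    ∀ (_ : (z : ℕ) = t) (_ : p.IsPath) (_ : inS x = 1),
      (p.edges.countP (· ∈ F) + a x) % 2 = 0 := by
  induction p with
  | nil =>
    intro h _ _
    simp [h, B.a_t]
  | @cons x y z hadj p ih =>
    intro hz hp hx
    rw [SimpleGraph.Walk.cons_isPath_iff] at hp
    have hxt : (x : ℕ) ≠ t := fun h =>
      hp.2 (by rw [Fin.ext (h.trans hz.symm)]; exact p.end_mem_support)
    have hadj' := natAdj_val.2 hadj
    have hy := hcl _ _ (B.found _ hx) hxt hadj'
    by_cases hyS : inS y = 1
    · have h1 := ih hz hp.1 hyS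
      have h2 := hpot _ _ hx hyS hadj'
      rw [natLabel_val] at h2
      simp only [SimpleGraph.Walk.edges_cons, List.countP_cons, decide_eq_true_eq]
      split_ifs at h2 ⊢ <;> omega
    · obtain ⟨c, hc, hct, hcs, hcS, hlow⟩ := B.exists_hanging T hy hyS
      have hxc : ¬ Anc par t c x := fun h => hcS (B.inS_anc T h hx)
      have hxp := (Bipolar.exit_subtree (labelled G F) T hL hy (B.found _ hx) hct hcs hlow hc
        ((labelled G F).symm _ _ hadj')).resolve_left hxc
      refine absurd hz (root_not_mem_subtree_walk T hL hcl hct hcs hlow p hy hc ?_)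
      intro u hu h
      rw [← hxp] at h
      exact hp.2 (Fin.ext h ▸ hu)

end

/-- The sum of the labels of the consecutive pairs in a list. -/
def labelSum (L : ℕ → ℕ → ℕ) : List ℕ → ℕ
  | u :: v :: l => L u v + labelSum L (v :: l)
  | _ => 0

theorem labelSum_concat (L : ℕ → ℕ → ℕ) (l : List ℕ) (u v : ℕ) :
    labelSum L (l ++ [u] ++ [v]) = labelSum L (l ++ [u]) + L u v := by
  induction l with
  | nil => simp [labelSum]
  | cons x l ih =>
    cases l with
    | nil => simp [labelSum]
    | cons y l =>
      simp only [List.cons_append, labelSum] at ih ⊢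
      omega

theorem exists_walk_of_chain {G : SimpleGraph (Fin n)} {F : Finset (Sym2 (Fin n))} (l : List ℕ) :
    ∀ (s t : Fin n), l.IsChain (NatAdj G) → l.head? = some (s : ℕ) →
      l.getLast? = some (t : ℕ) → ∃ p : G.Walk s t, p.support.map Fin.val = l ∧
        p.edges.countP (· ∈ F) = labelSum (natLabel F) l := by
  induction l with
  | nil => simp
  | cons u l ih =>
    intro s t hc hs ht
    simp only [List.head?_cons, Option.some.injEq] at hs
    subst hs
    cases l with
    | nil =>
      simp only [List.getLast?_singleton, Option.some.injEq] at ht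
      obtain rfl := Fin.ext ht
      exact ⟨.nil, by simp [labelSum]⟩
    | cons v l =>
      rw [List.isChain_cons_cons] at hc
      obtain ⟨hsv, hv, hadj⟩ := hc.1
      obtain ⟨p, hp, hp'⟩ := ih ⟨v, hv⟩ t hc.2 (by simp) (by simpa using ht)
      refine ⟨.cons hadj p, by simp [hp], ?_⟩
      have := natLabel_val (F := F) (u := s) (v := ⟨v, hv⟩)
      simp only at this
      simp only [SimpleGraph.Walk.edges_cons, List.countP_cons, decide_eq_true_eq, labelSum, hp',
        this]
      omega

/-- A list that increases in some order and whose consecutive entries are joined by edges is an odd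
path, if its sum of labels is odd. -/
theorem isCorrectOutput_of_chain {G : SimpleGraph (Fin n)} {F : Finset (Sym2 (Fin n))} {s t : Fin n}
    {l : List ℕ} (f : ℕ → ℚ) (hc : l.IsChain fun u v => NatAdj G u v ∧ f u < f v)
    (hs : l.head? = some (s : ℕ)) (ht : l.getLast? = some (t : ℕ))
    (hl : labelSum (natLabel F) l % 2 = 1) : IsCorrectOutput G F s t l := by
  obtain ⟨p, hp, hp'⟩ := exists_walk_of_chain (F := F) l s t (hc.imp fun _ _ h => h.1) hs ht
  refine .inl ⟨p, (isOddPath_iff p).2 ⟨?_, by rw [hp', hl]⟩, hp.symm⟩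
  have h1 : (l.map f).IsChain (· < ·) := by
    rw [List.isChain_map]
    exact hc.imp fun _ _ h => h.2
  have h2 : l.Nodup := List.Nodup.of_map f (h1.pairwise.imp fun h => ne_of_lt h)
  rw [← hp] at h2
  exact SimpleGraph.Walk.IsPath.mk' h2.of_map

end OddPath

namespace OddPath

/-! ### The input of the program and adjacency lists -/

/-!
The arrays are `0` input, `1` head of the adjacency list of a vertex, `2` target, `3` label and `4`
successor of a record in an adjacency list, `5` next record of a vertex to be considered, `6` found,
`7` number, `8` parent, `9` vertex with a given number, `10` label of the edge to the parent, `11`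
lowpoint, `12` first vertex and `13` label sum of a path that attains the lowpoint, `14` membership
in the bipolar order, `15` sign, `16` smaller and `17` greater neighbour in that order, `18` and
`19` label sums of the paths along these neighbours to `s` and to `t`, `20` output, `21` side of the
parent. Each has `4 * (n + m + 1)` entries, enough for the `4 + 3 * m` words of the input, for
`2 * m + 1` records, and for the output, which starts in the middle of `2 * n + 2` entries and grows
in both directions.
-/

/-- The edge number `i < m` joins `e₁ i` and `e₂ i` and has label `ef i`, and there are no other
edges. -/
structure Instance (Adj : ℕ → ℕ → Prop) (L : ℕ → ℕ → ℕ) (n m s t : ℕ) (e₁ e₂ ef : ℕ → ℕ) :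
    Prop where
  graph : Labelled Adj L
  s_lt : s < n
  t_lt : t < n
  ne : s ≠ t
  lt : ∀ u v, Adj u v → u < n
  adj : ∀ i < m, Adj (e₁ i) (e₂ i)
  lab : ∀ i < m, ef i = L (e₁ i) (e₂ i)
  cover : ∀ u v, Adj u v → ∃ i < m, (e₁ i = u ∧ e₂ i = v) ∨ (e₁ i = v ∧ e₂ i = u)

/-- What never changes: the variables `0`, …, `6` hold `0`, `n`, `m`, `s`, `t`, `0`, `1`, and array
`0` holds the input. -/
structure Const (n m s t : ℕ) (e₁ e₂ ef : ℕ → ℕ) (H : Store) : Prop where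
  r₀ : H.r 0 = 0
  r₁ : H.r 1 = n
  r₂ : H.r 2 = m
  r₃ : H.r 3 = s
  r₄ : H.r 4 = t
  zero : H.r 5 = 0
  one : H.r 6 = 1
  fst : ∀ i < m, H.A 0 (4 + 3 * i) = e₁ i
  snd : ∀ i < m, H.A 0 (4 + 3 * i + 1) = e₂ i
  flag : ∀ i < m, H.A 0 (4 + 3 * i + 2) = ef i

variable {Adj : ℕ → ℕ → Prop} {L : ℕ → ℕ → ℕ} {n m s t : ℕ} {e₁ e₂ ef : ℕ → ℕ} {U w : ℕ}

@[simp] theorem Const.set_iff {H : Store} {d x : ℕ} (hd : 7 ≤ d) :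
    Const n m s t e₁ e₂ ef (H.set d x) ↔ Const n m s t e₁ e₂ ef H := by
  have h : ∀ y < 7, (H.set d x).r y = H.r y := fun y hy => by
    rw [Store.set_r, if_neg (by omega)]
  constructor
  · rintro ⟨h0, h1, h2, h3, h4, h5, h6, h7, h8, h9⟩
    rw [h _ (by norm_num)] at h0 h1 h2 h3 h4 h5 h6
    exact ⟨h0, h1, h2, h3, h4, h5, h6, h7, h8, h9⟩
  · rintro ⟨h0, h1, h2, h3, h4, h5, h6, h7, h8, h9⟩
    rw [← h _ (by norm_num)] at h0 h1 h2 h3 h4 h5 h6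
    exact ⟨h0, h1, h2, h3, h4, h5, h6, h7, h8, h9⟩

@[simp] theorem Const.put_iff {H : Store} {j i x : ℕ} (hj : 0 < j) :
    Const n m s t e₁ e₂ ef (H.put j i x) ↔ Const n m s t e₁ e₂ ef H := by
  have h : (H.put j i x).A 0 = H.A 0 := by rw [Store.put_A, if_neg (by omega)]
  constructor
  · rintro ⟨h0, h1, h2, h3, h4, h5, h6, h7, h8, h9⟩
    rw [h] at h7 h8 h9
    exact ⟨h0, h1, h2, h3, h4, h5, h6, h7, h8, h9⟩
  · rintro ⟨h0, h1, h2, h3, h4, h5, h6, h7, h8, h9⟩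
    rw [← h] at h7 h8 h9
    exact ⟨h0, h1, h2, h3, h4, h5, h6, h7, h8, h9⟩

/-- Read the edge number `i`, `i` being variable `8`, from the input into the variables `9`, `10`
(ends) and `11` (label), and increment `i`; variable `7` is the position in the input. -/
def readEdge : Cmd :=
  .get 9 0 7 ;; .add 7 7 6 ;; .get 10 0 7 ;; .add 7 7 6 ;; .get 11 0 7 ;; .add 7 7 6 ;; .add 8 8 6

theorem wp_readEdge {c : Cmd} {Q : Store → Prop} {H : Store} {i : ℕ}
    (hU : 4 * (n + m + 1) = U) (hC : Const n m s t e₁ e₂ ef H) (h7 : H.r 7 = 4 + 3 * i)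
    (h8 : H.r 8 = i) (hi : i < m)
    (h : ∀ H', Const n m s t e₁ e₂ ef H' → H'.A = H.A → H'.r 7 = 4 + 3 * (i + 1) →
      H'.r 8 = i + 1 → H'.r 9 = e₁ i → H'.r 10 = e₂ i → H'.r 11 = ef i →
      (∀ x, 12 ≤ x ∨ x < 7 → H'.r x = H.r x) → wp U c Q H') : wp U (readEdge ;; c) Q H := by
  have h1 := hC.fst i hi
  have h2 := hC.snd i hi
  have h3 := hC.flag i hi
  have hA : numArrays = 22 := rfl
  simp only [readEdge, wp, Store.set_r, Store.set_A, h7, h8, hC.one]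
  norm_num
  refine ⟨by omega, by omega, by omega, by omega, by omega, by omega, by omega, ?_⟩
  apply h
  · simpa using hC
  · rfl
  · simp
    ring
  · simp
  · simp [h1]
  · simp [h2]
  · simp [h3]
  · intro x hx
    simp only [Store.set_r]
    repeat rw [if_neg (by omega)]

/-- `Linked nx h l`: following the pointers `nx` from `h` to the end marker `0` yields the list `l`.
-/
def Linked (nx : ℕ → ℕ) : ℕ → List ℕ → Prop
  | h, [] => h = 0
  | h, r :: l => h = r ∧ r ≠ 0 ∧ Linked nx (nx r) l

theorem Linked.update {nx : ℕ → ℕ} {l : List ℕ} {R x : ℕ} :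
    ∀ {h : ℕ}, R ∉ l → Linked nx h l → Linked (Function.update nx R x) h l := by
  induction l with
  | nil => exact fun _ h => h
  | cons r l ih =>
    rintro h hR ⟨h1, h2, h3⟩
    simp only [List.mem_cons, not_or] at hR
    refine ⟨h1, h2, ?_⟩
    rw [Function.update_of_ne (Ne.symm hR.1)]
    exact ih hR.2 h3

theorem Linked.nil {nx : ℕ → ℕ} {l : List ℕ} (h : Linked nx 0 l) : l = [] := by
  cases l with
  | nil => rfl
  | cons r l => exact absurd h.1.symm h.2.1

theorem Linked.exists_cons {nx : ℕ → ℕ} {l : List ℕ} {h : ℕ} (hl : Linked nx h l) (h0 : h ≠ 0) :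
    ∃ l', l = h :: l' ∧ Linked nx (nx h) l' := by
  cases l with
  | nil => exact absurd hl h0
  | cons r l =>
    obtain ⟨rfl, -, h⟩ := hl
    exact ⟨l, rfl, h⟩

theorem sum_length_update {f : ℕ → List ℕ} {u : ℕ} (hu : u < n) (l : List ℕ) :
    ∑ v ∈ Finset.range n, (Function.update f u l v).length + (f u).length =
      ∑ v ∈ Finset.range n, (f v).length + l.length := by
  have hu' : u ∈ Finset.range n := Finset.mem_range.2 hu
  rw [← Finset.add_sum_erase _ _ hu', ← Finset.add_sum_erase _ (fun v => (f v).length) hu']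
  have : ∑ v ∈ (Finset.range n).erase u, (Function.update f u l v).length =
      ∑ v ∈ (Finset.range n).erase u, (f v).length :=
    Finset.sum_congr rfl fun v hv => by rw [Function.update_of_ne (Finset.ne_of_mem_erase hv)]
  rw [this, Function.update_self]
  omega

/-- Adjacency lists that consist of records with numbers between `1` and `R - 1`: the record `r` in
the list of `u` stands for an edge from `u` to `tgt r` with label `fl r`. -/
structure AdjLists (Adj : ℕ → ℕ → Prop) (L : ℕ → ℕ → ℕ) (n R : ℕ) (head tgt fl nx : ℕ → ℕ)
    (adj : ℕ → List ℕ) : Prop where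
  linked : ∀ u, Linked nx (head u) (adj u)
  lt : ∀ u, ∀ r ∈ adj u, r < R
  edge : ∀ u, ∀ r ∈ adj u, Adj u (tgt r)
  lab : ∀ u, ∀ r ∈ adj u, fl r = L u (tgt r)
  sum : ∑ u ∈ Finset.range n, (adj u).length + 1 = R

theorem AdjLists.push {R : ℕ} {head tgt fl nx : ℕ → ℕ} {adj : ℕ → List ℕ}
    (h : AdjLists Adj L n R head tgt fl nx adj) {u v f : ℕ} (hu : u < n)
    (huv : Adj u v) (hf : f = L u v) :
    AdjLists Adj L n (R + 1) (Function.update head u R) (Function.update tgt R v)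
      (Function.update fl R f) (Function.update nx R (head u))
      (Function.update adj u (R :: adj u)) := by
  have hR : ∀ u, R ∉ adj u := fun u hR => lt_irrefl _ (h.lt u R hR)
  have hmem : ∀ x r, r ∈ Function.update adj u (R :: adj u) x → (r = R ∧ x = u) ∨
      (r ≠ R ∧ r ∈ adj x) := by
    intro x r hr
    have hne : ∀ r ∈ adj x, r ≠ R := fun r hr h' => hR x (h' ▸ hr)
    by_cases hx : x = u
    · subst hx
      rw [Function.update_self, List.mem_cons] at hr
      exact hr.elim (fun h => .inl ⟨h, rfl⟩) fun h => .inr ⟨hne r h, h⟩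
    · rw [Function.update_of_ne hx] at hr
      exact .inr ⟨hne r hr, hr⟩
  refine ⟨fun x => ?_, fun x r hr => ?_, fun x r hr => ?_, fun x r hr => ?_, ?_⟩
  · by_cases hx : x = u
    · subst hx
      rw [Function.update_self, Function.update_self]
      refine ⟨rfl, by have := h.sum; omega, ?_⟩
      rw [Function.update_self]
      exact (h.linked x).update (hR x)
    · rw [Function.update_of_ne hx, Function.update_of_ne hx]
      exact (h.linked x).update (hR x)
  · rcases hmem x r hr with ⟨h1, h2⟩ | ⟨h1, h2⟩
    · omega
    · exact (h.lt x r h2).trans (Nat.lt_succ_self _)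
  · rcases hmem x r hr with ⟨rfl, rfl⟩ | ⟨h1, h2⟩
    · rwa [Function.update_self]
    · rw [Function.update_of_ne h1]
      exact h.edge x r h2
  · rcases hmem x r hr with ⟨rfl, rfl⟩ | ⟨h1, h2⟩
    · rwa [Function.update_self, Function.update_self]
    · rw [Function.update_of_ne h1, Function.update_of_ne h1]
      exact h.lab x r h2
  · have h1 := sum_length_update (f := adj) hu (R :: adj u)
    have h2 := h.sum
    rw [List.length_cons] at h1
    omega

/-- Insert a record for the edge from variable `u` to variable `v`; its label is in variable `11`,
and variable `12` is the number of the next record. -/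
def pushRecord (u v : ℕ) : Cmd :=
  .put 2 12 v ;; .put 3 12 11 ;; .get 13 1 u ;; .put 4 12 13 ;; .put 1 u 12 ;; .add 12 12 6

/-- Build the adjacency lists. -/
def build : Cmd :=
  .const 7 4 ;; .const 8 0 ;; .const 12 1 ;;
    .loop (.lt 8 2) (readEdge ;; pushRecord 9 10 ;; pushRecord 10 9)

/-- The adjacency lists are complete for the first `i` edges. -/
structure BuildInv (Adj : ℕ → ℕ → Prop) (L : ℕ → ℕ → ℕ) (n m s t : ℕ) (e₁ e₂ ef : ℕ → ℕ)
    (i : ℕ) (H : Store) : Prop where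
  const : Const n m s t e₁ e₂ ef H
  fresh : ∀ j, 5 ≤ j → H.A j = fun _ => 0
  lists : ∃ adj, AdjLists Adj L n (2 * i + 1) (H.A 1) (H.A 2) (H.A 3) (H.A 4) adj ∧
    (∀ j < i, (∃ r ∈ adj (e₁ j), H.A 2 r = e₂ j) ∧ ∃ r ∈ adj (e₂ j), H.A 2 r = e₁ j)

theorem build_body (hU : 4 * (n + m + 1) = U) (I : Instance Adj L n m s t e₁ e₂ ef) {i : ℕ}
    {H : Store} (hi : i < m) (hH : BuildInv Adj L n m s t e₁ e₂ ef i H) (h7 : H.r 7 = 4 + 3 * i)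
    (h8 : H.r 8 = i) (h12 : H.r 12 = 2 * i + 1) :
    wp U (readEdge ;; pushRecord 9 10 ;; pushRecord 10 9)
      (fun H' => BuildInv Adj L n m s t e₁ e₂ ef (i + 1) H' ∧ H'.r 7 = 4 + 3 * (i + 1) ∧
        H'.r 8 = i + 1 ∧ H'.r 12 = 2 * (i + 1) + 1) H := by
  refine wp_readEdge hU hH.const h7 h8 hi fun H' hC hA h7 h8 h9 h10 h11 hr => ?_
  have hadj := I.adj i hi
  have hu := I.lt _ _ hadj
  have hadj' := I.graph.symm _ _ hadj
  have hv := I.lt _ _ hadj'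
  have hlab := I.lab i hi
  have hlab' := hlab.trans (I.graph.lsymm _ _)
  obtain ⟨adj, hl, hcov⟩ := hH.lists
  have hl₂ := (hl.push hu hadj hlab).push hv hadj' hlab'
  simp only [pushRecord, wp, numArrays, Store.set_r, Store.set_A, Store.put_r, Store.put_A, h9, h10,
    h11, h7, h8, hr 12 (by omega), h12, hC.one, hA, Nat.reduceEqDiff, if_true, if_false,
    Nat.reduceLT, true_and]
  have h2i : 2 * (i + 1) + 1 = 2 * i + 1 + 1 + 1 := by omega
  and_intros
  all_goals try omega
  refine ⟨by simpa using hC, fun j hj => ?_, _, (by simpa [hA, h2i] using hl₂), ?_⟩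
  · have h1 : j ≠ 1 := by omega
    have h2 : j ≠ 2 := by omega
    have h3 : j ≠ 3 := by omega
    have h4 : j ≠ 4 := by omega
    simpa [h1, h2, h3, h4, hA] using hH.fresh j hj
  · have hold : ∀ x, ∀ r ∈ adj x, r ∈ Function.update (Function.update adj (e₁ i)
        ((2 * i + 1) :: adj (e₁ i))) (e₂ i) ((2 * i + 1 + 1) :: Function.update adj (e₁ i)
        ((2 * i + 1) :: adj (e₁ i)) (e₂ i)) x ∧ Function.update (Function.update (H.A 2)
        (2 * i + 1) (e₂ i)) (2 * i + 1 + 1) (e₁ i) r = H.A 2 r := by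
      intro x r hr
      have h1 := hl.lt x r hr
      constructor
      · simp only [Function.update_apply]
        split_ifs with h2 h3 h4 <;> simp_all
      · rw [Function.update_of_ne (by omega), Function.update_of_ne (by omega)]
    intro j hj
    simp only [Store.set_A, Store.put_A, hA, Nat.reduceEqDiff, if_true, if_false]
    by_cases hji : j = i
    · subst hji
      constructor
      · have hne : e₁ j ≠ e₂ j := fun h => I.graph.irrefl (e₂ j) (by rwa [h] at hadj)
        exact ⟨2 * j + 1, by simp [hne], by simp⟩
      · exact ⟨2 * j + 1 + 1, by simp, by simp⟩
    · obtain ⟨⟨r, hr, h1⟩, r', hr', h1'⟩ := hcov j (by omega)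
      exact ⟨⟨r, (hold _ r hr).1, (hold _ r hr).2.trans h1⟩,
        ⟨r', (hold _ r' hr').1, (hold _ r' hr').2.trans h1'⟩⟩

theorem build_spec (hF : Fits U w) (hU : 4 * (n + m + 1) = U) (I : Instance Adj L n m s t e₁ e₂ ef)
    {H : Store} (hC : Const n m s t e₁ e₂ ef H) (hA : ∀ j, 0 < j → H.A j = fun _ => 0) :
    Halts U w build H (33 * m + 4) (BuildInv Adj L n m s t e₁ e₂ ef m) := by
  have hpos := hF.pos
  refine ((halts_of_wp hF (.const 7 4) _ _ ⟨by norm_num, ?_⟩).seq (T₂ := 33 * m + 3)).mono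
    (by simp only [cost]; omega) fun _ h => h
  refine ((halts_of_wp hF (.const 8 0) _ _ ⟨by norm_num, ?_⟩).seq (T₂ := 33 * m + 2)).mono
    (by simp only [cost]; omega) fun _ h => h
  refine ((halts_of_wp hF (.const 12 1) _ _ ⟨by norm_num, ?_⟩).seq (T₂ := 33 * m + 1)).mono
    (by simp only [cost]; omega) fun _ h => h
  refine (Halts.loop (T := 32) (I := fun k H => ∃ i, i + k = m ∧
    BuildInv Adj L n m s t e₁ e₂ ef i H ∧ H.r 7 = 4 + 3 * i ∧ H.r 8 = i ∧ H.r 12 = 2 * i + 1)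
    ?_ m _ ?_).mono (by omega) ?_
  · rintro k H ⟨i, hk, hB, h7, h8, h12⟩ hb
    have hi : i < m := by simpa [Holds, h8, hB.const.r₂] using hb
    refine (halts_of_wp hF _ _ _ (build_body hU I hi hB h7 h8 h12)).mono
      (by simp [cost, readEdge, pushRecord]) fun H' h => ?_
    exact ⟨k - 1, by omega, i + 1, by omega, h⟩
  · refine ⟨0, by omega, ⟨by simpa using hC, fun j hj => by simpa using hA j (by omega),
      fun _ => [], ⟨fun u => ?_, by simp, by simp, by simp, by simp⟩, by simp⟩, by simp, by simp,
      by simp⟩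
    simp [hA 1 (by norm_num), Linked]
  · rintro H ⟨⟨k, i, hk, hB, h7, h8, h12⟩, hb⟩
    have hi : ¬ i < m := by simpa [Holds, h8, hB.const.r₂] using hb
    obtain rfl : i = m := by omega
    exact hB

end OddPath

namespace OddPath

/-! ### Depth-first search -/

variable {Adj : ℕ → ℕ → Prop} {L : ℕ → ℕ → ℕ} {n m s t : ℕ} {e₁ e₂ ef : ℕ → ℕ} {U w : ℕ}
variable {vis pre par ord lab : ℕ → ℕ} {cnt : ℕ}

section Push

variable (hG : Labelled Adj L) (T : Tree Adj L s t vis pre par ord lab cnt)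

include T in
theorem Tree.anc_update {u x : ℕ} (hu : vis u ≠ 1) {c v : ℕ} (hv : vis v = 1) :
    Anc (Function.update par u x) t c v ↔ Anc par t c v := by
  constructor
  · intro h
    induction h with
    | refl => exact .refl
    | @step v hne h ih =>
      have hvu : v ≠ u := fun h => hu (by rw [← h, hv])
      rw [Function.update_of_ne hvu] at ih
      exact .step hne (ih (T.vis_par v hv hne))
  · intro h
    induction h with
    | refl => exact .refl
    | @step v hne h ih =>
      have hvu : v ≠ u := fun h => hu (by rw [← h, hv])
      refine .step hne ?_
      rw [Function.update_of_ne hvu]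
      exact ih (T.vis_par v hv hne)

include hG T in
/-- A tree grows by a new vertex `u` below the current vertex `cur`, where all vertices with
neighbours that have not been found are ancestors of `cur`. -/
theorem Tree.push {cur u : ℕ} (hcur : vis cur = 1) (hct : cur ≠ t) (hu : vis u ≠ 1)
    (hadj : Adj cur u)
    (hstack : ∀ c y, Anc par t c cur → vis y = 1 → pre c ≤ pre y → Anc par t c y)
    (hnbr : ∀ y, vis y = 1 → Adj u y → Anc par t y cur) :
    Tree Adj L s t (Function.update vis u 1) (Function.update pre u cnt)
      (Function.update par u cur) (Function.update ord cnt u)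
      (Function.update lab u (L cur u)) (cnt + 1) := by
  have hvis : ∀ v, Function.update vis u 1 v = 1 → v = u ∨ (v ≠ u ∧ vis v = 1) := by
    intro v hv
    by_cases h : v = u
    · exact .inl h
    · rw [Function.update_of_ne h] at hv
      exact .inr ⟨h, hv⟩
  have hne : ∀ {v}, vis v = 1 → v ≠ u := fun hv h => hu (h ▸ hv)
  have hpre : ∀ {v}, vis v = 1 → Function.update pre u cnt v = pre v :=
    fun hv => Function.update_of_ne (hne hv) _ _
  have hpar : ∀ {v}, vis v = 1 → Function.update par u cur v = par v :=
    fun hv => Function.update_of_ne (hne hv) _ _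
  have hvis' : ∀ {v}, vis v = 1 → Function.update vis u 1 v = 1 := fun {v} hv => by
    rw [Function.update_of_ne (hne hv), hv]
  have hut : u ≠ t := (hne T.vis_t).symm
  have hus : u ≠ s := (hne T.vis_s).symm
  have hancu : ∀ {c}, Anc (Function.update par u cur) t c u → c = u ∨ Anc par t c cur := by
    intro c h
    rcases h.eq_or with h | ⟨-, h⟩
    · exact .inl h
    · rw [Function.update_self] at h
      exact .inr ((T.anc_update hu hcur).1 h)
  have hancu' : ∀ {c}, Anc par t c cur → Anc (Function.update par u cur) t c u := by
    intro c h
    refine .step hut ?_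
    rw [Function.update_self]
    exact (T.anc_update hu hcur).2 h
  have hord : ∀ {i}, i < cnt → Function.update ord cnt u i = ord i :=
    fun hi => Function.update_of_ne hi.ne _ _
  refine
    { ne := T.ne
      vis_t := hvis' T.vis_t
      vis_s := hvis' T.vis_s
      par_s := by rw [hpar T.vis_s, T.par_s]
      pre_t := by rw [hpre T.vis_t, T.pre_t]
      pre_s := by rw [hpre T.vis_s, T.pre_s]
      vis_par := fun v hv hvt => ?_
      pre_par := fun v hv hvt => ?_
      par_ne := fun v hv hvt hvs => ?_
      adj := fun v hv hvt hvs => ?_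
      lab_eq := fun v hv hvt hvs => ?_
      ord_pre := fun v hv => ?_
      pre_lt := fun v hv => ?_
      vis_ord := fun i hi => ?_
      pre_ord := fun i hi => ?_
      anc := fun x y hx hy hxy hlt => ?_
      contig := fun c v y hv hy hc h1 h2 => ?_ }
  · rcases hvis v hv with rfl | ⟨-, h⟩
    · rw [Function.update_self]
      exact hvis' hcur
    · rw [hpar h]
      exact hvis' (T.vis_par v h hvt)
  · rcases hvis v hv with rfl | ⟨-, h⟩
    · rw [Function.update_self, Function.update_self, hpre hcur]
      exact T.pre_lt _ hcur
    · rw [hpar h, hpre h, hpre (T.vis_par v h hvt)]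
      exact T.pre_par v h hvt
  · rcases hvis v hv with rfl | ⟨-, h⟩
    · rwa [Function.update_self]
    · rw [hpar h]
      exact T.par_ne v h hvt hvs
  · rcases hvis v hv with rfl | ⟨-, h⟩
    · rwa [Function.update_self]
    · rw [hpar h]
      exact T.adj v h hvt hvs
  · rcases hvis v hv with rfl | ⟨h', h⟩
    · rw [Function.update_self, Function.update_self]
    · rw [hpar h, Function.update_of_ne h']
      exact T.lab_eq v h hvt hvs
  · rcases hvis v hv with rfl | ⟨-, h⟩
    · rw [Function.update_self, Function.update_self]
    · rw [hpre h, hord (T.pre_lt v h), T.ord_pre v h]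
  · rcases hvis v hv with rfl | ⟨-, h⟩
    · rw [Function.update_self]
      omega
    · rw [hpre h]
      exact (T.pre_lt v h).trans (Nat.lt_succ_self _)
  · rcases Nat.lt_succ_iff_lt_or_eq.1 hi with h | rfl
    · rw [hord h]
      exact hvis' (T.vis_ord i h)
    · rw [Function.update_self, Function.update_self]
  · rcases Nat.lt_succ_iff_lt_or_eq.1 hi with h | rfl
    · rw [hord h, hpre (T.vis_ord i h), T.pre_ord i h]
    · rw [Function.update_self, Function.update_self]
  · rcases hvis y hy with rfl | ⟨-, h⟩
    · rcases hvis x hx with rfl | ⟨-, h'⟩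
      · exact (hG.irrefl _ hxy).elim
      · exact hancu' (hnbr x h' (hG.symm _ _ hxy))
    · rcases hvis x hx with rfl | ⟨-, h'⟩
      · rw [Function.update_self, hpre h] at hlt
        have := T.pre_lt y h
        omega
      · rw [hpre h, hpre h'] at hlt
        exact (T.anc_update hu h).2 (T.anc x y h' h hxy hlt)
  · rcases hvis v hv with rfl | ⟨-, h⟩
    · rcases hvis y hy with rfl | ⟨-, h'⟩
      · exact hc
      · rcases hancu hc with rfl | h3
        · rw [Function.update_self, hpre h'] at h1
          have := T.pre_lt y h'
          omega
        · rw [hpre (T.vis_anc h3 hcur), hpre h'] at h1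
          exact (T.anc_update hu h').2 (hstack c y h3 h' h1)
    · have hc' := (T.anc_update hu h).1 hc
      rcases hvis y hy with rfl | ⟨-, h'⟩
      · rw [Function.update_self, hpre h] at h2
        have := T.pre_lt v h
        omega
      · rw [hpre h', hpre h] at h2
        rw [hpre h', hpre (T.vis_anc hc' h)] at h1
        exact (T.anc_update hu h').2 (T.contig c v y h h' hc' h1 h2)

end Push

/-- The invariant of depth-first search. The current vertex is `cur`, its ancestors form the stack.
The record `ptr v` is the next one to be considered in the adjacency list of `v`, and `rem v` is the
list of the remaining records, while `dep v` is the depth of `v` in the tree. -/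
structure DfsInv (Adj : ℕ → ℕ → Prop) (L : ℕ → ℕ → ℕ) (n m s t : ℕ) (adj : ℕ → List ℕ)
    (tgt nx : ℕ → ℕ) (ptr vis pre par ord lab low : ℕ → ℕ) (cnt cur : ℕ) (rem : ℕ → List ℕ)
    (dep : ℕ → ℕ) : Prop where
  tree : Tree Adj L s t vis pre par ord lab cnt
  found : vis cur = 1
  linked : ∀ v, vis v = 1 → v ≠ t → Linked nx (ptr v) (rem v)
  rem_eq : ∀ v, vis v ≠ 1 → rem v = adj v
  sub : ∀ v, ∀ r ∈ rem v, r ∈ adj v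
  nbr : ∀ v u, vis v = 1 → v ≠ t → Adj v u → vis u = 1 ∨ ∃ r ∈ rem v, tgt r = u
  fin : ∀ v, vis v = 1 → v ≠ t → ¬ Anc par t v cur → rem v = []
  stack : ∀ c y, Anc par t c cur → vis y = 1 → pre c ≤ pre y → Anc par t c y
  dep : ∀ v, vis v = 1 → v ≠ t → dep v = dep (par v) + 1
  sum : cnt + ∑ u ∈ Finset.range n, (rem u).length ≤ 2 * m + 2
  low : ∀ v, vis v = 1 → low v = pre v
  lt : ∀ v, vis v = 1 → v < n

section DfsInv

variable {adj rem : ℕ → List ℕ} {head tgt fl nx ptr low dep : ℕ → ℕ} {R cur : ℕ}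

/-- If the list of the current vertex is exhausted, depth-first search returns to its parent. -/
theorem DfsInv.pop (h : DfsInv Adj L n m s t adj tgt nx ptr vis pre par ord lab low cnt cur rem dep)
    (hct : cur ≠ t) (hptr : ptr cur = 0) :
    DfsInv Adj L n m s t adj tgt nx ptr vis pre par ord lab low cnt (par cur) rem dep ∧
      dep cur = dep (par cur) + 1 := by
  refine ⟨{ h with
    found := h.tree.vis_par cur h.found hct
    fin := fun v hv hvt hc => ?_
    stack := fun c y hc => h.stack c y (.step hct hc) }, h.dep cur h.found hct⟩
  by_cases hvc : v = cur
  · have := h.linked v hv hvt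
    rw [hvc, hptr] at this
    rw [hvc, this.nil]
  · exact h.fin v hv hvt fun ha => hc (ha.par_of_ne hvc)

/-- The next record of the current vertex leads to a vertex that has been found before. -/
theorem DfsInv.advance
    (h : DfsInv Adj L n m s t adj tgt nx ptr vis pre par ord lab low cnt cur rem dep)
    (hct : cur ≠ t) (hptr : ptr cur ≠ 0) (hvis : vis (tgt (ptr cur)) = 1) :
    ∃ rem', DfsInv Adj L n m s t adj tgt nx (Function.update ptr cur (nx (ptr cur))) vis pre par ord
      lab low cnt cur rem' dep ∧ ∑ u ∈ Finset.range n, (rem' u).length + 1 =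
        ∑ u ∈ Finset.range n, (rem u).length := by
  obtain ⟨l, hl, hl'⟩ := (h.linked cur h.found hct).exists_cons hptr
  have hsum := sum_length_update (f := rem) (h.lt cur h.found) l
  rw [hl, List.length_cons] at hsum
  refine ⟨Function.update rem cur l, { h with
    linked := fun v hv hvt => ?_
    rem_eq := fun v hv => ?_
    sub := fun v r hr => ?_
    nbr := fun v u hv hvt hvu => ?_
    fin := fun v hv hvt hc => ?_
    sum := ?_ }, ?_⟩
  · by_cases hvc : v = cur
    · rwa [hvc, Function.update_self, Function.update_self]
    · rw [Function.update_of_ne hvc, Function.update_of_ne hvc]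
      exact h.linked v hv hvt
  · have hvc : v ≠ cur := fun hvc => hv (by rw [hvc, h.found])
    rw [Function.update_of_ne hvc]
    exact h.rem_eq v hv
  · by_cases hvc : v = cur
    · rw [hvc, Function.update_self] at hr
      rw [hvc]
      exact h.sub cur r (by rw [hl]; exact List.mem_cons_of_mem _ hr)
    · rw [Function.update_of_ne hvc] at hr
      exact h.sub v r hr
  · rcases h.nbr v u hv hvt hvu with h1 | ⟨r, hr, hr'⟩
    · exact .inl h1
    · by_cases hvc : v = cur
      · subst hvc
        rw [hl, List.mem_cons] at hr
        rcases hr with rfl | hr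
        · exact .inl (hr' ▸ hvis)
        · exact .inr ⟨r, by rwa [Function.update_self], hr'⟩
      · exact .inr ⟨r, by rwa [Function.update_of_ne hvc], hr'⟩
  · have hvc : v ≠ cur := fun hvc => hc (by rw [hvc]; exact .refl)
    rw [Function.update_of_ne hvc]
    exact h.fin v hv hvt hc
  · have := h.sum
    omega
  · omega

/-- The next record of the current vertex leads to a new vertex. -/
theorem DfsInv.push (hG : Labelled Adj L) (hn : ∀ u v, Adj u v → u < n)
    (hadj : AdjLists Adj L n R head tgt fl nx adj)
    (hcomp : ∀ u v, Adj u v → ∃ r ∈ adj u, tgt r = v)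
    (h : DfsInv Adj L n m s t adj tgt nx ptr vis pre par ord lab low cnt cur rem dep)
    (hct : cur ≠ t) (hptr : ptr cur ≠ 0) {u : ℕ} (hu : tgt (ptr cur) = u) (hvis : vis u ≠ 1) :
    ∃ rem' dep', DfsInv Adj L n m s t adj tgt nx
      (Function.update (Function.update ptr cur (nx (ptr cur))) u (head u))
      (Function.update vis u 1) (Function.update pre u cnt) (Function.update par u cur)
      (Function.update ord cnt u) (Function.update lab u (fl (ptr cur)))
      (Function.update low u cnt) (cnt + 1) u rem' dep' ∧
      ∑ u ∈ Finset.range n, (rem' u).length + 1 = ∑ u ∈ Finset.range n, (rem u).length ∧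
      dep' u = dep cur + 1 := by
  obtain ⟨l, hl, hl'⟩ := (h.linked cur h.found hct).exists_cons hptr
  have hr : ptr cur ∈ adj cur := h.sub cur _ (by rw [hl]; exact List.mem_cons_self)
  have hcu : Adj cur u := hu ▸ hadj.edge cur _ hr
  have hlab : fl (ptr cur) = L cur u := hu ▸ hadj.lab cur _ hr
  have hsum := sum_length_update (f := rem) (h.lt cur h.found) l
  rw [hl, List.length_cons] at hsum
  have hne : ∀ {v}, vis v = 1 → v ≠ u := fun hv h => hvis (h ▸ hv)
  have hv' : ∀ v, Function.update vis u 1 v = 1 → v = u ∨ (v ≠ u ∧ vis v = 1) := by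
    intro v hv
    by_cases h : v = u
    · exact .inl h
    · rw [Function.update_of_ne h] at hv
      exact .inr ⟨h, hv⟩
  -- an unfinished neighbour of `u` lies on the stack
  have hnbr : ∀ y, vis y = 1 → Adj u y → Anc par t y cur := by
    intro y hy huy
    by_cases hyt : y = t
    · exact hyt ▸ h.tree.root_anc cur h.found
    by_contra hc
    have h1 := h.fin y hy hyt hc
    rcases h.nbr y u hy hyt (hG.symm _ _ huy) with h2 | ⟨r, h2, -⟩
    · exact hvis h2
    · rw [h1] at h2
      exact absurd h2 List.not_mem_nil
  have hT := h.tree.push hG h.found hct hvis hcu h.stack hnbr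
  have hanc : ∀ {c}, Anc (Function.update par u cur) t c u → c = u ∨ Anc par t c cur := by
    intro c hc
    rcases hc.eq_or with h1 | ⟨-, h1⟩
    · exact .inl h1
    · rw [Function.update_self] at h1
      exact .inr ((h.tree.anc_update hvis h.found).1 h1)
  rw [hlab]
  refine ⟨Function.update rem cur l, Function.update dep u (dep cur + 1),
    { tree := hT
      found := by rw [Function.update_self]
      linked := fun v hv hvt => ?_
      rem_eq := fun v hv => ?_
      sub := fun v r hr => ?_
      nbr := fun v x hv hvt hvx => ?_
      fin := fun v hv hvt hc => ?_
      stack := fun c y hc hy hcy => ?_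
      dep := fun v hv hvt => ?_
      sum := ?_
      low := fun v hv => ?_
      lt := fun v hv => ?_ }, by omega, by rw [Function.update_self]⟩
  · rcases hv' v hv with rfl | ⟨hvu, hv⟩
    · rw [Function.update_self, Function.update_of_ne (hne h.found).symm, h.rem_eq v hvis]
      exact hadj.linked v
    · rw [Function.update_of_ne hvu]
      by_cases hvc : v = cur
      · rwa [hvc, Function.update_self, Function.update_self]
      · rw [Function.update_of_ne hvc, Function.update_of_ne hvc]
        exact h.linked v hv hvt
  · have hvu : v ≠ u := fun h => hv (by rw [h, Function.update_self])
    rw [Function.update_of_ne hvu] at hv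
    have hvc : v ≠ cur := fun hvc => hv (by rw [hvc, h.found])
    rw [Function.update_of_ne hvc]
    exact h.rem_eq v hv
  · by_cases hvc : v = cur
    · rw [hvc, Function.update_self] at hr
      rw [hvc]
      exact h.sub cur r (by rw [hl]; exact List.mem_cons_of_mem _ hr)
    · rw [Function.update_of_ne hvc] at hr
      exact h.sub v r hr
  · rcases hv' v hv with rfl | ⟨hvu, hv⟩
    · obtain ⟨r, hr, hrx⟩ := hcomp v x hvx
      refine .inr ⟨r, ?_, hrx⟩
      rwa [Function.update_of_ne (hne h.found).symm, h.rem_eq v hvis]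
    · by_cases hxu : x = u
      · exact .inl (by rw [hxu, Function.update_self])
      rw [Function.update_of_ne hxu]
      rcases h.nbr v x hv hvt hvx with h1 | ⟨r, hrv, hrx⟩
      · exact .inl h1
      · refine .inr ⟨r, ?_, hrx⟩
        by_cases hvc : v = cur
        · subst hvc
          rw [hl, List.mem_cons] at hrv
          rcases hrv with rfl | hrv
          · exact absurd (hrx.symm.trans hu) hxu
          · rwa [Function.update_self]
        · rwa [Function.update_of_ne hvc]
  · rcases hv' v hv with rfl | ⟨hvu, hv⟩
    · exact absurd .refl hc
    · have hc' : ¬ Anc par t v cur := fun h1 => hc (.step (hne h.tree.vis_t).symm (by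
        rw [Function.update_self]
        exact (h.tree.anc_update hvis h.found).2 h1))
      have hvc : v ≠ cur := fun hvc => hc' (by rw [hvc]; exact .refl)
      rw [Function.update_of_ne hvc]
      exact h.fin v hv hvt hc'
  · rcases hv' y hy with rfl | ⟨hyu, hy₂⟩
    · exact hc
    · rw [Function.update_of_ne hyu] at hcy
      rcases hanc hc with rfl | h1
      · rw [Function.update_self] at hcy
        have := h.tree.pre_lt y hy₂
        omega
      · rw [Function.update_of_ne (hne (h.tree.vis_anc h1 h.found))] at hcy
        exact (h.tree.anc_update hvis hy₂).2 (h.stack c y h1 hy₂ hcy)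
  · rcases hv' v hv with rfl | ⟨hvu, hv⟩
    · rw [Function.update_self, Function.update_self, Function.update_of_ne (hne h.found)]
    · rw [Function.update_of_ne hvu, Function.update_of_ne hvu,
        Function.update_of_ne (hne (h.tree.vis_par v hv hvt))]
      exact h.dep v hv hvt
  · have := h.sum
    omega
  · rcases hv' v hv with rfl | ⟨hvu, hv⟩
    · rw [Function.update_self, Function.update_self]
    · rw [Function.update_of_ne hvu, Function.update_of_ne hvu]
      exact h.low v hv
  · rcases hv' v hv with rfl | ⟨hvu, hv⟩
    · exact hn _ _ (hG.symm _ _ hcu)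
    · exact h.lt v hv

end DfsInv

end OddPath

namespace OddPath

variable {Adj : ℕ → ℕ → Prop} {L : ℕ → ℕ → ℕ} {n m s t : ℕ} {e₁ e₂ ef : ℕ → ℕ} {U w : ℕ}

theorem DfsInv.init (I : Instance Adj L n m s t e₁ e₂ ef) {head tgt fl nx : ℕ → ℕ}
    {adj : ℕ → List ℕ} (hl : AdjLists Adj L n (2 * m + 1) head tgt fl nx adj)
    (hcomp : ∀ u v, Adj u v → ∃ r ∈ adj u, tgt r = v) :
    DfsInv Adj L n m s t adj tgt nx (Function.update (fun _ => 0) s (head s))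
      (Function.update (Function.update (fun _ => 0) t 1) s 1) (Function.update (fun _ => 0) s 1)
      (Function.update (fun _ => 0) s t) (Function.update (Function.update (fun _ => 0) 0 t) 1 s)
      (fun _ => 0) (Function.update (fun _ => 0) s 1) 2 s adj fun v => if v = t then 0 else 1 := by
  have hst := I.ne
  have hv : ∀ v, Function.update (Function.update (fun _ => 0) t 1) s 1 v = 1 → v = t ∨ v = s := by
    intro v hv
    by_contra h
    rw [not_or] at h
    simp [h] at hv
  have hs : Anc (Function.update (fun _ => 0) s t) t t s := .step hst (by simpa using .refl)
  have hstack : ∀ c y, Anc (Function.update (fun _ => 0) s t) t c s →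
      Function.update (Function.update (fun _ => 0) t 1) s 1 y = 1 →
      Function.update (fun _ => 0) s 1 c ≤ Function.update (fun _ => 0) s 1 y →
      Anc (Function.update (fun _ => 0) s t) t c y := by
    intro c y hc hy hle
    rcases hv y hy with rfl | rfl
    · rcases hc.eq_or with rfl | ⟨-, hc⟩
      · simp [Ne.symm hst] at hle
      · simpa using hc
    · exact hc
  refine
    { tree :=
        { ne := hst
          vis_t := by simp [Ne.symm hst]
          vis_s := by simp
          par_s := by simp
          pre_t := by simp [Ne.symm hst]
          pre_s := by simp
          vis_par := fun v h hne => ?_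
          pre_par := fun v h hne => ?_
          par_ne := fun v h hne hne' => ?_
          adj := fun v h hne hne' => ?_
          lab_eq := fun v h hne hne' => ?_
          ord_pre := fun v h => ?_
          pre_lt := fun v h => ?_
          vis_ord := fun i hi => ?_
          pre_ord := fun i hi => ?_
          anc := fun u v hu hv' huv hlt => ?_
          contig := fun c v y hv' hy hc h1 h2 => ?_ }
      found := by simp
      linked := fun v h hne => ?_
      rem_eq := fun _ _ => rfl
      sub := fun _ _ h => h
      nbr := fun v u _ _ hvu => .inr (hcomp v u hvu)
      fin := fun v h hne hc => ?_
      stack := hstack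
      dep := fun v h hne => ?_
      sum := ?_
      low := fun v h => rfl
      lt := fun v h => ?_ }
  · obtain rfl := (hv v h).resolve_left hne
    simp [Ne.symm hst]
  · obtain rfl := (hv v h).resolve_left hne
    simp [Ne.symm hst]
  · exact absurd ((hv v h).resolve_left hne) hne'
  · exact absurd ((hv v h).resolve_left hne) hne'
  · exact absurd ((hv v h).resolve_left hne) hne'
  · rcases hv v h with rfl | rfl
    · simp [Ne.symm hst]
    · simp
  · rcases hv v h with rfl | rfl
    · simp [Ne.symm hst]
    · simp
  · interval_cases i <;> simp [Ne.symm hst]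
  · interval_cases i <;> simp [Ne.symm hst]
  · rcases hv v hv' with rfl | rfl
    · simp [Ne.symm hst] at hlt
    · rcases hv u hu with rfl | rfl
      · exact hs
      · exact .refl
  · rcases hv v hv' with rfl | rfl
    · obtain rfl := hc.eq_root
      rcases hv y hy with rfl | rfl
      · exact .refl
      · exact hs
    · exact hstack c y hc hy h1
  · obtain rfl := (hv v h).resolve_left hne
    simpa using hl.linked v
  · exact absurd ((hv v h).resolve_left hne ▸ .refl) hc
  · obtain rfl := (hv v h).resolve_left hne
    simp [hne]
  · have := hl.sum
    omega
  · rcases hv v h with rfl | rfl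
    · exact I.t_lt
    · exact I.s_lt

/-- Start the search with `t` and `s`. Variable `14` is the current vertex, `15` counts the vertices
that have been found, and `19` is the number of the current vertex. -/
def dfsInit : Cmd :=
  .put 6 4 6 ;; .put 9 5 4 ;; .put 6 3 6 ;; .put 7 3 6 ;; .put 9 6 3 ;; .put 8 3 4 ;; .get 13 1 3 ;;
    .put 5 3 13 ;; .put 11 3 6 ;; .const 15 2 ;; .move 14 3 ;; .const 19 1

/-- One step of the search: consider the next record of the current vertex, or return to its parent
if there is none. -/
def dfsStep : Cmd :=
  .get 13 5 14 ;;
  .cond (.eq 13 5) (.get 14 8 14)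
    (.get 16 4 13 ;; .put 5 14 16 ;; .get 9 2 13 ;; .get 16 6 9 ;;
      .cond (.eq 16 6) .skip
        (.put 6 9 6 ;; .put 8 9 14 ;; .get 11 3 13 ;; .put 10 9 11 ;; .put 7 9 15 ;; .put 9 15 9 ;;
          .put 11 9 15 ;; .get 13 1 9 ;; .put 5 9 13 ;; .add 15 15 6 ;; .move 14 9)) ;;
  .get 19 7 14

/-- Depth-first search. -/
def dfs : Cmd := dfsInit ;; .loop (.lt 5 19) dfsStep

/-- The result of depth-first search. -/
structure DfsPost (Adj : ℕ → ℕ → Prop) (L : ℕ → ℕ → ℕ) (n m s t : ℕ) (e₁ e₂ ef : ℕ → ℕ)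
    (H : Store) : Prop where
  const : Const n m s t e₁ e₂ ef H
  fresh : ∀ j, 12 ≤ j → H.A j = fun _ => 0
  tree : Tree Adj L s t (H.A 6) (H.A 7) (H.A 8) (H.A 9) (H.A 10) (H.r 15)
  closed : ∀ v u, H.A 6 v = 1 → v ≠ t → Adj v u → H.A 6 u = 1
  low : ∀ v, H.A 6 v = 1 → H.A 11 v = H.A 7 v
  lt : ∀ v, H.A 6 v = 1 → v < n
  cnt : H.r 15 ≤ 2 * m + 2

/-- The invariant of depth-first search in terms of the store. Every step shortens a list of
remaining records or decreases the depth of the current vertex, so at most `k` steps are left. -/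
structure DfsState (Adj : ℕ → ℕ → Prop) (L : ℕ → ℕ → ℕ) (n m s t : ℕ) (e₁ e₂ ef : ℕ → ℕ)
    (adj : ℕ → List ℕ) (k : ℕ) (H : Store) : Prop where
  const : Const n m s t e₁ e₂ ef H
  fresh : ∀ j, 12 ≤ j → H.A j = fun _ => 0
  lists : AdjLists Adj L n (2 * m + 1) (H.A 1) (H.A 2) (H.A 3) (H.A 4) adj
  complete : ∀ u v, Adj u v → ∃ r ∈ adj u, H.A 2 r = v
  number : H.r 19 = H.A 7 (H.r 14)
  inv : ∃ rem dep, DfsInv Adj L n m s t adj (H.A 2) (H.A 4) (H.A 5) (H.A 6) (H.A 7) (H.A 8) (H.A 9)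
    (H.A 10) (H.A 11) (H.r 15) (H.r 14) rem dep ∧
      2 * ∑ u ∈ Finset.range n, (rem u).length + dep (H.r 14) = k

theorem dfs_body (hU : 4 * (n + m + 1) = U) (I : Instance Adj L n m s t e₁ e₂ ef)
    {adj : ℕ → List ℕ} {k : ℕ} {H : Store} (h : DfsState Adj L n m s t e₁ e₂ ef adj k H)
    (hct : H.r 14 ≠ t) :
    wp U dfsStep (fun H' => ∃ k' < k, DfsState Adj L n m s t e₁ e₂ ef adj k' H') H := by
  obtain ⟨rem, dep, hinv, hk⟩ := h.inv
  have hC := h.const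
  have hcur := hinv.lt _ hinv.found
  have hcnt := hinv.sum
  have hfresh : ∀ j, 12 ≤ j → j ≠ 1 ∧ j ≠ 2 ∧ j ≠ 3 ∧ j ≠ 4 ∧ j ≠ 5 ∧ j ≠ 6 ∧ j ≠ 7 ∧ j ≠ 8 ∧
    j ≠ 9 ∧ j ≠ 10 ∧ j ≠ 11 := fun j hj => by omega
  simp only [dfsStep, wp, numArrays, Holds, Store.set_r, Store.set_A, Store.put_r, Store.put_A,
    hC.one, hC.zero, Nat.reduceEqDiff, if_true, if_false, Nat.reduceLT, true_and]
  refine ⟨by omega, fun hptr => ?_, fun hptr => ?_⟩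
  · obtain ⟨h1, h2⟩ := hinv.pop hct hptr
    have hpar := h1.lt _ h1.found
    refine ⟨by omega, by omega, k - 1, by omega, by simpa using hC, fun j hj => ?_, h.lists,
      h.complete, by simp, rem, dep, by simpa using h1, ?_⟩
    · simpa using h.fresh j hj
    · simp
      omega
  · obtain ⟨l, hl, -⟩ := (hinv.linked _ hinv.found hct).exists_cons hptr
    have hmem := hinv.sub _ (H.A 5 (H.r 14)) (by rw [hl]; exact List.mem_cons_self)
    have hr := h.lists.lt _ _ hmem
    have hu := I.lt _ _ (I.graph.symm _ _ (h.lists.edge _ _ hmem))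
    refine ⟨by omega, by omega, by omega, by omega, fun hvis => ?_, fun hvis => ?_⟩
    · obtain ⟨rem', h1, h2⟩ := hinv.advance hct hptr hvis
      refine ⟨by omega, k - 2, by omega, by simpa using hC, fun j hj => ?_, by simpa using h.lists,
        by simpa using h.complete, by simp, rem', dep, by simpa using h1, ?_⟩
      · obtain ⟨-, -, -, -, h5, -⟩ := hfresh j hj
        simpa [h5] using h.fresh j hj
      · simp
        omega
    · obtain ⟨rem', dep', h1, h2, h3⟩ := hinv.push I.graph I.lt h.lists h.complete hct hptr rfl hvis
      refine ⟨by omega, by omega, by omega, by omega, by omega, by omega, by omega, by omega,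
        by omega, by omega, by omega, k - 1, by omega, by simpa using hC, fun j hj => ?_,
        by simpa using h.lists, by simpa using h.complete, by simp, rem', dep', by simpa using h1,
          ?_⟩
      · have := hfresh j hj
        simpa [this] using h.fresh j hj
      · simp
        omega

theorem dfs_spec (hF : Fits U w) (hU : 4 * (n + m + 1) = U) (I : Instance Adj L n m s t e₁ e₂ ef)
    {H : Store} (hB : BuildInv Adj L n m s t e₁ e₂ ef m H) :
    Halts U w dfs H (200 * m + 200) (DfsPost Adj L n m s t e₁ e₂ ef) := by
  obtain ⟨adj, hl, hcov⟩ := hB.lists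
  have hC := hB.const
  have hs := I.s_lt
  have ht := I.t_lt
  have hcomp : ∀ u v, Adj u v → ∃ r ∈ adj u, H.A 2 r = v := by
    intro u v huv
    obtain ⟨i, hi, ⟨rfl, rfl⟩ | ⟨rfl, rfl⟩⟩ := I.cover u v huv
    · exact (hcov i hi).1
    · exact (hcov i hi).2
  refine ((halts_of_wp hF dfsInit _ (fun H => ∃ k ≤ 4 * m + 1,
    DfsState Adj L n m s t e₁ e₂ ef adj k H) ?_).mono le_rfl ?_).seq (T₂ := 200 * m + 100) |>.mono
    (by simp only [dfsInit, cost]; omega) fun _ h => h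
  · simp only [dfsInit, wp, numArrays, Store.set_r, Store.put_r, Store.put_A,
      hC.one, hC.zero, hC.r₃, hC.r₄, Nat.reduceEqDiff, if_true, if_false, Nat.reduceLT, true_and]
    refine ⟨by omega, by omega, by omega, by omega, by omega, by omega, by omega, by omega,
      by omega,
      _, ?_, by simpa using hC, fun j hj => ?_, by simpa using hl, by simpa using hcomp, by simp,
      adj, fun v => if v = t then 0 else 1, ?_, rfl⟩
    · simp [I.ne]
      have := hl.sum
      omega
    · have : j ≠ 1 ∧ j ≠ 2 ∧ j ≠ 3 ∧ j ≠ 4 ∧ j ≠ 5 ∧ j ≠ 6 ∧ j ≠ 7 ∧ j ≠ 8 ∧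
        j ≠ 9 ∧ j ≠ 10 ∧ j ≠ 11 := by omega
      simpa [this] using hB.fresh j (by omega)
    · simp only [Store.set_r, Store.set_A, Store.put_r, Store.put_A, hB.fresh 5 (by omega),
        hB.fresh 6 (by omega), hB.fresh 7 (by omega), hB.fresh 8 (by omega), hB.fresh 9 (by omega),
        hB.fresh 10 (by omega), hB.fresh 11 (by omega), Nat.reduceEqDiff, if_true, if_false]
      exact .init I hl hcomp
  · rintro H' ⟨k, hk, hH'⟩
    refine (Halts.loop (T := 40) (I := DfsState Adj L n m s t e₁ e₂ ef adj) ?_ k _ hH').mono ?_ ?_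
    · intro k H h hb
      refine (halts_of_wp hF _ _ _ (dfs_body hU I h fun hct => ?_)).mono
        (by simp [cost, dfsStep]) fun H' h => h
      obtain ⟨rem, dep, hinv, -⟩ := h.inv
      simp [Holds, h.const.zero, h.number, hct, hinv.tree.pre_t] at hb
    · omega
    · rintro H ⟨⟨k, h⟩, hb⟩
      obtain ⟨rem, dep, hinv, -⟩ := h.inv
      have hct : H.r 14 = t := by
        apply hinv.tree.pre_inj hinv.found hinv.tree.vis_t
        simpa [Holds, h.const.zero, h.number, hinv.tree.pre_t] using hb
      refine ⟨h.const, h.fresh, hinv.tree, fun v u hv hvt hvu => ?_, hinv.low, hinv.lt, ?_⟩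
      · rcases hinv.nbr v u hv hvt hvu with h1 | ⟨r, hr, -⟩
        · exact h1
        · rw [hinv.fin v hv hvt fun h => hvt (by rw [hct] at h; exact h.eq_root)] at hr
          exact absurd hr List.not_mem_nil
      · have := hinv.sum
        omega

end OddPath

namespace OddPath

/-! ### Computation of the lowpoints -/

variable {Adj : ℕ → ℕ → Prop} {L : ℕ → ℕ → ℕ} {n m s t : ℕ} {e₁ e₂ ef : ℕ → ℕ} {U w : ℕ}
variable {vis pre par ord lab low dn g : ℕ → ℕ} {cnt i : ℕ}

/-- Lowpoints in which only the first `i` edges are accounted for, and no tree edges. -/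
structure LowEdges (Adj : ℕ → ℕ → Prop) (L : ℕ → ℕ → ℕ) (s t : ℕ) (e₁ e₂ : ℕ → ℕ)
    (vis pre par low dn g : ℕ → ℕ) (i : ℕ) : Prop where
  le : ∀ v, vis v = 1 → low v ≤ pre v
  attained : ∀ v, vis v = 1 → v ≠ t → v ≠ s → low v < pre v →
    vis (dn v) = 1 ∧ Adj v (dn v) ∧ pre (dn v) = low v ∧ g v = L v (dn v)
  back : ∀ j < i, ∀ v u, (e₁ j = u ∧ e₂ j = v) ∨ (e₁ j = v ∧ e₂ j = u) → vis v = 1 → vis u = 1 →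
    pre u < pre v → u ≠ par v → low v ≤ pre u
  g_le : ∀ v, g v ≤ 1

theorem LowEdges.relax (hL : Labelled Adj L)
    (h : LowEdges Adj L s t e₁ e₂ vis pre par low dn g i) {u v : ℕ} (hu : vis u = 1)
    (hvu : Adj v u) (hlt : pre u < low v) :
    LowEdges Adj L s t e₁ e₂ vis pre par (Function.update low v (pre u)) (Function.update dn v u)
      (Function.update g v (L v u)) i where
  le x hx := by
    by_cases hxv : x = v
    · subst hxv
      rw [Function.update_self]
      exact (hlt.trans_le (h.le x hx)).le
    · rw [Function.update_of_ne hxv]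
      exact h.le x hx
  attained x hx hxt hxs hlow := by
    by_cases hxv : x = v
    · subst hxv
      simp only [Function.update_self]
      exact ⟨hu, hvu, trivial, trivial⟩
    · rw [Function.update_of_ne hxv] at hlow ⊢
      rw [Function.update_of_ne hxv, Function.update_of_ne hxv]
      exact h.attained x hx hxt hxs hlow
  back j hj x y hxy hx hy hp hpar := by
    have := h.back j hj x y hxy hx hy hp hpar
    by_cases hxv : x = v
    · subst hxv
      rw [Function.update_self]
      omega
    · rwa [Function.update_of_ne hxv]
  g_le x := by
    by_cases hxv : x = v
    · rw [hxv, Function.update_self]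
      exact hL.le_one _ _
    · rw [Function.update_of_ne hxv]
      exact h.g_le x

theorem LowEdges.succ (h : LowEdges Adj L s t e₁ e₂ vis pre par low dn g i)
    (h₁ : vis (e₁ i) = 1 → vis (e₂ i) = 1 → pre (e₁ i) < pre (e₂ i) → e₁ i ≠ par (e₂ i) →
      low (e₂ i) ≤ pre (e₁ i))
    (h₂ : vis (e₁ i) = 1 → vis (e₂ i) = 1 → pre (e₂ i) < pre (e₁ i) → e₂ i ≠ par (e₁ i) →
      low (e₁ i) ≤ pre (e₂ i)) :
    LowEdges Adj L s t e₁ e₂ vis pre par low dn g (i + 1) where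
  le := h.le
  attained := h.attained
  g_le := h.g_le
  back j hj v u huv hv hu hp hpar := by
    rcases Nat.lt_succ_iff_lt_or_eq.1 hj with hj | rfl
    · exact h.back j hj v u huv hv hu hp hpar
    · rcases huv with ⟨rfl, rfl⟩ | ⟨rfl, rfl⟩
      · exact h₁ hu hv hp hpar
      · exact h₂ hv hu hp hpar

/-- Lowpoints in which all edges are accounted for, but only the tree edges to vertices with numbers
at least `i`. -/
structure LowTree (Adj : ℕ → ℕ → Prop) (L : ℕ → ℕ → ℕ) (s t : ℕ)
    (vis pre par lab low dn g : ℕ → ℕ) (i : ℕ) : Prop where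
  le : ∀ v, vis v = 1 → low v ≤ pre v
  attained : ∀ v, vis v = 1 → v ≠ t → v ≠ s → low v < pre v →
    (vis (dn v) = 1 ∧ Adj v (dn v) ∧ pre (dn v) = low v ∧ g v = L v (dn v)) ∨
    (vis (dn v) = 1 ∧ dn v ≠ t ∧ dn v ≠ s ∧ par (dn v) = v ∧ low (dn v) = low v ∧
      g v = (g (dn v) + lab (dn v)) % 2 ∧ i ≤ pre (dn v))
  back : ∀ v u, vis v = 1 → vis u = 1 → Adj v u → pre u < pre v → u ≠ par v → low v ≤ pre u
  child : ∀ c, vis c = 1 → c ≠ t → c ≠ s → i ≤ pre c → low (par c) ≤ low c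
  g_le : ∀ v, g v ≤ 1

theorem LowEdges.lowTree (I : Instance Adj L n m s t e₁ e₂ ef)
    (T : Tree Adj L s t vis pre par ord lab cnt)
    (h : LowEdges Adj L s t e₁ e₂ vis pre par low dn g m) :
    LowTree Adj L s t vis pre par lab low dn g cnt where
  le := h.le
  attained v hv hvt hvs hlt := .inl (h.attained v hv hvt hvs hlt)
  back v u hv hu hvu hlt hp := by
    obtain ⟨j, hj, hjuv⟩ := I.cover v u hvu
    exact h.back j hj v u hjuv.symm hv hu hlt hp
  child c hc _ _ hlt := absurd (T.pre_lt c hc) (by omega)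
  g_le := h.g_le

theorem LowTree.toLow (h : LowTree Adj L s t vis pre par lab low dn g 2)
    (T : Tree Adj L s t vis pre par ord lab cnt) : Low Adj L s t vis pre par lab low dn g where
  attained v hv hvt hvs hlt := (h.attained v hv hvt hvs hlt).imp_right
    fun ⟨h1, h2, h3, h4, h5, h6, _⟩ => ⟨h1, h2, h3, h4, h5, h6⟩
  back v u hv hu _ _ := h.back v u hv hu
  child c hc hct hcs _ := by
    refine h.child c hc hct hcs ?_
    have h1 : pre c ≠ 0 := fun h => hct (T.pre_inj hc T.vis_t (h.trans T.pre_t.symm))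
    have h2 : pre c ≠ 1 := fun h => hcs (T.pre_inj hc T.vis_s (h.trans T.pre_s.symm))
    omega

section Propagate

variable (T : Tree Adj L s t vis pre par ord lab cnt)
  (h : LowTree Adj L s t vis pre par lab low dn g (i + 1)) {v : ℕ} (hv : vis v = 1) (hvt : v ≠ t)
  (hvs : v ≠ s) (hi : pre v = i)

include T h hi hv

theorem LowTree.keep (hle : low (par v) ≤ low v) :
    LowTree Adj L s t vis pre par lab low dn g i where
  le := h.le
  attained x hx hxt hxs hlt := (h.attained x hx hxt hxs hlt).imp_right
    fun ⟨h1, h2, h3, h4, h5, h6, h7⟩ => ⟨h1, h2, h3, h4, h5, h6, by omega⟩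
  back := h.back
  child c hc hct hcs hic := by
    by_cases hci : pre c = i
    · rwa [T.pre_inj hc hv (hci.trans hi.symm)]
    · exact h.child c hc hct hcs (by omega)
  g_le := h.g_le

include hvt hvs

/-- The lowpoint of `v` improves the one of its parent. -/
theorem LowTree.propagate (hlt : low v < low (par v)) :
    LowTree Adj L s t vis pre par lab (Function.update low (par v) (low v))
      (Function.update dn (par v) v) (Function.update g (par v) ((g v + lab v) % 2)) i := by
  have hp := T.pre_par v hv hvt
  have hne : ∀ {c}, i ≤ pre c → c ≠ par v := fun h1 h2 => by rw [h2] at h1; omega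
  refine ⟨fun x hx => ?_, fun x hx hxt hxs hlow => ?_, fun x u hx hu hxu hpre hpar => ?_,
    fun c hc hct hcs hic => ?_, fun x => ?_⟩
  · by_cases hxv : x = par v
    · have := h.le x hx
      rw [hxv, Function.update_self]
      rw [hxv] at this
      omega
    · rw [Function.update_of_ne hxv]
      exact h.le x hx
  · by_cases hxv : x = par v
    · right
      rw [hxv, Function.update_self, Function.update_self, Function.update_self,
        Function.update_of_ne (hne hi.ge), Function.update_of_ne (hne hi.ge)]
      exact ⟨hv, hvt, hvs, rfl, rfl, rfl, hi.ge⟩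
    · simp only [Function.update_of_ne hxv] at hlow ⊢
      refine (h.attained x hx hxt hxs hlow).imp_right fun ⟨h1, h2, h3, h4, h5, h6, h7⟩ => ?_
      rw [Function.update_of_ne (hne (by omega)), Function.update_of_ne (hne (by omega))]
      exact ⟨h1, h2, h3, h4, h5, h6, by omega⟩
  · have := h.back x u hx hu hxu hpre hpar
    by_cases hxv : x = par v
    · rw [hxv, Function.update_self]
      rw [hxv] at this
      omega
    · rwa [Function.update_of_ne hxv]
  · rw [Function.update_of_ne (hne hic) _ low]
    by_cases hci : pre c = i
    · rw [T.pre_inj hc hv (hci.trans hi.symm), Function.update_self]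
    · have := h.child c hc hct hcs (by omega)
      by_cases hxv : par c = par v
      · rw [hxv, Function.update_self]
        rw [hxv] at this
        omega
      · rwa [Function.update_of_ne hxv]
  · by_cases hxv : x = par v
    · rw [hxv, Function.update_self]
      omega
    · rw [Function.update_of_ne hxv]
      exact h.g_le x

end Propagate

/-- The sum of two bits modulo `2`. -/
def xor (d a b : ℕ) : Cmd := .cond (.eq a b) (.const d 0) (.const d 1)

theorem wp_xor {d a b : ℕ} {Q : Store → Prop} {H : Store} (ha : H.r a ≤ 1)
    (hb : H.r b ≤ 1) (h : Q (H.set d ((H.r a + H.r b) % 2))) : wp U (xor d a b) Q H := by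
  refine ⟨fun hab => ⟨by norm_num, ?_⟩, fun hab => ⟨by norm_num, ?_⟩⟩
  · have hab : H.r a = H.r b := hab
    have : (H.r a + H.r b) % 2 = 0 := by omega
    rwa [this] at h
  · have hab : H.r a ≠ H.r b := hab
    have : (H.r a + H.r b) % 2 = 1 := by omega
    rwa [this] at h

/-- Account for the edge from variable `v` to its ancestor in variable `u`, where the number of `u`
is in variable `pu`. -/
def relax (u v pu : ℕ) : Cmd :=
  .get 23 8 v ;; .cond (.eq 23 u) .skip
    (.get 24 11 v ;; .cond (.lt pu 24) (.put 11 v pu ;; .put 12 v u ;; .put 13 v 11) .skip)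

/-- Account for all edges that do not belong to the tree. -/
def lowEdges : Cmd :=
  .const 7 4 ;; .const 8 0 ;; .loop (.lt 8 2) (readEdge ;; .get 16 6 9 ;; .get 17 6 10 ;;
    .cond (.eq 16 6) (.cond (.eq 17 6) (.get 18 7 9 ;; .get 19 7 10 ;;
      .cond (.lt 18 19) (relax 9 10 18) (relax 10 9 19)) .skip) .skip)

/-- Propagate the lowpoints from the vertices to their parents. -/
def lowTree : Cmd :=
  .const 23 2 ;; .move 8 15 ;; .loop (.lt 23 8) (.sub 8 8 6 ;; .get 10 9 8 ;; .get 17 8 10 ;;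
    .get 18 11 10 ;; .get 19 11 17 ;; .cond (.lt 18 19)
      (.put 11 17 18 ;; .put 12 17 10 ;; .get 24 13 10 ;; .get 25 10 10 ;; xor 26 24 25 ;;
        .put 13 17 26) .skip)

/-- What remains unchanged after depth-first search. -/
structure Searched (Adj : ℕ → ℕ → Prop) (L : ℕ → ℕ → ℕ) (n m s t : ℕ) (e₁ e₂ ef : ℕ → ℕ)
    (H : Store) : Prop where
  const : Const n m s t e₁ e₂ ef H
  tree : Tree Adj L s t (H.A 6) (H.A 7) (H.A 8) (H.A 9) (H.A 10) (H.r 15)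
  closed : ∀ v u, H.A 6 v = 1 → v ≠ t → Adj v u → H.A 6 u = 1
  lt : ∀ v, H.A 6 v = 1 → v < n
  cnt : H.r 15 ≤ 2 * m + 2

theorem Searched.congr {H H' : Store} (h : Searched Adj L n m s t e₁ e₂ ef H)
    (hC : Const n m s t e₁ e₂ ef H') (h6 : H'.A 6 = H.A 6) (h7 : H'.A 7 = H.A 7)
    (h8 : H'.A 8 = H.A 8) (h9 : H'.A 9 = H.A 9) (h10 : H'.A 10 = H.A 10) (h15 : H'.r 15 = H.r 15) :
    Searched Adj L n m s t e₁ e₂ ef H' := by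
  refine ⟨hC, ?_, ?_, ?_, ?_⟩
  · rw [h6, h7, h8, h9, h10, h15]
    exact h.tree
  · rw [h6]
    exact h.closed
  · rw [h6]
    exact h.lt
  · rw [h15]
    exact h.cnt

/-- The invariant of `lowEdges`. -/
structure LowEdgesState (Adj : ℕ → ℕ → Prop) (L : ℕ → ℕ → ℕ) (n m s t : ℕ) (e₁ e₂ ef : ℕ → ℕ)
    (i : ℕ) (H : Store) : Prop where
  searched : Searched Adj L n m s t e₁ e₂ ef H
  fresh : ∀ j, 14 ≤ j → H.A j = fun _ => 0
  inv : LowEdges Adj L s t e₁ e₂ (H.A 6) (H.A 7) (H.A 8) (H.A 11) (H.A 12) (H.A 13) i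
  r₇ : H.r 7 = 4 + 3 * i
  r₈ : H.r 8 = i

theorem wp_relax (hU : 4 * (n + m + 1) = U) (I : Instance Adj L n m s t e₁ e₂ ef) {i : ℕ}
    {H : Store} {u v pu : ℕ} (h : Searched Adj L n m s t e₁ e₂ ef H)
    (hf : ∀ j, 14 ≤ j → H.A j = fun _ => 0)
    (hinv : LowEdges Adj L s t e₁ e₂ (H.A 6) (H.A 7) (H.A 8) (H.A 11) (H.A 12) (H.A 13) i)
    (h7 : H.r 7 = 4 + 3 * (i + 1)) (h8 : H.r 8 = i + 1) (h11 : H.r 11 = L (H.r v) (H.r u))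
    (hu : H.A 6 (H.r u) = 1) (hv : H.A 6 (H.r v) = 1) (hadj : Adj (H.r v) (H.r u))
    (hpu : H.r pu = H.A 7 (H.r u))
    (he : (e₁ i = H.r u ∧ e₂ i = H.r v) ∨ (e₁ i = H.r v ∧ e₂ i = H.r u))
    (hlt : H.A 7 (H.r u) < H.A 7 (H.r v)) (hu' : u ≠ 23 ∧ u ≠ 24) (hv' : v ≠ 23 ∧ v ≠ 24)
    (hpu' : pu ≠ 23 ∧ pu ≠ 24) :
    wp U (relax u v pu) (LowEdgesState Adj L n m s t e₁ e₂ ef (i + 1)) H := by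
  have hun := h.lt _ hu
  have hvn := h.lt _ hv
  have hsucc : ∀ {low dn g}, LowEdges Adj L s t e₁ e₂ (H.A 6) (H.A 7) (H.A 8) low dn g i →
      (H.r u ≠ H.A 8 (H.r v) → low (H.r v) ≤ H.A 7 (H.r u)) →
      LowEdges Adj L s t e₁ e₂ (H.A 6) (H.A 7) (H.A 8) low dn g (i + 1) := by
    intro low dn g h1 h2
    rcases he with ⟨h3, h4⟩ | ⟨h3, h4⟩
    · refine h1.succ (fun _ _ _ h => ?_) (fun _ _ h _ => ?_)
      · rw [h3, h4] at *
        exact h2 h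
      · rw [h3, h4] at h
        omega
    · refine h1.succ (fun _ _ h _ => ?_) (fun _ _ _ h => ?_)
      · rw [h3, h4] at h
        omega
      · rw [h3, h4] at *
        exact h2 h
  simp only [relax, wp, numArrays, Holds, Store.set_r, Store.set_A, Store.put_r,
    Nat.reduceEqDiff, if_true, if_false, Nat.reduceLT, true_and, hu', hv', hpu']
  refine ⟨by omega, fun hp => ?_, fun hp => ⟨by omega, fun hlow => ⟨by omega, by omega, by omega,
      ?_⟩,
    fun hlow => ?_⟩⟩
  · exact ⟨h.congr (by simpa using h.const) rfl rfl rfl rfl rfl (by simp), by simpa using hf,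
      hsucc hinv fun h => absurd hp.symm h, by simpa using h7, by simpa using h8⟩
  · have h1 := hinv.relax I.graph hu hadj (by rwa [← hpu])
    refine ⟨h.congr (by simpa using h.const) (by simp) (by simp) (by simp) (by simp) (by simp)
      (by simp), fun j hj => ?_, ?_, by simpa using h7, by simpa using h8⟩
    · have : j ≠ 11 ∧ j ≠ 12 ∧ j ≠ 13 := by omega
      simpa [this] using hf j hj
    · have h2 := hsucc h1 fun _ => by rw [Function.update_self]
      simpa [hpu, h11] using h2
  · refine ⟨h.congr (by simpa using h.const) rfl rfl rfl rfl rfl (by simp), by simpa using hf,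
      hsucc hinv fun _ => ?_, by simpa using h7, by simpa using h8⟩
    simp only [Store.set_A]
    omega

theorem lowEdges_spec (hF : Fits U w) (hU : 4 * (n + m + 1) = U)
    (I : Instance Adj L n m s t e₁ e₂ ef) {H : Store} (hD : DfsPost Adj L n m s t e₁ e₂ ef H) :
    Halts U w lowEdges H (100 * m + 3) (LowEdgesState Adj L n m s t e₁ e₂ ef m) := by
  refine ((halts_of_wp hF (.const 7 4) _ _ ⟨by norm_num, ?_⟩).seq (T₂ := 100 * m + 2)).mono
    (by simp only [cost]; omega) fun _ h => h
  refine ((halts_of_wp hF (.const 8 0) _ _ ⟨by norm_num, ?_⟩).seq (T₂ := 100 * m + 1)).mono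
    (by simp only [cost]; omega) fun _ h => h
  refine (Halts.loop (T := 99) (I := fun k H => ∃ i, i + k = m ∧
    LowEdgesState Adj L n m s t e₁ e₂ ef i H) ?_ m _ ?_).mono (by omega) ?_
  · rintro k H ⟨i, hk, hB⟩ hb
    have hC := hB.searched.const
    have hi : i < m := by simpa [Holds, hB.r₈, hC.r₂] using hb
    suffices h : wp U _ (LowEdgesState Adj L n m s t e₁ e₂ ef (i + 1)) H from
      (halts_of_wp hF _ _ _ h).mono (by simp [cost, readEdge, relax])
        fun H' h => ⟨k - 1, by omega, i + 1, by omega, h⟩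
    have hadj := I.adj i hi
    have hadj' := I.graph.symm _ _ hadj
    have hu := I.lt _ _ hadj
    have hv := I.lt _ _ hadj'
    have hlab := I.lab i hi
    refine wp_readEdge hU hC hB.r₇ hB.r₈ hi fun H' hC' hA h7 h8 h9 h10 h11 hr => ?_
    have hS : Searched Adj L n m s t e₁ e₂ ef H' :=
      hB.searched.congr hC' (by rw [hA]) (by rw [hA]) (by rw [hA]) (by rw [hA]) (by rw [hA])
        (hr _ (by omega))
    have hf := hB.fresh
    have hinv := hB.inv
    rw [← hA] at hf hinv
    simp only [wp, numArrays, Holds, Store.set_r, Store.set_A, h9, h10, hC'.one,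
      Nat.reduceEqDiff, if_true, if_false, Nat.reduceLT, true_and]
    refine ⟨by omega, by omega, fun h₁ => ⟨fun h₂ => ⟨by omega, by omega, fun hlt => ?_,
      fun hlt => ?_⟩, fun h₂ => ?_⟩, fun h₁ => ?_⟩
    · exact wp_relax hU I (i := i)
        (hS.congr (by simpa using hC') rfl rfl rfl rfl rfl (by simp)) hf hinv (by simpa using h7)
        (by simpa using h8) (by simp [h9, h10, h11, hlab, I.graph.lsymm (e₁ i)]) (by simpa [h9])
        (by simpa [h10]) (by simpa [h9, h10]) (by simp [h9]) (by simp [h9, h10])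
        (by simpa [h9, h10]) (by norm_num) (by norm_num) (by norm_num)
    · have hne : H'.A 7 (e₁ i) ≠ H'.A 7 (e₂ i) := fun h => by
        have := hS.tree.pre_inj h₁ h₂ h
        rw [this] at hadj
        exact I.graph.irrefl _ hadj
      have hlt' : H'.A 7 (e₂ i) < H'.A 7 (e₁ i) := by omega
      exact wp_relax hU I (i := i)
        (hS.congr (by simpa using hC') rfl rfl rfl rfl rfl (by simp)) hf hinv (by simpa using h7)
        (by simpa using h8) (by simp [h9, h10, h11, hlab]) (by simpa [h10])
        (by simpa [h9]) (by simpa [h9, h10]) (by simp [h10]) (by simp [h9, h10])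
        (by simpa [h9, h10]) (by norm_num) (by norm_num) (by norm_num)
    · exact ⟨hS.congr (by simpa using hC') rfl rfl rfl rfl rfl (by simp), hf,
        hinv.succ (fun _ h => absurd h h₂) fun _ h => absurd h h₂, by simpa using h7,
        by simpa using h8⟩
    · exact ⟨hS.congr (by simpa using hC') rfl rfl rfl rfl rfl (by simp), hf,
        hinv.succ (fun h => absurd h h₁) fun h => absurd h h₁, by simpa using h7,
        by simpa using h8⟩
  · refine ⟨0, by omega, ⟨by simpa using hD.const, hD.tree, hD.closed, hD.lt, hD.cnt⟩,
      fun j hj => by simpa using hD.fresh j (by omega), ⟨fun v hv => (hD.low v hv).le,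
        fun v hv _ _ h => absurd (hD.low v hv) h.ne, by simp, fun v => ?_⟩, by simp, by simp⟩
    simp [hD.fresh 13]
  · rintro H ⟨⟨k, i, hk, hB⟩, hb⟩
    have hi : ¬ i < m := by simpa [Holds, hB.r₈, hB.searched.const.r₂] using hb
    obtain rfl : i = m := by omega
    exact hB

/-- The result of computing the lowpoints. -/
structure LowPost (Adj : ℕ → ℕ → Prop) (L : ℕ → ℕ → ℕ) (n m s t : ℕ) (e₁ e₂ ef : ℕ → ℕ)
    (i : ℕ) (H : Store) : Prop where
  searched : Searched Adj L n m s t e₁ e₂ ef H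
  fresh : ∀ j, 14 ≤ j → H.A j = fun _ => 0
  inv : LowTree Adj L s t (H.A 6) (H.A 7) (H.A 8) (H.A 10) (H.A 11) (H.A 12) (H.A 13) i

theorem lowTree_spec (hF : Fits U w) (hU : 4 * (n + m + 1) = U)
    (I : Instance Adj L n m s t e₁ e₂ ef) {H : Store}
    (hD : LowEdgesState Adj L n m s t e₁ e₂ ef m H) :
    Halts U w lowTree H (100 * m + 100) (LowPost Adj L n m s t e₁ e₂ ef 2) := by
  refine ((halts_of_wp hF (.const 23 2) _ _ ⟨by norm_num, ?_⟩).seq (T₂ := 100 * m + 99)).mono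
    (by simp only [cost]; omega) fun _ h => h
  refine ((halts_of_wp hF (.move 8 15) _ _ ?_).seq (T₂ := 100 * m + 98)).mono
    (by simp only [cost]; omega) fun _ h => h
  have hcnt := hD.searched.cnt
  have h2 : 2 ≤ H.r 15 := by
    have h1 := hD.searched.tree.pre_lt s hD.searched.tree.vis_s
    rw [hD.searched.tree.pre_s] at h1
    exact h1
  refine (Halts.loop (T := 40) (I := fun k H => ∃ i, i = k + 2 ∧
    LowPost Adj L n m s t e₁ e₂ ef i H ∧ H.r 8 = i ∧ H.r 23 = 2 ∧ i ≤ H.r 15) ?_ (H.r 15 - 2) _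
    ?_).mono (by omega) ?_
  · rintro k H ⟨i, rfl, hB, h8, h23, h15⟩ hb
    have hS := hB.searched
    have hC := hS.const
    have hT := hS.tree
    have hcnt := hS.cnt
    have hk : 0 < k := by simpa [Holds, h8, h23] using hb
    suffices h : wp U _ (fun H => LowPost Adj L n m s t e₁ e₂ ef (k + 1) H ∧ H.r 8 = k + 1 ∧
        H.r 23 = 2 ∧ k + 1 ≤ H.r 15) H from
      (halts_of_wp hF _ _ _ h).mono (by simp [cost, xor])
        fun H' h => ⟨k - 1, by omega, k + 1, by omega, h⟩
    have hv := hT.vis_ord (k + 1) (by omega)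
    have hi := hT.pre_ord (k + 1) (by omega)
    have hvt : H.A 9 (k + 1) ≠ t := fun h => by rw [h, hT.pre_t] at hi; omega
    have hvs : H.A 9 (k + 1) ≠ s := fun h => by rw [h, hT.pre_s] at hi; omega
    have hvn := hS.lt _ hv
    have hpn := hS.lt _ (hT.vis_par _ hv hvt)
    have hlab := I.graph.le_one (H.A 8 (H.A 9 (k + 1))) (H.A 9 (k + 1))
    rw [← hT.lab_eq _ hv hvt hvs] at hlab
    have hg := hB.inv.g_le (H.A 9 (k + 1))
    have hk1 : k + 2 - 1 = k + 1 := rfl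
    simp only [wp, numArrays, Holds, Store.set_r, Store.set_A, Store.put_r, Store.put_A, h8, hC.one,
      hk1, Nat.reduceEqDiff, if_true, if_false, Nat.reduceLT, true_and]
    refine ⟨by omega, by omega, by omega, by omega, fun hlt => ⟨by omega, by omega, by omega,
      by omega, ?_⟩, fun hlt => ?_⟩
    · refine wp_xor (by simpa) (by simpa) ?_
      have h1 := hB.inv.propagate hT hv hvt hvs hi hlt
      simp only [Store.set_r, Store.put_r, Nat.reduceEqDiff, if_true, if_false, true_and]
      refine ⟨by omega, ⟨hS.congr (by simpa using hC) (by simp) (by simp) (by simp) (by simp)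
        (by simp) (by simp), fun j hj => ?_, by simpa using h1⟩, h23, by omega⟩
      have : j ≠ 11 ∧ j ≠ 12 ∧ j ≠ 13 := by omega
      simpa [this] using hB.fresh j hj
    · exact ⟨⟨hS.congr (by simpa using hC) rfl rfl rfl rfl rfl (by simp), hB.fresh,
        hB.inv.keep hT hv hi (by simpa using hlt)⟩, h23, by omega⟩
  · exact ⟨H.r 15, by omega, ⟨hD.searched.congr (by simpa using hD.searched.const) rfl rfl rfl rfl
      rfl (by simp), hD.fresh, hD.inv.lowTree I hD.searched.tree⟩, by simp, by simp, by simp⟩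
  · rintro H ⟨⟨k, i, hk, hB, h8, h23, -⟩, hb⟩
    have hi : ¬ 2 < i := by simpa [Holds, h8, h23] using hb
    obtain rfl : i = 2 := by omega
    exact hB

end OddPath

namespace OddPath

/-! ### Computation of the bipolar order -/

variable {Adj : ℕ → ℕ → Prop} {L : ℕ → ℕ → ℕ} {n m s t : ℕ} {e₁ e₂ ef : ℕ → ℕ} {U w : ℕ}
variable {vis pre par ord lab low dn g inS sign sd lo hi a b : ℕ → ℕ} {cnt i : ℕ}

/-- A bipolar order of those vertices whose number is less than `i`. Furthermore, `sign u` tells on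
which side of `u` the last child of `u` has been inserted: it is `1` if this child precedes `u`. -/
structure PartialBipolar (s t : ℕ) (vis pre par ord lab low dn g inS sign sd lo hi a b : ℕ → ℕ)
    (i : ℕ) : Prop where
  root : inS t = 1
  source : inS s = 1
  found : ∀ v, inS v = 1 → vis v = 1
  lt : ∀ v, inS v = 1 → pre v < i
  iff : ∀ v, vis v = 1 → v ≠ t → v ≠ s → pre v < i →
    (inS v = 1 ↔ inS (par v) = 1 ∧ low v < pre (par v))
  ptr : ∀ v, inS v = 1 → v ≠ t → v ≠ s →
    (sd v = 1 ∧ hi v = par v ∧ lo v = dn v ∧ b v = (b (par v) + lab v) % 2 ∧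
      a v = (a (ord (low v)) + g v) % 2) ∨
    (sd v = 0 ∧ lo v = par v ∧ hi v = dn v ∧ a v = (a (par v) + lab v) % 2 ∧
      b v = (b (ord (low v)) + g v) % 2)
  side : ∀ v c, inS v = 1 → v ≠ t → v ≠ s → c ≠ t → Anc par t c (par v) → par c = ord (low v) →
    (sd v = 1 ↔ sd c ≠ 1)
  sign_iff : ∀ c, inS c = 1 → c ≠ t →
    (∀ c', inS c' = 1 → c' ≠ t → par c' = par c → pre c' ≤ pre c) → (sign (par c) = 1 ↔ sd c = 1)
  sd_s : sd s = 1
  a_s : a s = 0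
  a_t : a t = 0
  b_t : b t = 0
  a_le : ∀ v, a v ≤ 1
  b_le : ∀ v, b v ≤ 1

theorem PartialBipolar.bipolar (T : Tree Adj L s t vis pre par ord lab cnt)
    (h : PartialBipolar s t vis pre par ord lab low dn g inS sign sd lo hi a b cnt) :
    Bipolar s t vis pre par ord lab low dn g inS sd lo hi a b where
  root := h.root
  source := h.source
  found := h.found
  iff v hv hvt hvs := h.iff v hv hvt hvs (T.pre_lt v hv)
  ptr := h.ptr
  side := h.side
  sd_s := h.sd_s
  a_s := h.a_s
  a_t := h.a_t
  b_t := h.b_t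

theorem PartialBipolar.init (T : Tree Adj L s t vis pre par ord lab cnt) :
    PartialBipolar s t vis pre par ord lab low dn g
      (Function.update (Function.update (fun _ => 0) t 1) s 1) (Function.update (fun _ => 0) t 1)
      (Function.update (fun _ => 0) s 1) (fun _ => 0) (fun _ => 0) (fun _ => 0) (fun _ => 0) 2 := by
  have hst := T.ne
  have hv : ∀ {v}, Function.update (Function.update (fun _ => 0) t 1) s 1 v = 1 → v = t ∨
      v = s := by
    intro v hv
    by_contra h
    rw [not_or] at h
    simp [h] at hv
  have hlt : ∀ {v}, vis v = 1 → pre v < 2 → v = t ∨ v = s := by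
    intro v hv h
    by_cases h0 : pre v = 0
    · exact .inl (T.pre_inj hv T.vis_t (h0.trans T.pre_t.symm))
    · exact .inr (T.pre_inj hv T.vis_s ((by omega : pre v = 1).trans T.pre_s.symm))
  refine
    { root := by simp [Ne.symm hst]
      source := by simp
      found := fun v h => ?_
      lt := fun v h => ?_
      iff := fun v h ht hs hp => ((hlt h hp).elim ht hs).elim
      ptr := fun v h ht hs => ((hv h).elim ht hs).elim
      side := fun v c h ht hs => ((hv h).elim ht hs).elim
      sign_iff := fun c h hct _ => ?_
      sd_s := by simp
      a_s := rfl
      a_t := rfl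
      b_t := rfl
      a_le := by simp
      b_le := by simp }
  · rcases hv h with rfl | rfl
    · exact T.vis_t
    · exact T.vis_s
  · rcases hv h with rfl | rfl
    · rw [T.pre_t]
      norm_num
    · rw [T.pre_s]
      norm_num
  · obtain rfl := (hv h).resolve_left hct
    simp [T.par_s]

section Step

variable (T : Tree Adj L s t vis pre par ord lab cnt)
  (h : PartialBipolar s t vis pre par ord lab low dn g inS sign sd lo hi a b i) {v : ℕ}
  (hv : vis v = 1)
  (hpi : pre v = i)

include T h hv hpi

theorem PartialBipolar.skip (hS : ¬ (inS (par v) = 1 ∧ low v < pre (par v))) :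
    PartialBipolar s t vis pre par ord lab low dn g inS sign sd lo hi a b (i + 1) where
  __ := h
  lt x hx := (h.lt x hx).trans (Nat.lt_succ_self i)
  iff x hx hxt hxs hxi := by
    by_cases hxv : pre x = i
    · obtain rfl := T.pre_inj hx hv (hxv.trans hpi.symm)
      exact ⟨fun h' => absurd (h.lt x h') (by omega), fun h' => absurd h' hS⟩
    · exact h.iff x hx hxt hxs (by omega)

/-- The sign of `ord (low v)` belongs to the child towards `v`, because all vertices that have been
inserted after this child are descendants of it. -/
theorem PartialBipolar.side_of_sign (hvt : v ≠ t) (hq : inS (par v) = 1) {c : ℕ} (hct : c ≠ t)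
    (hc : Anc par t c (par v)) (hp : par c = ord (low v)) :
    sign (ord (low v)) = 1 ↔ sd c = 1 := by
  have hvq := T.vis_par v hv hvt
  have hcvis := T.vis_anc hc hvq
  have hcS : inS c = 1 := by
    clear hp
    have : ∀ x, Anc par t c x → vis x = 1 → pre x < i → inS x = 1 → inS c = 1 := by
      intro x hx
      induction hx with
      | refl => exact fun _ _ h => h
      | @step x hne _ ih =>
        intro hx hxi hxS
        have h1 := T.pre_par x hx hne
        refine ih (T.vis_par x hx hne) (by omega) ?_
        by_cases hxs : x = s
        · rw [hxs, T.par_s]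
          exact h.root
        · exact ((h.iff x hx hne hxs hxi).1 hxS).1
    exact this _ hc hvq (by have := T.pre_par v hv hvt; omega) hq
  rw [← hp]
  refine h.sign_iff c hcS hct fun c' hc' hct' hpc => ?_
  by_contra hlt
  have h1 := h.lt c' hc'
  have h2 := T.contig c v c' hv (h.found c' hc') (.step hvt hc) (by omega) (by omega)
  have h3 := h2.par_of_ne fun h => by rw [h] at hlt; exact hlt le_rfl
  rw [hpc] at h3
  have h4 := T.pre_le_anc h3 (T.vis_par c hcvis hct)
  have h5 := T.pre_par c hcvis hct
  omega

theorem PartialBipolar.insert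
    (hvt : v ≠ t) (hvs : v ≠ s) (hq : inS (par v) = 1) (hlow : low v < pre (par v))
    {sv lv hv' av bv : ℕ} (hsv : sv = 1 ↔ sign (ord (low v)) ≠ 1)
    (hptr : (sv = 1 ∧ hv' = par v ∧ lv = dn v ∧ bv = (b (par v) + lab v) % 2 ∧
        av = (a (ord (low v)) + g v) % 2) ∨
      (sv = 0 ∧ lv = par v ∧ hv' = dn v ∧ av = (a (par v) + lab v) % 2 ∧
        bv = (b (ord (low v)) + g v) % 2)) :
    PartialBipolar s t vis pre par ord lab low dn g (Function.update inS v 1)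
      (Function.update sign (par v) sv) (Function.update sd v sv) (Function.update lo v lv)
      (Function.update hi v hv') (Function.update a v av) (Function.update b v bv) (i + 1) := by
  have hvS : inS v ≠ 1 := fun h' => by have := h.lt v h'; omega
  have hS : ∀ {x}, Function.update inS v 1 x = 1 → x = v ∨ (x ≠ v ∧ inS x = 1) := by
    intro x hx
    by_cases hxv : x = v
    · exact .inl hxv
    · rw [Function.update_of_ne hxv] at hx
      exact .inr ⟨hxv, hx⟩
  have hne : ∀ {x}, inS x = 1 → x ≠ v := fun hx h => hvS (h ▸ hx)
  have hlt : ∀ {x}, pre x < i → x ≠ v := fun hx h => by rw [h] at hx; omega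
  have hpq := T.pre_par v hv hvt
  have hqvis := T.vis_par v hv hvt
  have hxo : pre (ord (low v)) = low v := T.pre_ord _ (by have := T.pre_lt v hv; omega)
  have hpar : ∀ {x}, vis x = 1 → x ≠ t → pre x ≤ i → par x ≠ v := fun hx hxt hxi => hlt (by
    have := T.pre_par _ hx hxt
    omega)
  -- the data that the pointers of older vertices refer to do not change
  have hlowne : ∀ {x}, inS x = 1 → x ≠ t → x ≠ s → ord (low x) ≠ v := fun {x} hx hxt hxs => hlt (by
    have h1 := h.lt x hx
    have h2 := T.pre_par x (h.found x hx) hxt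
    have h3 := ((h.iff x (h.found x hx) hxt hxs h1).1 hx).2
    rw [T.pre_ord _ (by have := T.pre_lt x (h.found x hx); omega)]
    omega)
  have hst : ∀ {f : ℕ → ℕ} {y}, Function.update f v y s = f s := Function.update_of_ne hvs.symm _ _
  have htt : ∀ {f : ℕ → ℕ} {y}, Function.update f v y t = f t := Function.update_of_ne hvt.symm _ _
  refine
    { root := by rw [htt, h.root]
      source := by rw [hst, h.source]
      found := fun x hx => ?_
      lt := fun x hx => ?_
      iff := fun x hx hxt hxs hxi => ?_
      ptr := fun x hx hxt hxs => ?_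
      side := fun x c hx hxt hxs hct hc hp => ?_
      sign_iff := fun c hc hct hlast => ?_
      sd_s := by rw [hst, h.sd_s]
      a_s := by rw [hst, h.a_s]
      a_t := by rw [htt, h.a_t]
      b_t := by rw [htt, h.b_t]
      a_le := fun x => ?_
      b_le := fun x => ?_ }
  · rcases hS hx with rfl | ⟨-, hx⟩
    · exact hv
    · exact h.found x hx
  · rcases hS hx with rfl | ⟨-, hx⟩
    · omega
    · exact (h.lt x hx).trans (Nat.lt_succ_self i)
  · rw [Function.update_of_ne (hpar hx hxt (by omega))]
    by_cases hxv : x = v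
    · subst hxv
      rw [Function.update_self]
      exact ⟨fun _ => ⟨hq, hlow⟩, fun _ => rfl⟩
    · rw [Function.update_of_ne hxv]
      refine h.iff x hx hxt hxs ?_
      have : pre x ≠ i := fun h' => hxv (T.pre_inj hx hv (h'.trans hpi.symm))
      omega
  · rcases hS hx with rfl | ⟨hxv, hxS⟩
    · have h1 := hpar hv hxt hpi.le
      have h2 : ord (low x) ≠ x := hlt (by omega)
      simpa only [Function.update_self, Function.update_of_ne h1, Function.update_of_ne h2] using
          hptr
    · have h1 := hpar (h.found x hxS) hxt (h.lt x hxS).le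
      have h2 := hlowne hxS hxt hxs
      simp only [Function.update_of_ne hxv, Function.update_of_ne h1, Function.update_of_ne h2]
      exact h.ptr x hxS hxt hxs
  · rcases hS hx with rfl | ⟨hxv, hxS⟩
    · have h1 := T.pre_le_anc hc hqvis
      rw [Function.update_self, Function.update_of_ne (hlt (by omega)), hsv]
      exact not_congr (h.side_of_sign T hv hpi hvt hq hct hc hp)
    · have hxvis := h.found x hxS
      have h1 := T.pre_le_anc hc (T.vis_par x hxvis hxt)
      have h2 := T.pre_par x hxvis hxt
      have h3 := h.lt x hxS
      rw [Function.update_of_ne hxv, Function.update_of_ne (hlt (by omega))]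
      exact h.side x c hxS hxt hxs hct hc hp
  · rcases hS hc with rfl | ⟨hcv, hcS⟩
    · rw [Function.update_self, Function.update_self]
    · rw [Function.update_of_ne hcv]
      by_cases hcp : par c = par v
      · have h1 := hlast v (by rw [Function.update_self]) hvt hcp.symm
        have h2 := h.lt c hcS
        omega
      · rw [Function.update_of_ne hcp]
        refine h.sign_iff c hcS hct fun c' hc' hct' hpc => hlast c' ?_ hct' hpc
        rwa [Function.update_of_ne (hne hc')]
  · by_cases hxv : x = v
    · rw [hxv, Function.update_self]
      omega
    · rw [Function.update_of_ne hxv]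
      exact h.a_le x
  · by_cases hxv : x = v
    · rw [hxv, Function.update_self]
      omega
    · rw [Function.update_of_ne hxv]
      exact h.b_le x

end Step

/-- Insert the vertex `v` in variable `10`, whose parent is in variable `17`, into the bipolar
order, and record a violation in the variables `20`, `21`, `22` if `a v` and `b v` differ. -/
def insertVertex : Cmd :=
  .put 14 10 6 ;; .get 13 9 18 ;; .get 24 15 13 ;; .get 25 12 10 ;; .get 26 10 10 ;;
  .get 27 13 10 ;;
  .cond (.eq 24 6)
    (.put 16 10 17 ;; .put 17 10 25 ;; .get 28 18 17 ;; xor 28 28 26 ;; .get 29 19 13 ;;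
      xor 29 29 27 ;; .put 21 10 5 ;; .put 15 17 5)
    (.put 17 10 17 ;; .put 16 10 25 ;; .get 28 18 13 ;; xor 28 28 27 ;; .get 29 19 17 ;;
      xor 29 29 26 ;; .put 21 10 6 ;; .put 15 17 6) ;;
  .put 18 10 28 ;; .put 19 10 29 ;;
  .cond (.eq 28 29) .skip (.const 20 1 ;; .get 21 16 10 ;; .move 22 10)

/-- Start the bipolar order with `s` and `t`. -/
def orderInit : Cmd :=
  .put 14 4 6 ;; .put 14 3 6 ;; .put 15 4 6 ;; .put 21 3 6 ;; .const 20 0 ;; .const 8 2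

/-- Compute the bipolar order. -/
def order : Cmd :=
  orderInit ;; .loop (.lt 8 15) (.get 10 9 8 ;; .get 17 8 10 ;; .get 16 14 17 ;;
    .cond (.eq 16 6) (.get 18 11 10 ;; .get 19 7 17 ;;
      .cond (.lt 18 19) insertVertex .skip) .skip ;;
    .add 8 8 6)

/-- The invariant of `order`. If variable `20` is `1`, then the variables `21` and `22` hold `lo v`
and `v` for a vertex `v` such that `a v` and `b v` differ. -/
structure OrderState (Adj : ℕ → ℕ → Prop) (L : ℕ → ℕ → ℕ) (n m s t : ℕ) (e₁ e₂ ef : ℕ → ℕ)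
    (i : ℕ) (H : Store) : Prop where
  searched : Searched Adj L n m s t e₁ e₂ ef H
  low : Low Adj L s t (H.A 6) (H.A 7) (H.A 8) (H.A 10) (H.A 11) (H.A 12) (H.A 13)
  low_le : ∀ v, H.A 6 v = 1 → H.A 11 v ≤ H.A 7 v
  g_le : ∀ v, H.A 13 v ≤ 1
  inv : PartialBipolar s t (H.A 6) (H.A 7) (H.A 8) (H.A 9) (H.A 10) (H.A 11) (H.A 12) (H.A 13)
    (H.A 14) (H.A 15) (H.A 21) (H.A 16) (H.A 17) (H.A 18) (H.A 19) i
  violation : (H.r 20 = 0 ∧ ∀ v, H.A 14 v = 1 → H.A 18 v = H.A 19 v) ∨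
    (H.r 20 = 1 ∧ ∃ v, H.A 14 v = 1 ∧ v ≠ t ∧ v ≠ s ∧ H.A 18 v ≠ H.A 19 v ∧ H.r 21 = H.A 16 v ∧
      H.r 22 = v)

theorem OrderState.congr {H H' : Store} (h : OrderState Adj L n m s t e₁ e₂ ef i H)
    (hC : Const n m s t e₁ e₂ ef H') (hA : H'.A = H.A) (h15 : H'.r 15 = H.r 15)
    (h20 : H'.r 20 = H.r 20) (h21 : H'.r 21 = H.r 21) (h22 : H'.r 22 = H.r 22) :
    OrderState Adj L n m s t e₁ e₂ ef i H' := by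
  refine ⟨h.searched.congr hC (by rw [hA]) (by rw [hA]) (by rw [hA]) (by rw [hA]) (by rw [hA]) h15,
    ?_, ?_, ?_, ?_, ?_⟩
  · rw [hA]
    exact h.low
  · rw [hA]
    exact h.low_le
  · rw [hA]
    exact h.g_le
  · rw [hA]
    exact h.inv
  · rw [hA, h20, h21, h22]
    exact h.violation

theorem OrderState.skip {v : ℕ} {H : Store} (h : OrderState Adj L n m s t e₁ e₂ ef i H)
    (hv : H.A 6 v = 1) (hi : H.A 7 v = i) (hS : ¬ (H.A 14 (H.A 8 v) = 1 ∧
      H.A 11 v < H.A 7 (H.A 8 v))) : OrderState Adj L n m s t e₁ e₂ ef (i + 1) H :=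
  ⟨h.searched, h.low, h.low_le, h.g_le, h.inv.skip h.searched.tree hv hi hS, h.violation⟩

theorem OrderState.insert {i v : ℕ} {H : Store} (h : OrderState Adj L n m s t e₁ e₂ ef i H)
    (hv : H.A 6 v = 1) (hi : H.A 7 v = i) (hvt : v ≠ t) (hvs : v ≠ s) (hq : H.A 14 (H.A 8 v) = 1)
    (hlow : H.A 11 v < H.A 7 (H.A 8 v)) {sv lv hv' av bv : ℕ}
    (hsv : sv = 1 ↔ H.A 15 (H.A 9 (H.A 11 v)) ≠ 1)
    (hptr : (sv = 1 ∧ hv' = H.A 8 v ∧ lv = H.A 12 v ∧ bv = (H.A 19 (H.A 8 v) + H.A 10 v) % 2 ∧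
        av = (H.A 18 (H.A 9 (H.A 11 v)) + H.A 13 v) % 2) ∨
      (sv = 0 ∧ lv = H.A 8 v ∧ hv' = H.A 12 v ∧ av = (H.A 18 (H.A 8 v) + H.A 10 v) % 2 ∧
        bv = (H.A 19 (H.A 9 (H.A 11 v)) + H.A 13 v) % 2))
    {H' : Store} (hC : Const n m s t e₁ e₂ ef H') (hA : ∀ j, 6 ≤ j → j < 14 → H'.A j = H.A j)
    (h14 : H'.A 14 = Function.update (H.A 14) v 1)
    (h15 : H'.A 15 = Function.update (H.A 15) (H.A 8 v) sv)
    (h21 : H'.A 21 = Function.update (H.A 21) v sv)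
    (h16 : H'.A 16 = Function.update (H.A 16) v lv)
    (h17 : H'.A 17 = Function.update (H.A 17) v hv')
    (h18 : H'.A 18 = Function.update (H.A 18) v av)
    (h19 : H'.A 19 = Function.update (H.A 19) v bv) (hr : H'.r 15 = H.r 15)
    (hviol : (av = bv ∧ H'.r 20 = H.r 20 ∧ H'.r 21 = H.r 21 ∧ H'.r 22 = H.r 22) ∨
      (av ≠ bv ∧ H'.r 20 = 1 ∧ H'.r 21 = lv ∧ H'.r 22 = v)) :
    OrderState Adj L n m s t e₁ e₂ ef (i + 1) H' := by
  have hS := h.searched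
  have hvS : ∀ x, H.A 14 x = 1 → x ≠ v := by
    rintro x hx rfl
    have := h.inv.lt x hx
    omega
  refine ⟨hS.congr hC (hA _ (by norm_num) (by norm_num)) (hA _ (by norm_num) (by norm_num))
    (hA _ (by norm_num) (by norm_num)) (hA _ (by norm_num) (by norm_num))
    (hA _ (by norm_num) (by norm_num)) hr, ?_, ?_, ?_, ?_, ?_⟩
  · simpa [hA] using h.low
  · simpa [hA] using h.low_le
  · simpa [hA] using h.g_le
  · rw [h14, h15, h16, h17, h18, h19, h21]
    simpa [hA] using h.inv.insert hS.tree hv hi hvt hvs hq hlow hsv hptr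
  · rw [h14, h16, h18, h19]
    rcases hviol with ⟨hab, h20, hx, hy⟩ | ⟨hab, h20, hx, hy⟩
    · rw [h20, hx, hy]
      refine h.violation.imp (fun ⟨h1, h2⟩ => ⟨h1, fun x hx => ?_⟩) fun ⟨h1, x, h2, h3⟩ =>
        ⟨h1, x, ?_⟩
      · by_cases hxv : x = v
        · rw [hxv, Function.update_self, Function.update_self, hab]
        · rw [Function.update_of_ne hxv] at hx
          rw [Function.update_of_ne hxv, Function.update_of_ne hxv, h2 x hx]
      · rw [Function.update_of_ne (hvS x h2), Function.update_of_ne (hvS x h2),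
          Function.update_of_ne (hvS x h2), Function.update_of_ne (hvS x h2)]
        exact ⟨h2, h3⟩
    · refine .inr ⟨h20, v, ?_⟩
      simp only [Function.update_self]
      exact ⟨trivial, hvt, hvs, hab, hx, hy⟩

theorem wp_insertVertex (hU : 4 * (n + m + 1) = U) (I : Instance Adj L n m s t e₁ e₂ ef) {i v : ℕ}
    {H : Store} (h : OrderState Adj L n m s t e₁ e₂ ef i H) (h8 : H.r 8 = i) (h10 : H.r 10 = v)
    (h17 : H.r 17 = H.A 8 v) (h18 : H.r 18 = H.A 11 v) (hv : H.A 6 v = 1) (hi : H.A 7 v = i)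
    (hvt : v ≠ t) (hvs : v ≠ s) (hq : H.A 14 (H.A 8 v) = 1) (hlow : H.A 11 v < H.A 7 (H.A 8 v)) :
    wp U insertVertex
      (fun H' => OrderState Adj L n m s t e₁ e₂ ef (i + 1) H' ∧ H'.r 8 = i ∧ H'.r 15 = H.r 15)
      H := by
  have hS := h.searched
  have hC := hS.const
  have hT := hS.tree
  have hcnt := hS.cnt
  have hvn := hS.lt v hv
  have hpn := hS.lt _ (hT.vis_par v hv hvt)
  have hlab := I.graph.le_one (H.A 8 v) v
  rw [← hT.lab_eq _ hv hvt hvs] at hlab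
  have hg := h.g_le v
  have hpre := hT.pre_lt v hv
  have hpp := hT.pre_par v hv hvt
  have hxvis := hT.vis_ord (H.A 11 v) (by omega)
  have hxn := hS.lt _ hxvis
  have ha := h.inv.a_le
  have hb := h.inv.b_le
  simp only [insertVertex, wp, numArrays, Holds, Store.set_r, Store.set_A, Store.put_r, Store.put_A,
    h10, h17, h18, hC.one, Nat.reduceEqDiff, if_true, if_false, Nat.reduceLT, true_and]
  refine ⟨by omega, by omega, by omega, by omega, by omega, by omega, fun hs => ?_, fun hs => ?_⟩
  · refine ⟨by omega, by omega, by omega, wp_xor (by simpa using ha _) (by simpa) ?_⟩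
    simp only [Store.set_r, Store.set_A, Store.put_r, Store.put_A, Nat.reduceEqDiff,
      if_true, if_false]
    refine ⟨by omega, wp_xor (by simpa using hb _) (by simpa) ?_⟩
    simp only [Store.set_r, Store.set_A, Store.put_r, Store.put_A, h10, h17, Nat.reduceEqDiff,
      if_true, if_false]
    refine ⟨by omega, by omega, by omega, by omega, fun hab => ⟨?_, h8, trivial⟩,
      fun hab => ⟨by omega, ?_, h8, trivial⟩⟩
    · refine h.insert (sv := 0) hv hi hvt hvs hq hlow (by simp [hs])
        (.inr ⟨rfl, rfl, rfl, rfl, rfl⟩)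
        (by simpa using hC) (fun j h1 h2 => ?_) (by simp) (by simp [hC.zero]) (by simp [hC.zero])
        (by simp) (by simp) (by simp) (by simp) (by simp) (.inl ⟨hab, by simp, by simp, by simp⟩)
      have : j ≠ 14 ∧ j ≠ 15 ∧ j ≠ 16 ∧ j ≠ 17 ∧ j ≠ 18 ∧ j ≠ 19 ∧ j ≠ 21 := by omega
      simp [this]
    · refine h.insert (sv := 0) hv hi hvt hvs hq hlow (by simp [hs])
        (.inr ⟨rfl, rfl, rfl, rfl, rfl⟩)
        (by simpa using hC) (fun j h1 h2 => ?_) (by simp) (by simp [hC.zero]) (by simp [hC.zero])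
        (by simp) (by simp) (by simp) (by simp) (by simp) (.inr ⟨hab, by simp, by simp, by simp⟩)
      have : j ≠ 14 ∧ j ≠ 15 ∧ j ≠ 16 ∧ j ≠ 17 ∧ j ≠ 18 ∧ j ≠ 19 ∧ j ≠ 21 := by omega
      simp [this]
  · refine ⟨by omega, by omega, by omega, wp_xor (by simpa using ha _) (by simpa) ?_⟩
    simp only [Store.set_r, Store.set_A, Store.put_r, Store.put_A, Nat.reduceEqDiff,
      if_true, if_false]
    refine ⟨by omega, wp_xor (by simpa using hb _) (by simpa) ?_⟩
    simp only [Store.set_r, Store.set_A, Store.put_r, Store.put_A, h10, h17, Nat.reduceEqDiff,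
      if_true, if_false]
    refine ⟨by omega, by omega, by omega, by omega, fun hab => ⟨?_, h8, trivial⟩,
      fun hab => ⟨by omega, ?_, h8, trivial⟩⟩
    · refine h.insert (sv := 1) hv hi hvt hvs hq hlow (by simp [hs])
        (.inl ⟨rfl, rfl, rfl, rfl, rfl⟩)
        (by simpa using hC) (fun j h1 h2 => ?_) (by simp) (by simp [hC.one]) (by simp [hC.one])
        (by simp) (by simp) (by simp) (by simp) (by simp) (.inl ⟨hab, by simp, by simp, by simp⟩)
      have : j ≠ 14 ∧ j ≠ 15 ∧ j ≠ 16 ∧ j ≠ 17 ∧ j ≠ 18 ∧ j ≠ 19 ∧ j ≠ 21 := by omega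
      simp [this]
    · refine h.insert (sv := 1) hv hi hvt hvs hq hlow (by simp [hs])
        (.inl ⟨rfl, rfl, rfl, rfl, rfl⟩)
        (by simpa using hC) (fun j h1 h2 => ?_) (by simp) (by simp [hC.one]) (by simp [hC.one])
        (by simp) (by simp) (by simp) (by simp) (by simp) (.inr ⟨hab, by simp, by simp, by simp⟩)
      have : j ≠ 14 ∧ j ≠ 15 ∧ j ≠ 16 ∧ j ≠ 17 ∧ j ≠ 18 ∧ j ≠ 19 ∧ j ≠ 21 := by omega
      simp [this]

theorem order_spec (hF : Fits U w) (hU : 4 * (n + m + 1) = U)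
    (I : Instance Adj L n m s t e₁ e₂ ef) {H : Store} (hD : LowPost Adj L n m s t e₁ e₂ ef 2 H) :
    Halts U w order H (160 * m + 20)
      (fun H' => OrderState Adj L n m s t e₁ e₂ ef (H'.r 15) H') := by
  have hS := hD.searched
  have hC := hS.const
  have hT := hS.tree
  have hs := I.s_lt
  have ht := I.t_lt
  have hst := I.ne
  have hcnt := hS.cnt
  have h2 : 2 ≤ H.r 15 := by
    have h1 := hT.pre_lt s hT.vis_s
    rw [hT.pre_s] at h1
    exact h1
  refine ((halts_of_wp hF orderInit _ (fun H' => OrderState Adj L n m s t e₁ e₂ ef 2 H' ∧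
    H'.r 8 = 2) ?_).mono le_rfl ?_).seq (T₂ := 160 * m + 5) |>.mono
    (by simp only [orderInit, cost]; omega) fun _ h => h
  · simp only [orderInit, wp, numArrays, Store.set_r, Store.put_r, hC.r₃, hC.r₄, hC.one,
      Nat.reduceEqDiff, if_true, if_false, Nat.reduceLT, true_and]
    refine ⟨by omega, by omega, by omega, by omega, ⟨hS.congr (by simpa using hC) (by simp)
        (by simp)
      (by simp) (by simp) (by simp) (by simp), by simpa using hD.inv.toLow hT,
      by simpa using hD.inv.le, by simpa using hD.inv.g_le, ?_, .inl ⟨by simp, ?_⟩⟩, trivial⟩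
    · simp only [Store.set_A, Store.put_A, Nat.reduceEqDiff, if_true, if_false,
        hD.fresh 14 (by omega), hD.fresh 15 (by omega), hD.fresh 16 (by omega),
        hD.fresh 17 (by omega), hD.fresh 18 (by omega), hD.fresh 19 (by omega),
        hD.fresh 21 (by omega)]
      exact .init hT
    · simp [hD.fresh]
  · rintro H₀ ⟨h₀, h8₀⟩
    have h2 : 2 ≤ H₀.r 15 := by
      have h1 := h₀.searched.tree.pre_lt s h₀.searched.tree.vis_s
      rw [h₀.searched.tree.pre_s] at h1
      exact h1
    have hcnt := h₀.searched.cnt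
    refine (Halts.loop (T := 79) (I := fun k H => ∃ i, i + k = H.r 15 ∧
      OrderState Adj L n m s t e₁ e₂ ef i H ∧ H.r 8 = i ∧ 2 ≤ i) ?_ (H₀.r 15 - 2) _
      ⟨2, by omega, h₀, h8₀, le_rfl⟩).mono (by omega) ?_
    · rintro k H ⟨i, hk, h, h8, hi2⟩ hb
      have hi : i < H.r 15 := by simpa [Holds, h8] using hb
      have hS := h.searched
      have hC := hS.const
      have hT := hS.tree
      have hcnt := hS.cnt
      suffices h : wp U _ (fun H' => OrderState Adj L n m s t e₁ e₂ ef (i + 1) H' ∧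
          H'.r 8 = i + 1 ∧ H'.r 15 = H.r 15) H from
        (halts_of_wp hF _ _ _ h).mono (by simp [cost, xor, insertVertex])
          fun H' h => ⟨k - 1, by omega, i + 1, by omega, h.1, h.2.1, by omega⟩
      have hv := hT.vis_ord i hi
      have hpi := hT.pre_ord i hi
      have hvt : H.A 9 i ≠ t := fun h => by rw [h, hT.pre_t] at hpi; omega
      have hvs : H.A 9 i ≠ s := fun h => by rw [h, hT.pre_s] at hpi; omega
      have hvn := hS.lt _ hv
      have hpn := hS.lt _ (hT.vis_par _ hv hvt)
      simp only [wp, numArrays, Holds, Store.set_r, Store.set_A, h8, hC.one,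
        Nat.reduceEqDiff, if_true, if_false, Nat.reduceLT, true_and]
      refine ⟨by omega, by omega, by omega, fun hq => ⟨by omega, by omega, fun hlow => ?_,
        fun hlow => ?_⟩, fun hq => ?_⟩
      · refine wp.mono (fun H' h' => ?_) (wp_insertVertex hU I (i := i) (v := H.A 9 i)
          (h.congr (by simpa using hC) rfl (by simp) (by simp) (by simp) (by simp))
          (by simpa using h8) (by simp) (by simp) (by simp) hv hpi hvt hvs hq hlow)
        obtain ⟨h1, h2, h3⟩ := h'
        have hC' := h1.searched.const
        simp only [Store.set_r, Nat.reduceEqDiff, if_false] at h3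
        exact ⟨by rw [h2, hC'.one]; omega, h1.congr (by simpa using hC') rfl rfl rfl rfl rfl,
          by rw [h2, hC'.one], h3⟩
      · exact ⟨by omega, (h.skip hv hpi fun h => hlow h.2).congr (by simpa using hC) rfl (by simp)
          (by simp) (by simp) (by simp), trivial⟩
      · exact ⟨by omega, (h.skip hv hpi fun h => hq h.1).congr (by simpa using hC) rfl (by simp)
          (by simp) (by simp) (by simp), trivial⟩
    · rintro H ⟨⟨k, i, hk, hB, h8, -⟩, hb⟩
      have hi : ¬ i < H.r 15 := by simpa [Holds, h8] using hb
      obtain rfl : i = H.r 15 := by omega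
      exact hB

end OddPath

namespace OddPath

/-! ### Detection of an odd path -/

variable {Adj : ℕ → ℕ → Prop} {L : ℕ → ℕ → ℕ} {n m s t : ℕ} {e₁ e₂ ef : ℕ → ℕ} {U w : ℕ}
variable {vis pre par ord lab low dn g inS sign sd lo hi a b : ℕ → ℕ} {cnt i : ℕ}

/-- The vertex `s` is the minimum of the bipolar order, because the subtree of a child of `s` that
belongs to the set has an edge to `t`. -/
theorem Bipolar.pos_source_lt (T : Tree Adj L s t vis pre par ord lab cnt)
    (B : Bipolar s t vis pre par ord lab low dn g inS sd lo hi a b) {v : ℕ} (hv : inS v = 1)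
    (hne : v ≠ s) : pos par ord sd t cnt s < pos par ord sd t cnt v := by
  by_cases hvt : v = t
  · rw [hvt]
    exact B.pos_lt_root T T.vis_s T.ne
  have hvis := B.found v hv
  obtain ⟨d, hdt, hdp, hdv⟩ := (T.root_anc v hvis).exists_child (Ne.symm hvt)
  have hds : d = s := by
    by_contra h
    exact T.par_ne d (T.vis_anc hdv hvis) hdt h hdp
  rw [hds] at hdv
  obtain ⟨c, hct, hcp, hcv⟩ := hdv.exists_child (Ne.symm hne)
  have hcs : c ≠ s := fun h => T.ne (by rw [← hcp, h, T.par_s])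
  have hcS := B.inS_anc T hcv hv
  have hlow := ((B.iff c (B.found c hcS) hct hcs).1 hcS).2
  rw [hcp, T.pre_s] at hlow
  have h0 : ord (low c) = t := by
    have := T.ord_pre t T.vis_t
    rwa [T.pre_t, ← (by omega : low c = 0)] at this
  have hside := B.side c s hcS hct hcs T.ne (by rw [hcp]; exact .refl) (by rw [T.par_s, h0])
  have := par_lt_pos T hcv hvis hct fun h => hside.1 h B.sd_s
  rwa [hcp] at this

/-- The result of computing the bipolar order. -/
structure Ordered (Adj : ℕ → ℕ → Prop) (L : ℕ → ℕ → ℕ) (n m s t : ℕ) (e₁ e₂ ef : ℕ → ℕ)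
    (H : Store) : Prop where
  searched : Searched Adj L n m s t e₁ e₂ ef H
  low : Low Adj L s t (H.A 6) (H.A 7) (H.A 8) (H.A 10) (H.A 11) (H.A 12) (H.A 13)
  bipolar : Bipolar s t (H.A 6) (H.A 7) (H.A 8) (H.A 9) (H.A 10) (H.A 11) (H.A 12) (H.A 13)
    (H.A 14) (H.A 21) (H.A 16) (H.A 17) (H.A 18) (H.A 19)
  a_le : ∀ v, H.A 18 v ≤ 1
  b_le : ∀ v, H.A 19 v ≤ 1

/-- The position in the computed bipolar order. -/
noncomputable def Store.pos (t : ℕ) (H : Store) (v : ℕ) : ℚ :=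
  OddPath.pos (H.A 8) (H.A 9) (H.A 21) t (H.r 15) v

/-- An edge from `x` to a greater neighbour `y` such that going down from `x` and up from `y` yields
an odd path. -/
structure OddEdge (Adj : ℕ → ℕ → Prop) (L : ℕ → ℕ → ℕ) (t : ℕ) (H : Store) (x y : ℕ) : Prop where
  fst : H.A 14 x = 1
  snd : H.A 14 y = 1
  adj : Adj x y
  lt : H.pos t x < H.pos t y
  odd : (H.A 18 x + L x y + H.A 19 y) % 2 = 1

theorem Ordered.congr {H H' : Store} (h : Ordered Adj L n m s t e₁ e₂ ef H)
    (hC : Const n m s t e₁ e₂ ef H') (hA : H'.A = H.A) (h15 : H'.r 15 = H.r 15) :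
    Ordered Adj L n m s t e₁ e₂ ef H' := by
  refine ⟨h.searched.congr hC (by rw [hA]) (by rw [hA]) (by rw [hA]) (by rw [hA]) (by rw [hA]) h15,
    ?_, ?_, ?_, ?_⟩
  · rw [hA]
    exact h.low
  · rw [hA]
    exact h.bipolar
  · rw [hA]
    exact h.a_le
  · rw [hA]
    exact h.b_le

theorem OddEdge.congr {H H' : Store} {x y : ℕ} (h : OddEdge Adj L t H x y) (hA : H'.A = H.A)
    (h15 : H'.r 15 = H.r 15) : OddEdge Adj L t H' x y := by
  obtain ⟨h1, h2, h3, h4, h5⟩ := h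
  refine ⟨?_, ?_, h3, ?_, ?_⟩
  · rwa [hA]
  · rwa [hA]
  · unfold Store.pos at *
    rwa [hA, h15]
  · rwa [hA]

theorem OrderState.ordered {H : Store} (h : OrderState Adj L n m s t e₁ e₂ ef (H.r 15) H) :
    Ordered Adj L n m s t e₁ e₂ ef H :=
  ⟨h.searched, h.low, h.inv.bipolar h.searched.tree, h.inv.a_le, h.inv.b_le⟩

/-- If `a v ≠ b v`, then the edge from `lo v` to `v` lies on an odd path. -/
theorem Ordered.oddEdge_lo (I : Instance Adj L n m s t e₁ e₂ ef) {H : Store}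
    (h : Ordered Adj L n m s t e₁ e₂ ef H) {v : ℕ} (hv : H.A 14 v = 1) (hvt : v ≠ t) (hvs : v ≠ s)
    (hab : H.A 18 v ≠ H.A 19 v) : OddEdge Adj L t H (H.A 16 v) v := by
  obtain ⟨⟨h1, h2, h3, h4⟩, -⟩ := h.bipolar.ptr_spec I.graph h.searched.tree h.low hv hvt hvs
  have := h.a_le v
  have := h.b_le v
  exact ⟨h1, hv, h2, h3, by omega⟩

/-- The state of the search for an edge between vertices of the bipolar order at which `a` is not a
potential, where only the first `i` edges have been considered. -/
structure CheckState (Adj : ℕ → ℕ → Prop) (L : ℕ → ℕ → ℕ) (n m s t : ℕ) (e₁ e₂ ef : ℕ → ℕ)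
    (i : ℕ) (H : Store) : Prop where
  ordered : Ordered Adj L n m s t e₁ e₂ ef H
  eq : ∀ v, H.A 14 v = 1 → H.A 18 v = H.A 19 v
  r₇ : H.r 7 = 4 + 3 * i
  r₈ : H.r 8 = i
  violation : (H.r 20 = 0 ∧ ∀ j < i, H.A 14 (e₁ j) = 1 → H.A 14 (e₂ j) = 1 →
      (H.A 18 (e₁ j) + H.A 18 (e₂ j) + ef j) % 2 = 0) ∨
    (H.r 20 ≠ 0 ∧ H.A 14 (H.r 21) = 1 ∧ H.A 14 (H.r 22) = 1 ∧ Adj (H.r 21) (H.r 22) ∧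
      (H.A 18 (H.r 21) + H.A 18 (H.r 22) + L (H.r 21) (H.r 22)) % 2 = 1)

/-- Search for an edge between vertices of the bipolar order at which `a` is not a potential. -/
def check : Cmd :=
  .const 7 4 ;; .const 8 0 ;; .loop (.lt 8 2) (readEdge ;; .get 16 14 9 ;; .get 17 14 10 ;;
    .cond (.eq 16 6) (.cond (.eq 17 6) (.get 18 18 9 ;; .get 19 18 10 ;; xor 18 18 19 ;;
      .cond (.eq 18 11) .skip (.const 20 2 ;; .move 21 9 ;; .move 22 10)) .skip) .skip)

theorem check_spec (hF : Fits U w) (hU : 4 * (n + m + 1) = U)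
    (I : Instance Adj L n m s t e₁ e₂ ef) {H : Store} (hD : Ordered Adj L n m s t e₁ e₂ ef H)
    (hab : ∀ v, H.A 14 v = 1 → H.A 18 v = H.A 19 v) (h20 : H.r 20 = 0) :
    Halts U w check H (100 * m + 3) (CheckState Adj L n m s t e₁ e₂ ef m) := by
  refine ((halts_of_wp hF (.const 7 4) _ _ ⟨by norm_num, ?_⟩).seq (T₂ := 100 * m + 2)).mono
    (by simp only [cost]; omega) fun _ h => h
  refine ((halts_of_wp hF (.const 8 0) _ _ ⟨by norm_num, ?_⟩).seq (T₂ := 100 * m + 1)).mono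
    (by simp only [cost]; omega) fun _ h => h
  refine (Halts.loop (T := 99) (I := fun k H => ∃ i, i + k = m ∧
    CheckState Adj L n m s t e₁ e₂ ef i H) ?_ m _ ?_).mono (by omega) ?_
  · rintro k H ⟨i, hk, hB⟩ hb
    have hC := hB.ordered.searched.const
    have hi : i < m := by simpa [Holds, hB.r₈, hC.r₂] using hb
    suffices h : wp U _ (CheckState Adj L n m s t e₁ e₂ ef (i + 1)) H from
      (halts_of_wp hF _ _ _ h).mono (by simp [cost, readEdge, xor])
        fun H' h => ⟨k - 1, by omega, i + 1, by omega, h⟩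
    have hadj := I.adj i hi
    have hu := I.lt _ _ hadj
    have hv := I.lt _ _ (I.graph.symm _ _ hadj)
    have hlab := I.lab i hi
    have hle := I.graph.le_one (e₁ i) (e₂ i)
    have hviol := hB.violation
    have heq := hB.eq
    have ha := hB.ordered.a_le
    refine wp_readEdge hU hC hB.r₇ hB.r₈ hi fun H' hC' hA h7 h8 h9 h10 h11 hr => ?_
    have hO := hB.ordered.congr hC' hA (hr _ (by norm_num))
    rw [← hr 20 (by norm_num), ← hr 21 (by norm_num), ← hr 22 (by norm_num)] at hviol
    rw [← hA] at hviol heq ha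
    simp only [wp, numArrays, Holds, Store.set_r, Store.set_A, h9, h10, hC'.one,
      Nat.reduceEqDiff, if_true, if_false, Nat.reduceLT, true_and]
    have hnext : ((H'.A 14 (e₁ i) = 1 → H'.A 14 (e₂ i) = 1 →
        (H'.A 18 (e₁ i) + H'.A 18 (e₂ i) + ef i) % 2 = 0)) →
        (H'.r 20 = 0 ∧ ∀ j < i + 1, H'.A 14 (e₁ j) = 1 → H'.A 14 (e₂ j) = 1 →
          (H'.A 18 (e₁ j) + H'.A 18 (e₂ j) + ef j) % 2 = 0) ∨
        (H'.r 20 ≠ 0 ∧ H'.A 14 (H'.r 21) = 1 ∧ H'.A 14 (H'.r 22) = 1 ∧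
          Adj (H'.r 21) (H'.r 22) ∧
          (H'.A 18 (H'.r 21) + H'.A 18 (H'.r 22) + L (H'.r 21) (H'.r 22)) % 2 = 1) := by
      refine fun h => hviol.imp_left fun ⟨h1, h2⟩ => ⟨h1, fun j hj => ?_⟩
      rcases Nat.lt_succ_iff_lt_or_eq.1 hj with hj | rfl
      · exact h2 j hj
      · exact h
    refine ⟨by omega, by omega, fun h₁ => ⟨fun h₂ => ⟨by omega, by omega, ?_⟩, fun h₂ => ?_⟩,
      fun h₁ => ?_⟩
    · refine wp_xor (by simpa using ha _) (by simpa using ha _) ?_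
      simp only [Store.set_r, h9, h10, h11, Nat.reduceEqDiff, if_true, if_false]
      refine ⟨fun h => ?_, fun h => ?_⟩
      · exact ⟨hO.congr (by simpa using hC') rfl (by simp), heq, by simpa using h7,
          by simpa using h8, hnext fun _ _ => by omega⟩
      · refine ⟨hO.congr (by simpa using hC') rfl (by simp), heq, by simpa using h7,
          by simpa using h8, .inr ?_⟩
        simp only [Store.set_r, Store.set_A, Nat.reduceEqDiff, if_true, if_false]
        exact ⟨by norm_num, h₁, h₂, hadj, by omega⟩
    · exact ⟨hO.congr (by simpa using hC') rfl (by simp), heq, by simpa using h7,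
          by simpa using h8, hnext fun _ h => absurd h h₂⟩
    · exact ⟨hO.congr (by simpa using hC') rfl (by simp), heq, by simpa using h7,
          by simpa using h8, hnext fun h => absurd h h₁⟩
  · exact ⟨0, by omega, hD.congr (by simpa using hD.searched.const) rfl (by simp), hab, by simp,
      by simp, .inl ⟨by simpa using h20, by simp⟩⟩
  · rintro H ⟨⟨k, i, hk, hB⟩, hb⟩
    have hi : ¬ i < m := by simpa [Holds, hB.r₈, hB.ordered.searched.const.r₂] using hb
    obtain rfl : i = m := by omega
    exact hB

/-! ### Orientation of an edge -/

/-- Exchange the variables `21` and `22`. -/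
def swapEnds : Cmd := .move 23 21 ;; .move 21 22 ;; .move 22 23

/-- Let variable `21` hold the end of the edge that is the ancestor of the other one. -/
def orientInit : Cmd :=
  .get 16 7 21 ;; .get 17 7 22 ;; .cond (.lt 16 17) .skip swapEnds ;; .move 14 22 ;; .const 19 0

/-- Move on to the child, in variable `14`, of the ancestor towards the other end. -/
def orientLoop : Cmd :=
  .loop (.eq 19 5) (.get 16 8 14 ;; .cond (.eq 16 21) (.const 19 1) (.move 14 16))

/-- Orient the edge between the vertices in the variables `21` and `22` upwards in the bipolar
order. -/
def orient : Cmd :=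
  orientInit ;; orientLoop ;; .get 16 21 14 ;; .cond (.eq 16 6) swapEnds .skip

/-- The invariant of `orientLoop`. -/
structure OrientState (Adj : ℕ → ℕ → Prop) (L : ℕ → ℕ → ℕ) (n m s t : ℕ) (e₁ e₂ ef : ℕ → ℕ)
    (x y k : ℕ) (H : Store) : Prop where
  ordered : Ordered Adj L n m s t e₁ e₂ ef H
  eq : ∀ v, H.A 14 v = 1 → H.A 18 v = H.A 19 v
  r₂₀ : H.r 20 ≠ 0
  fst : H.A 14 x = 1
  snd : H.A 14 y = 1
  adj : Adj x y
  odd : (H.A 18 x + H.A 18 y + L x y) % 2 = 1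
  r₂₁ : H.r 21 = x
  r₂₂ : H.r 22 = y
  anc : Anc (H.A 8) t x (H.r 14)
  ne : x ≠ H.r 14
  desc : Anc (H.A 8) t (H.r 14) y
  measure : (H.r 19 = 0 ∧ k = H.A 7 (H.r 14) + 1) ∨
    (H.r 19 = 1 ∧ H.A 8 (H.r 14) = x ∧ k = 0)

theorem orientInit_spec (hU : 4 * (n + m + 1) = U)
    (I : Instance Adj L n m s t e₁ e₂ ef) {H : Store}
    (hD : CheckState Adj L n m s t e₁ e₂ ef m H) (h20 : H.r 20 ≠ 0) :
    wp U orientInit (fun H' => ∃ x y, OrientState Adj L n m s t e₁ e₂ ef x y (H.A 7 y + 1) H' ∧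
      H.A 7 y < 2 * m + 2) H := by
  have hO := hD.ordered
  have hS := hO.searched
  have hC := hS.const
  have hT := hS.tree
  have hcnt := hS.cnt
  obtain ⟨h1, h2, h3, h4⟩ := (hD.violation.resolve_left fun h => h20 h.1).2
  have hv1 := hO.bipolar.found _ h1
  have hv2 := hO.bipolar.found _ h2
  have hp1 := hT.pre_lt _ hv1
  have hp2 := hT.pre_lt _ hv2
  have hn1 := hS.lt _ hv1
  have hn2 := hS.lt _ hv2
  have hl := I.graph.lsymm (H.r 21) (H.r 22)
  have hadj := I.graph.symm _ _ h3
  simp only [orientInit, swapEnds, wp, numArrays, Holds, Store.set_r, Store.set_A,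
    Nat.reduceEqDiff, if_true, if_false, Nat.reduceLT, true_and]
  refine ⟨by omega, by omega, fun hlt => ⟨H.r 21, H.r 22, ?_, by omega⟩,
    fun hlt => ⟨H.r 22, H.r 21, ?_, by omega⟩⟩
  · exact ⟨hO.congr (by simpa using hC) rfl (by simp), hD.eq, by simpa using h20, h1, h2, h3, h4,
      by simp, by simp, by simpa using hT.anc _ _ hv1 hv2 h3 hlt,
      by simpa using fun h : H.r 21 = H.r 22 => by rw [h] at hlt; exact lt_irrefl _ hlt,
      by simpa using .refl, .inl ⟨by simp, by simp⟩⟩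
  · have hne : H.A 7 (H.r 21) ≠ H.A 7 (H.r 22) := fun h => by
      rw [hT.pre_inj hv1 hv2 h] at h3
      exact I.graph.irrefl _ h3
    have hlt' : H.A 7 (H.r 22) < H.A 7 (H.r 21) := by omega
    exact ⟨hO.congr (by simpa using hC) rfl (by simp), hD.eq, by simpa using h20, h2, h1, hadj,
      by simp only [Store.set_A]; omega,
      by simp, by simp, by simpa using hT.anc _ _ hv2 hv1 hadj hlt',
      by simpa using fun h : H.r 22 = H.r 21 => by rw [h] at hlt'; exact lt_irrefl _ hlt',
      by simpa using .refl, .inl ⟨by simp, by simp⟩⟩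

theorem orientLoop_spec (hF : Fits U w) (hU : 4 * (n + m + 1) = U) {x y k : ℕ} {H : Store}
    (hD : OrientState Adj L n m s t e₁ e₂ ef x y k H) :
    Halts U w orientLoop H (k * 7 + 1)
      (fun H' => OrientState Adj L n m s t e₁ e₂ ef x y 0 H') := by
  refine (Halts.loop (T := 6) (I := OrientState Adj L n m s t e₁ e₂ ef x y) ?_ k _ hD).mono
    (by omega) ?_
  · rintro k H h hb
    have hO := h.ordered
    have hS := hO.searched
    have hC := hS.const
    have hT := hS.tree
    have h19 : H.r 19 = 0 := by simpa [Holds, hC.zero] using hb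
    obtain ⟨-, hk⟩ := h.measure.resolve_right (by omega)
    have hyvis := hO.bipolar.found _ h.snd
    have hcvis := hT.vis_anc h.desc hyvis
    have hcn := hS.lt _ hcvis
    have hct : H.r 14 ≠ t := fun h' => h.ne (by
      have := h.anc
      rw [h'] at this ⊢
      exact this.eq_root)
    have hpre := hT.pre_par _ hcvis hct
    suffices h : wp U _ (fun H => ∃ k' < k, OrientState Adj L n m s t e₁ e₂ ef x y k' H) H from
      (halts_of_wp hF _ _ _ h).mono (by simp [cost]) fun H' h => h
    simp only [wp, numArrays, Holds, Store.set_r, h.r₂₁,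
      Nat.reduceEqDiff, if_true, if_false, Nat.reduceLT, true_and]
    refine ⟨by omega, fun hp => ⟨0, by omega, ?_⟩, fun hp => ⟨H.A 7 (H.A 8 (H.r 14)) + 1,
      by omega, ?_⟩⟩
    · exact ⟨hO.congr (by simpa using hC) rfl (by simp), h.eq, by simpa using h.r₂₀, h.fst, h.snd,
        h.adj, h.odd, by simpa using h.r₂₁, by simpa using h.r₂₂, by simpa using h.anc,
        by simpa using h.ne, by simpa using h.desc, .inr ⟨by simp, by simpa using hp, rfl⟩⟩
    · exact ⟨hO.congr (by simpa using hC) rfl (by simp), h.eq, by simpa using h.r₂₀, h.fst, h.snd,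
        h.adj, h.odd, by simpa using h.r₂₁, by simpa using h.r₂₂,
        by simpa using h.anc.par_of_ne h.ne, by simpa using Ne.symm hp,
        by simpa using (Anc.step hct .refl).trans h.desc, .inl ⟨by simpa using h19, by simp⟩⟩
  · rintro H ⟨⟨k, h⟩, hb⟩
    have h19 : H.r 19 ≠ 0 := by simpa [Holds, h.ordered.searched.const.zero] using hb
    obtain ⟨h1, h2, rfl⟩ := h.measure.resolve_left fun h => h19 h.1
    exact h

/-- The outcome of the search: either `a` is a potential for the labels, or the variables `21` and
`22` hold the ends of an edge that lies on an odd path. -/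
structure Decided (Adj : ℕ → ℕ → Prop) (L : ℕ → ℕ → ℕ) (n m s t : ℕ) (e₁ e₂ ef : ℕ → ℕ)
    (H : Store) : Prop where
  ordered : Ordered Adj L n m s t e₁ e₂ ef H
  cases : (H.r 20 = 0 ∧ ∀ u v, H.A 14 u = 1 → H.A 14 v = 1 → Adj u v →
      (H.A 18 u + H.A 18 v + L u v) % 2 = 0) ∨
    (H.r 20 ≠ 0 ∧ OddEdge Adj L t H (H.r 21) (H.r 22))

theorem orient_spec (hF : Fits U w) (hU : 4 * (n + m + 1) = U)
    (I : Instance Adj L n m s t e₁ e₂ ef) {H : Store}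
    (hD : CheckState Adj L n m s t e₁ e₂ ef m H) (h20 : H.r 20 ≠ 0) :
    Halts U w orient H (20 * m + 40) (Decided Adj L n m s t e₁ e₂ ef) := by
  refine ((halts_of_wp hF orientInit _ _ (orientInit_spec hU I hD h20)).mono le_rfl ?_).seq
    (T₂ := 20 * m + 25) |>.mono (by simp only [orientInit, swapEnds, cost]; omega) fun _ h => h
  rintro H₁ ⟨x, y, h₁, hlt⟩
  refine ((orientLoop_spec hF hU h₁).mono le_rfl ?_).seq (T₂ := 7) |>.mono (by omega) fun _ h => h
  intro H h
  suffices h : wp U _ (Decided Adj L n m s t e₁ e₂ ef) H from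
    (halts_of_wp hF _ _ _ h).mono (by simp [swapEnds, cost]) fun H' h => h
  have hO := h.ordered
  have hS := hO.searched
  have hC := hS.const
  have hT := hS.tree
  have hyvis := hO.bipolar.found _ h.snd
  have hcvis := hT.vis_anc h.desc hyvis
  have hcn := hS.lt _ hcvis
  have hct : H.r 14 ≠ t := fun h' => h.ne (by
    have := h.anc
    rw [h'] at this ⊢
    exact this.eq_root)
  obtain ⟨-, hp, -⟩ := h.measure.resolve_left fun h => absurd h.2 (by omega)
  have hx := h.eq x h.fst
  have hy := h.eq y h.snd
  have hl := I.graph.lsymm x y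
  have hodd := h.odd
  simp only [swapEnds, wp, numArrays, Holds, Store.set_r, hC.one, h.r₂₁, h.r₂₂,
    Nat.reduceEqDiff, if_true, if_false, Nat.reduceLT, true_and]
  refine ⟨by omega, fun hsd => ?_, fun hsd => ?_⟩
  · have hpos := pos_lt_par (sd := H.A 21) hT h.desc hyvis hct hsd
    rw [hp] at hpos
    have he : OddEdge Adj L t H y x :=
      ⟨h.snd, h.fst, I.graph.symm _ _ h.adj, hpos, by omega⟩
    refine ⟨hO.congr (by simpa using hC) rfl (by simp), .inr ⟨by simpa using h.r₂₀, ?_⟩⟩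
    exact he.congr rfl (by simp)
  · have hpos := par_lt_pos (sd := H.A 21) hT h.desc hyvis hct hsd
    rw [hp] at hpos
    have he : OddEdge Adj L t H x y := ⟨h.fst, h.snd, h.adj, hpos, by omega⟩
    refine ⟨hO.congr (by simpa using hC) rfl (by simp), .inr ⟨by simpa using h.r₂₀, ?_⟩⟩
    simpa [h.r₂₁, h.r₂₂] using he.congr (H' := H.set 16 (H.A 21 (H.r 14))) rfl (by simp)

/-- Look for an edge that lies on an odd path, unless one has been found already. -/
def decide : Cmd :=
  .cond (.eq 20 5) (check ;; .cond (.eq 20 5) .skip orient) .skip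

theorem decide_spec (hF : Fits U w) (hU : 4 * (n + m + 1) = U)
    (I : Instance Adj L n m s t e₁ e₂ ef) {H : Store}
    (hD : OrderState Adj L n m s t e₁ e₂ ef (H.r 15) H) :
    Halts U w decide H (120 * m + 50) (Decided Adj L n m s t e₁ e₂ ef) := by
  have hO := hD.ordered
  have hz := hO.searched.const.zero
  refine (Halts.cond (T := 120 * m + 49) (fun hb => ?_) fun hb => ?_).mono (by omega) fun _ h => h
  · have hb : H.r 20 = 0 := by simpa [Holds, hz] using hb
    have hab := (hD.violation.resolve_right fun h => by omega).2
    refine ((check_spec hF hU I hO hab hb).mono le_rfl ?_).seq (T₂ := 20 * m + 41) |>.mono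
      (by omega) fun _ h => h
    intro H h
    have hz := h.ordered.searched.const.zero
    refine (Halts.cond (T := 20 * m + 40) (fun hb => ?_) fun hb => ?_).mono (by omega)
      fun _ h => h
    · have hb : H.r 20 = 0 := by simpa [Holds, hz] using hb
      refine (halts_of_wp hF .skip _ _ ?_).mono (by simp only [cost]; omega) fun _ h => h
      refine ⟨h.ordered, .inl ⟨hb, fun u v hu hv huv => ?_⟩⟩
      have hp := (h.violation.resolve_right fun h => h.1 hb).2
      obtain ⟨j, hj, ⟨rfl, rfl⟩ | ⟨rfl, rfl⟩⟩ := I.cover u v huv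
      · have := hp j hj hu hv
        rwa [I.lab j hj] at this
      · have := hp j hj hv hu
        rwa [I.lab j hj, I.graph.lsymm, add_comm (H.A 18 (e₁ j))] at this
    · exact orient_spec hF hU I h (by simpa [Holds, hz] using hb)
  · have hb : H.r 20 ≠ 0 := by simpa [Holds, hz] using hb
    refine (halts_of_wp hF .skip _ _ ?_).mono (by simp only [cost]; omega) fun _ h => h
    obtain ⟨v, hv, hvt, hvs, hab, hx, hy⟩ := (hD.violation.resolve_left fun h => hb h.1).2
    have := hO.oddEdge_lo I hv hvt hvs hab
    rw [← hx, ← hy] at this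
    exact ⟨hO, .inr ⟨hb, this⟩⟩

end OddPath

namespace OddPath

/-! ### Output of the path -/

variable {Adj : ℕ → ℕ → Prop} {L : ℕ → ℕ → ℕ} {n m s t : ℕ} {e₁ e₂ ef : ℕ → ℕ} {U w : ℕ}

/-- A path that increases in the order `f`, from `x` to `y`. Prolonged downwards from `x` and
upwards from `y`, where `a` and `b` count the labels, it becomes an odd path. -/
structure Route (Adj : ℕ → ℕ → Prop) (L : ℕ → ℕ → ℕ) (f : ℕ → ℚ) (a b : ℕ → ℕ) (x y : ℕ)
    (l : List ℕ) : Prop where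
  chain : l.IsChain fun u v => Adj u v ∧ f u < f v
  head : l.head? = some x
  last : l.getLast? = some y
  odd : (labelSum L l + a x + b y) % 2 = 1

theorem Route.cons {f : ℕ → ℚ} {a b : ℕ → ℕ} {x x' y : ℕ} {l : List ℕ}
    (h : Route Adj L f a b x y l) (hadj : Adj x' x) (hf : f x' < f x)
    (ha : (a x + a x' + L x' x) % 2 = 0) : Route Adj L f a b x' y (x' :: l) := by
  obtain ⟨h1, h2, h3, h4⟩ := h
  cases l with
  | nil => simp at h2
  | cons z l =>
    obtain rfl : z = x := by simpa using h2
    refine ⟨List.isChain_cons_cons.2 ⟨⟨hadj, hf⟩, h1⟩, rfl, by simpa using h3, ?_⟩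
    rw [labelSum]
    omega

theorem Route.concat {f : ℕ → ℚ} {a b : ℕ → ℕ} {x y y' : ℕ} {l : List ℕ}
    (h : Route Adj L f a b x y l) (hadj : Adj y y') (hf : f y < f y')
    (hb : (b y + b y' + L y y') % 2 = 0) : Route Adj L f a b x y' (l ++ [y']) := by
  obtain ⟨h1, h2, h3, h4⟩ := h
  obtain ⟨l, rfl⟩ := List.getLast?_eq_some_iff.1 h3
  refine ⟨h1.append (.singleton _) fun u hu v hv => ?_, ?_, by simp, ?_⟩
  · obtain rfl : y = u := by simpa using hu
    obtain rfl : y' = v := by simpa using hv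
    exact ⟨hadj, hf⟩
  · simpa [List.head?_append] using h2
  · rw [labelSum_concat]
    omega

/-- The entries of the array `f` from number `j` to number `e - 1`. -/
def segment (f : ℕ → ℕ) (j e : ℕ) : List ℕ := (List.range' j (e - j)).map f

theorem segment_cons {f : ℕ → ℕ} {j e x : ℕ} (h : j < e) :
    segment (Function.update f j x) j e = x :: segment f (j + 1) e := by
  obtain ⟨k, rfl⟩ : ∃ k, e = j + (k + 1) := ⟨e - j - 1, by omega⟩
  have h1 : j + (k + 1) - j = k + 1 := by omega
  have h2 : j + (k + 1) - (j + 1) = k := by omega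
  rw [segment, segment, h1, h2, List.range'_succ, List.map_cons, Function.update_self]
  congr 1
  refine List.map_congr_left fun i hi => Function.update_of_ne ?_ _ _
  have := List.mem_range'_1.1 hi
  omega

theorem segment_concat {f : ℕ → ℕ} {j e x : ℕ} (h : j ≤ e) :
    segment (Function.update f e x) j (e + 1) = segment f j e ++ [x] := by
  obtain ⟨k, rfl⟩ : ∃ k, e = j + k := ⟨e - j, by omega⟩
  have h1 : j + k + 1 - j = k + 1 := by omega
  have h2 : j + k - j = k := by omega
  rw [segment, segment, h1, h2, List.range'_1_concat, List.map_append]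
  congr 1
  · refine List.map_congr_left fun i hi => Function.update_of_ne ?_ _ _
    have := List.mem_range'_1.1 hi
    omega
  · simp

open Classical in
/-- The number of vertices of the bipolar order below `x`. -/
noncomputable def numBelow (n : ℕ) (S : ℕ → ℕ) (f : ℕ → ℚ) (x : ℕ) : ℕ :=
  ((Finset.range n).filter fun v => S v = 1 ∧ f v < f x).card

theorem numBelow_lt {S : ℕ → ℕ} {f : ℕ → ℚ} {x y : ℕ} (hn : x < n) (hx : S x = 1) (h : f x < f y) :
    numBelow n S f x < numBelow n S f y := by
  classical
  refine Finset.card_lt_card (Finset.ssubset_iff_of_subset ?_ |>.2 ⟨x, ?_, ?_⟩)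
  · intro v hv
    simp only [Finset.mem_filter] at hv ⊢
    exact ⟨hv.1, hv.2.1, hv.2.2.trans h⟩
  · simp [hn, hx, h]
  · simp

theorem numBelow_lt_self {S : ℕ → ℕ} {f : ℕ → ℚ} {x : ℕ} (hn : x < n) : numBelow n S f x < n := by
  classical
  have : ((Finset.range n).filter fun v => S v = 1 ∧ f v < f x).card < (Finset.range n).card :=
    Finset.card_lt_card (Finset.ssubset_iff_of_subset (Finset.filter_subset _ _) |>.2
      ⟨x, by simpa using hn, by simp⟩)
  rwa [Finset.card_range] at this

theorem numBelow_le {H : Store} (h : Ordered Adj L n m s t e₁ e₂ ef H) (f : ℕ → ℚ) (x : ℕ) :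
    numBelow n (H.A 14) f x ≤ 2 * m + 2 := by
  classical
  refine le_trans ?_ h.searched.cnt
  have : (Finset.range n).filter (fun v => H.A 14 v = 1 ∧ f v < f x) ⊆
      (Finset.range (H.r 15)).image (H.A 9) := by
    intro v hv
    simp only [Finset.mem_filter] at hv
    have hvis := h.bipolar.found v hv.2.1
    exact Finset.mem_image.2 ⟨H.A 7 v, Finset.mem_range.2 (h.searched.tree.pre_lt v hvis),
      h.searched.tree.ord_pre v hvis⟩
  exact (Finset.card_le_card this).trans (Finset.card_image_le.trans (by simp))

/-- Write the edge between the vertices in the variables `21` and `22` into array `20`. The path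
will occupy the entries from number `r 24` to number `r 25 - 1`. -/
def outputInit : Cmd :=
  .put 20 1 21 ;; .add 23 1 6 ;; .put 20 23 22 ;; .move 24 1 ;; .add 25 23 6 ;; .const 19 0

/-- Prolong the path downwards to `s`. -/
def outputDown : Cmd :=
  .loop (.eq 19 5) (.cond (.eq 21 3) (.const 19 1)
    (.get 21 16 21 ;; .sub 24 24 6 ;; .put 20 24 21))

/-- Prolong the path upwards to `t`. -/
def outputUp : Cmd :=
  .loop (.eq 19 5) (.cond (.eq 22 4) (.const 19 1)
    (.get 22 17 22 ;; .put 20 25 22 ;; .add 25 25 6))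

/-- Write an odd path through the edge between the variables `21` and `22`. Finally, its length is
in variable `0`, and it starts in array `20` with the entry whose number is in variable `24`. -/
def output : Cmd :=
  outputInit ;; outputDown ;; .const 19 0 ;; outputUp ;; .sub 0 25 24

/-- The invariant of the output loops: the store `H₀` is the one before the output. -/
structure OutputState (Adj : ℕ → ℕ → Prop) (L : ℕ → ℕ → ℕ) (n m s t : ℕ) (e₁ e₂ ef : ℕ → ℕ)
    (H₀ H : Store) : Prop where
  const : Const n m s t e₁ e₂ ef H
  arrays : ∀ j, j ≠ 20 → H.A j = H₀.A j
  fst : H₀.A 14 (H.r 21) = 1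
  snd : H₀.A 14 (H.r 22) = 1
  fst_ne : H.r 21 ≠ t
  snd_ne : H.r 22 ≠ s
  lt : H.r 24 < H.r 25
  route : Route Adj L (H₀.pos t) (H₀.A 18) (H₀.A 19) (H.r 21) (H.r 22)
    (segment (H.A 20) (H.r 24) (H.r 25))
  /-- There is room for all vertices below the path. -/
  below : numBelow n (H₀.A 14) (H₀.pos t) (H.r 21) < H.r 24
  /-- There is room for all vertices above the path. -/
  above : H.r 25 + numBelow n (H₀.A 14) (fun v => - H₀.pos t v) (H.r 22) ≤ 2 * n + 1

theorem Ordered.lo_spec (I : Instance Adj L n m s t e₁ e₂ ef) {H : Store}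
    (h : Ordered Adj L n m s t e₁ e₂ ef H) {v : ℕ} (hv : H.A 14 v = 1) (hvt : v ≠ t) (hvs : v ≠ s) :
    H.A 14 (H.A 16 v) = 1 ∧ Adj (H.A 16 v) v ∧ H.pos t (H.A 16 v) < H.pos t v ∧
      (H.A 18 v + H.A 18 (H.A 16 v) + L (H.A 16 v) v) % 2 = 0 ∧ H.A 16 v ≠ t := by
  obtain ⟨⟨h1, h2, h3, h4⟩, -⟩ := h.bipolar.ptr_spec I.graph h.searched.tree h.low hv hvt hvs
  refine ⟨h1, h2, h3, h4, fun h5 => ?_⟩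
  rw [h5] at h3
  exact lt_asymm h3 (h.bipolar.pos_lt_root h.searched.tree (h.bipolar.found v hv) hvt)

theorem Ordered.hi_spec (I : Instance Adj L n m s t e₁ e₂ ef) {H : Store}
    (h : Ordered Adj L n m s t e₁ e₂ ef H) {v : ℕ} (hv : H.A 14 v = 1) (hvt : v ≠ t) (hvs : v ≠ s) :
    H.A 14 (H.A 17 v) = 1 ∧ Adj v (H.A 17 v) ∧ H.pos t v < H.pos t (H.A 17 v) ∧
      (H.A 19 v + H.A 19 (H.A 17 v) + L v (H.A 17 v)) % 2 = 0 ∧ H.A 17 v ≠ s := by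
  obtain ⟨-, ⟨h1, h2, h3, h4⟩⟩ := h.bipolar.ptr_spec I.graph h.searched.tree h.low hv hvt hvs
  refine ⟨h1, h2, h3, h4, fun h5 => ?_⟩
  rw [h5] at h3
  exact lt_asymm h3 (h.bipolar.pos_source_lt h.searched.tree hv hvs)

theorem OddEdge.fst_ne {H : Store} (hO : Ordered Adj L n m s t e₁ e₂ ef H) {x y : ℕ}
    (h : OddEdge Adj L t H x y) : x ≠ t := by
  rintro rfl
  have hlt := h.lt
  by_cases hy : y = x
  · rw [hy] at hlt
    exact lt_irrefl _ hlt
  · exact lt_asymm hlt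
      (hO.bipolar.pos_lt_root hO.searched.tree (hO.bipolar.found y h.snd) hy)

theorem OddEdge.snd_ne {H : Store} (hO : Ordered Adj L n m s t e₁ e₂ ef H) {x y : ℕ}
    (h : OddEdge Adj L t H x y) : y ≠ s := by
  rintro rfl
  have hlt := h.lt
  by_cases hx : x = y
  · rw [hx] at hlt
    exact lt_irrefl _ hlt
  · exact lt_asymm hlt (hO.bipolar.pos_source_lt hO.searched.tree h.fst hx)

theorem outputInit_spec (hU : 4 * (n + m + 1) = U) {H : Store}
    (hO : Ordered Adj L n m s t e₁ e₂ ef H) (he : OddEdge Adj L t H (H.r 21) (H.r 22)) :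
    wp U outputInit (fun H' => OutputState Adj L n m s t e₁ e₂ ef H H' ∧ H'.r 19 = 0) H := by
  have hC := hO.searched.const
  have hx := hO.searched.lt _ (hO.bipolar.found _ he.fst)
  have hy := hO.searched.lt _ (hO.bipolar.found _ he.snd)
  have hodd := he.odd
  simp only [outputInit, wp, numArrays, Store.set_r, Store.put_r, hC.one, hC.r₁,
    Nat.reduceEqDiff, if_true, if_false, Nat.reduceLT, true_and]
  refine ⟨by omega, by omega, by omega, by omega, ?_, trivial⟩
  refine ⟨by simpa using hC, fun j hj => by simp [hj], by simpa using he.fst, by simpa using he.snd,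
    by simpa using he.fst_ne hO, by simpa using he.snd_ne hO, by simp, ?_, ?_, ?_⟩
  · have h1 : n + 1 + 1 - n = 2 := by omega
    simp only [Store.set_r, Store.put_r, Store.set_A, Store.put_A, segment, Nat.reduceEqDiff,
      if_true, if_false, h1]
    simp only [List.range', List.map_cons, List.map_nil, Function.update_self]
    rw [Function.update_of_ne (by omega), Function.update_self]
    refine ⟨?_, rfl, rfl, ?_⟩
    · simp [he.adj, he.lt]
    · simp only [labelSum]
      omega
  · simpa using numBelow_lt_self hx
  · have := numBelow_lt_self (S := H.A 14) (f := fun v => - H.pos t v) hy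
    simp only [Store.set_r, Store.put_r, Nat.reduceEqDiff, if_true, if_false]
    omega

theorem outputDown_spec (hF : Fits U w) (hU : 4 * (n + m + 1) = U)
    (I : Instance Adj L n m s t e₁ e₂ ef) {H₀ H : Store} (hO : Ordered Adj L n m s t e₁ e₂ ef H₀)
    (h : OutputState Adj L n m s t e₁ e₂ ef H₀ H) (h19 : H.r 19 = 0) :
    Halts U w outputDown H ((2 * m + 3) * 10 + 1)
      (fun H' => OutputState Adj L n m s t e₁ e₂ ef H₀ H' ∧ H'.r 21 = s) := by
  refine (Halts.loop (T := 9) (I := fun k H => OutputState Adj L n m s t e₁ e₂ ef H₀ H ∧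
    ((H.r 19 = 0 ∧ k = numBelow n (H₀.A 14) (H₀.pos t) (H.r 21) + 1) ∨
      (H.r 19 = 1 ∧ H.r 21 = s ∧ k = 0))) ?_ _ _ ⟨h, .inl ⟨h19, rfl⟩⟩).mono ?_ ?_
  · rintro k H ⟨h, hk⟩ hb
    have hC := h.const
    have h19 : H.r 19 = 0 := by simpa [Holds, hC.zero] using hb
    obtain ⟨-, hk⟩ := hk.resolve_right (by omega)
    suffices h : wp U _ (fun H => ∃ k' < k, OutputState Adj L n m s t e₁ e₂ ef H₀ H ∧
        ((H.r 19 = 0 ∧ k' = numBelow n (H₀.A 14) (H₀.pos t) (H.r 21) + 1) ∨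
          (H.r 19 = 1 ∧ H.r 21 = s ∧ k' = 0))) H from
      (halts_of_wp hF _ _ _ h).mono (by simp [cost]) fun H' h => h
    have hxn := hO.searched.lt _ (hO.bipolar.found _ h.fst)
    have hlt := h.lt
    have hbelow := h.below
    have habove := h.above
    simp only [wp, numArrays, Holds, Store.set_r, hC.r₃, hC.one, h.arrays 16 (by norm_num),
      Nat.reduceEqDiff, if_true, if_false, Nat.reduceLT, true_and]
    refine ⟨fun hs => ⟨0, by omega, ?_, .inr ⟨hs, rfl⟩⟩, fun hs => ⟨by omega, by omega, ?_⟩⟩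
    · exact ⟨by simpa using hC, by simpa using h.arrays, by simpa using h.fst, by simpa using h.snd,
        by simpa using h.fst_ne, by simpa using h.snd_ne, by simpa using h.lt,
        by simpa using h.route, by simpa using h.below, by simpa using h.above⟩
    · obtain ⟨h1, h2, h3, h4, h5⟩ := hO.lo_spec I h.fst h.fst_ne hs
      have hn := numBelow_lt (S := H₀.A 14) (hO.searched.lt _ (hO.bipolar.found _ h1)) h1 h3
      refine ⟨_, ?_, ⟨by simpa using hC, fun j hj => by simpa [hj] using h.arrays j hj,
        by simpa using h1, by simpa using h.snd, by simpa using h5, by simpa using h.snd_ne,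
        by simp; omega, ?_, by simp; omega, by simpa using h.above⟩, .inl ⟨by simpa using h19, rfl⟩⟩
      · simp
        omega
      · simp only [Store.set_r, Store.put_r, Store.set_A, Store.put_A, Nat.reduceEqDiff,
          if_true, if_false]
        rw [segment_cons (by omega), Nat.sub_add_cancel (by omega)]
        exact h.route.cons h2 h3 h4
  · have := numBelow_le hO (H₀.pos t) (H.r 21)
    omega
  · rintro H ⟨⟨k, h, hk⟩, hb⟩
    have h19 : H.r 19 ≠ 0 := by simpa [Holds, h.const.zero] using hb
    exact ⟨h, (hk.resolve_left fun h => h19 h.1).2.1⟩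

theorem outputUp_spec (hF : Fits U w) (hU : 4 * (n + m + 1) = U)
    (I : Instance Adj L n m s t e₁ e₂ ef) {H₀ H : Store} (hO : Ordered Adj L n m s t e₁ e₂ ef H₀)
    (h : OutputState Adj L n m s t e₁ e₂ ef H₀ H) (h19 : H.r 19 = 0) (h21 : H.r 21 = s) :
    Halts U w outputUp H ((2 * m + 3) * 10 + 1)
      (fun H' => OutputState Adj L n m s t e₁ e₂ ef H₀ H' ∧ H'.r 21 = s ∧ H'.r 22 = t) := by
  refine (Halts.loop (T := 9) (I := fun k H => (OutputState Adj L n m s t e₁ e₂ ef H₀ H ∧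
    H.r 21 = s) ∧
    ((H.r 19 = 0 ∧ k = numBelow n (H₀.A 14) (fun v => - H₀.pos t v) (H.r 22) + 1) ∨
      (H.r 19 = 1 ∧ H.r 22 = t ∧ k = 0))) ?_ _ _ ⟨⟨h, h21⟩, .inl ⟨h19, rfl⟩⟩).mono ?_ ?_
  · rintro k H ⟨⟨h, h21⟩, hk⟩ hb
    have hC := h.const
    have h19 : H.r 19 = 0 := by simpa [Holds, hC.zero] using hb
    obtain ⟨-, hk⟩ := hk.resolve_right (by omega)
    suffices h : wp U _ (fun H => ∃ k' < k, (OutputState Adj L n m s t e₁ e₂ ef H₀ H ∧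
        H.r 21 = s) ∧
        ((H.r 19 = 0 ∧ k' = numBelow n (H₀.A 14) (fun v => - H₀.pos t v) (H.r 22) + 1) ∨
          (H.r 19 = 1 ∧ H.r 22 = t ∧ k' = 0))) H from
      (halts_of_wp hF _ _ _ h).mono (by simp [cost]) fun H' h => h
    have hyn := hO.searched.lt _ (hO.bipolar.found _ h.snd)
    have hlt := h.lt
    have hbelow := h.below
    have habove := h.above
    simp only [wp, numArrays, Holds, Store.set_r, Store.put_r, hC.r₄, hC.one,
      h.arrays 17 (by norm_num), Nat.reduceEqDiff, if_true, if_false, Nat.reduceLT, true_and]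
    refine ⟨fun ht => ⟨0, by omega, ⟨?_, h21⟩, .inr ⟨ht, rfl⟩⟩,
      fun ht => ⟨by omega, by omega, by omega, ?_⟩⟩
    · exact ⟨by simpa using hC, by simpa using h.arrays, by simpa using h.fst, by simpa using h.snd,
        by simpa using h.fst_ne, by simpa using h.snd_ne, by simpa using h.lt,
        by simpa using h.route, by simpa using h.below, by simpa using h.above⟩
    · obtain ⟨h1, h2, h3, h4, h5⟩ := hO.hi_spec I h.snd ht h.snd_ne
      have hn := numBelow_lt (S := H₀.A 14) (f := fun v => - H₀.pos t v)
        (hO.searched.lt _ (hO.bipolar.found _ h1)) h1 (neg_lt_neg h3)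
      refine ⟨_, ?_, ⟨⟨by simpa using hC, fun j hj => by simpa [hj] using h.arrays j hj,
        by simpa using h.fst, by simpa using h1, by simpa using h.fst_ne, by simpa using h5,
        by simp; omega, ?_, by simpa using h.below, by simp; omega⟩, h21⟩,
        .inl ⟨by simpa using h19, rfl⟩⟩
      · omega
      · simp only [Store.set_r, Store.put_r, Store.set_A, Store.put_A, Nat.reduceEqDiff,
          if_true, if_false]
        rw [segment_concat hlt.le]
        exact h.route.concat h2 h3 h4
  · have := numBelow_le hO (fun v => - H₀.pos t v) (H.r 22)
    omega
  · rintro H ⟨⟨k, ⟨h, h21⟩, hk⟩, hb⟩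
    have h19 : H.r 19 ≠ 0 := by simpa [Holds, h.const.zero] using hb
    exact ⟨h, h21, (hk.resolve_left fun h => h19 h.1).2.1⟩

/-- The store after the output of an odd path: it is increasing in some order `f` of the vertices.
-/
def Written (Adj : ℕ → ℕ → Prop) (L : ℕ → ℕ → ℕ) (n m s t : ℕ) (H : Store) : Prop :=
  ∃ (f : ℕ → ℚ) (l : List ℕ), l.IsChain (fun u v => Adj u v ∧ f u < f v) ∧ l.head? = some s ∧
    l.getLast? = some t ∧ labelSum L l % 2 = 1 ∧ l = segment (H.A 20) (H.r 24) (H.r 24 + H.r 0) ∧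
    H.r 24 + H.r 0 < 4 * (n + m + 1)

theorem output_spec (hF : Fits U w) (hU : 4 * (n + m + 1) = U)
    (I : Instance Adj L n m s t e₁ e₂ ef) {H : Store} (hO : Ordered Adj L n m s t e₁ e₂ ef H)
    (he : OddEdge Adj L t H (H.r 21) (H.r 22)) :
    Halts U w output H (40 * m + 80) (Written Adj L n m s t) := by
  refine ((halts_of_wp hF outputInit _ _ (outputInit_spec hU hO he)).mono le_rfl ?_).seq
    (T₂ := 40 * m + 65) |>.mono (by simp only [outputInit, cost]; omega) fun _ h => h
  rintro H₁ ⟨h₁, h19⟩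
  refine ((outputDown_spec hF hU I hO h₁ h19).mono le_rfl ?_).seq (T₂ := 20 * m + 34) |>.mono
    (by omega) fun _ h => h
  rintro H₂ ⟨h₂, h21⟩
  refine (halts_of_wp hF (.const 19 0) _ _ ⟨by norm_num, ?_⟩).seq (T₂ := 20 * m + 33) |>.mono
    (by simp only [cost]; omega) fun _ h => h
  refine ((outputUp_spec hF hU I hO (H := H₂.set 19 0) ?_ (by simp) (by simpa using h21)).mono
    le_rfl ?_).seq (T₂ := 1) |>.mono (by omega) fun _ h => h
  · exact ⟨by simpa using h₂.const, by simpa using h₂.arrays, by simpa using h₂.fst,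
      by simpa using h₂.snd, by simpa using h₂.fst_ne, by simpa using h₂.snd_ne,
      by simpa using h₂.lt, by simpa using h₂.route, by simpa using h₂.below,
      by simpa using h₂.above⟩
  rintro H₃ ⟨h₃, h21, h22⟩
  refine (halts_of_wp hF (.sub 0 25 24) _ _ ?_).mono (by simp only [cost]; omega) fun _ h => h
  have hr := h₃.route
  have hlt := h₃.lt
  have habove := h₃.above
  have hodd := hr.odd
  have hadd : H₃.r 24 + (H₃.r 25 - H₃.r 24) = H₃.r 25 := by omega
  rw [h21, h22, hO.bipolar.a_s, hO.bipolar.b_t] at hodd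
  rw [h21, h22] at hr
  refine ⟨H.pos t, _, hr.chain, hr.head, hr.last, hodd, ?_, ?_⟩
  · simp [hadd]
  · simp only [Store.set_r, Nat.reduceEqDiff, if_true, if_false]
    omega

end OddPath

namespace OddPath

/-! ### The program -/

variable {n : ℕ} {G : SimpleGraph (Fin n)} {F : Finset (Sym2 (Fin n))} {U w : ℕ}

/-- The main part of the algorithm. -/
def search : Cmd :=
  build ;; dfs ;; lowEdges ;; lowTree ;; order ;; decide ;; .cond (.eq 20 5) .skip output

/-- The algorithm. There are no odd closed paths. -/
def algorithm : Cmd := .cond (.eq 3 4) .skip search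

/-- The output of the algorithm is correct and lies within array `20`. -/
def Correct (G : SimpleGraph (Fin n)) (F : Finset (Sym2 (Fin n))) (s t : Fin n) (U : ℕ)
    (H : Store) : Prop :=
  IsCorrectOutput G F s t (segment (H.A 20) (H.r 24) (H.r 24 + H.r 0)) ∧
    ∀ i < H.r 0, H.r 24 + i < U

theorem correct_of_not_exists {s t : Fin n} {H : Store} (h : ¬ ∃ p : G.Walk s t, IsOddPath F p)
    (h0 : H.r 0 = 0) : Correct G F s t U H :=
  ⟨.inr ⟨h, by simp [segment, h0]⟩, by simp [h0]⟩

theorem Ordered.not_exists {m : ℕ} {s t : Fin n} {e₁ e₂ ef : ℕ → ℕ} {H : Store}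
    (h : Ordered (NatAdj G) (natLabel F) n m s t e₁ e₂ ef H)
    (hpot : ∀ u v, H.A 14 u = 1 → H.A 14 v = 1 → NatAdj G u v →
      (H.A 18 u + H.A 18 v + natLabel F u v) % 2 = 0) : ¬ ∃ p : G.Walk s t, IsOddPath F p := by
  rintro ⟨p, hp⟩
  rw [isOddPath_iff] at hp
  have := countP_of_potential h.searched.tree h.low h.bipolar h.searched.closed hpot p rfl hp.1
    h.bipolar.source
  rw [h.bipolar.a_s] at this
  omega

theorem search_spec {m : ℕ} {s t : Fin n} {e₁ e₂ ef : ℕ → ℕ} (hF : Fits U w)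
    (hU : 4 * (n + m + 1) = U) (I : Instance (NatAdj G) (natLabel F) n m s t e₁ e₂ ef)
    {H : Store} (hC : Const n m s t e₁ e₂ ef H) (hA : ∀ j, 0 < j → H.A j = fun _ => 0) :
    Halts U w search H (800 * m + 500) (Correct G F s t U) := by
  refine ((build_spec hF hU I hC hA).mono le_rfl fun H₁ h₁ => ?_).seq
    (T₂ := 767 * m + 480) |>.mono (by omega) fun _ h => h
  refine ((dfs_spec hF hU I h₁).mono le_rfl fun H₂ h₂ => ?_).seq
    (T₂ := 567 * m + 280) |>.mono (by omega) fun _ h => h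
  refine ((lowEdges_spec hF hU I h₂).mono le_rfl fun H₃ h₃ => ?_).seq
    (T₂ := 467 * m + 270) |>.mono (by omega) fun _ h => h
  refine ((lowTree_spec hF hU I h₃).mono le_rfl fun H₄ h₄ => ?_).seq
    (T₂ := 367 * m + 170) |>.mono (by omega) fun _ h => h
  refine ((order_spec hF hU I h₄).mono le_rfl fun H₅ h₅ => ?_).seq
    (T₂ := 207 * m + 150) |>.mono (by omega) fun _ h => h
  refine ((decide_spec hF hU I h₅).mono le_rfl fun H₆ h₆ => ?_).seq
    (T₂ := 87 * m + 100) |>.mono (by omega) fun _ h => h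
  have hC := h₆.ordered.searched.const
  refine (Halts.cond (T := 40 * m + 80) (fun hb => ?_) fun hb => ?_).mono (by omega) fun _ h => h
  · have hb : H₆.r 20 = 0 := by simpa [Holds, hC.zero] using hb
    refine (halts_of_wp hF .skip _ _ ?_).mono (by simp only [cost]; omega) fun _ h => h
    exact correct_of_not_exists
      (h₆.ordered.not_exists (h₆.cases.resolve_right fun h => h.1 hb).2) hC.r₀
  · have hb : H₆.r 20 ≠ 0 := by simpa [Holds, hC.zero] using hb
    refine (output_spec hF hU I h₆.ordered (h₆.cases.resolve_left fun h => hb h.1).2).mono le_rfl ?_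
    rintro H ⟨f, l, hl, hs, ht, hodd, rfl, hlt⟩
    exact ⟨isCorrectOutput_of_chain f hl hs ht hodd, fun i hi => by omega⟩

theorem not_exists_of_eq {s t : Fin n} (h : s = t) : ¬ ∃ p : G.Walk s t, IsOddPath F p := by
  subst h
  rintro ⟨p, hp⟩
  rw [isOddPath_iff] at hp
  rw [SimpleGraph.Walk.eq_nil_iff_nil.2 (SimpleGraph.Walk.isPath_iff_nil.1 hp.1)] at hp
  simp at hp

/-! ### Initialization of the registers -/

/-- A sequence of elementary instructions. -/
def block (l : List RAM.Instr) : RAM.Program := l.foldr (fun i p => .seq (.instr i) p) .skip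

theorem runs_block (w : ℕ) (l : List RAM.Instr) : ∀ σ : RAM.State,
    RAM.Runs w (block l) σ (l.length + 1) (l.foldl (RAM.Instr.apply w) σ) := by
  induction l with
  | nil => exact fun σ => .skip σ
  | cons i l ih =>
    intro σ
    rw [List.length_cons, add_comm l.length, add_assoc]
    exact .seq (.instr i σ) (ih _)

/-- Load `n`, `m`, `s`, `t` and `1` into the variables `1`, `2`, `3`, `4` and `6`, and the length
`4 * (n + m + 1)` of the arrays into variable `14`. -/
def loadInput : List RAM.Instr :=
  [.const 12 1, .load 2 10, .load 4 12, .add 28 12 12, .load 6 28, .add 28 28 12, .load 8 28,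
    .add 28 2 4, .add 28 28 12, .add 28 28 28, .add 28 28 28]

/-- Compute the addresses of the arrays with numbers up to `k`. -/
def loadBases (k : ℕ) : List RAM.Instr :=
  (List.range k).map fun j => .add (2 * (j + 1) + 3) (2 * j + 3) 28

theorem loadBases_spec (hF : numArrays * U ≤ 2 ^ w) (σ : RAM.State) (h28 : σ.reg 28 = U)
    (h3 : σ.reg 3 = 0) (k : ℕ) (hk : k < numArrays) :
    (∀ x, ((loadBases k).foldl (RAM.Instr.apply w) σ).reg (2 * x) = σ.reg (2 * x)) ∧
      (∀ j ≤ k, ((loadBases k).foldl (RAM.Instr.apply w) σ).reg (2 * j + 3) = j * U) ∧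
      ((loadBases k).foldl (RAM.Instr.apply w) σ).mem = σ.mem := by
  induction k with
  | zero => simp [loadBases, h3]
  | succ k ih =>
    obtain ⟨h1, h2, h4⟩ := ih (by omega)
    have h5 : loadBases (k + 1) = loadBases k ++ [.add (2 * (k + 1) + 3) (2 * k + 3) 28] := by
      simp [loadBases, List.range_succ]
    rw [h5, List.foldl_append]
    simp only [List.foldl_cons, List.foldl_nil, RAM.Instr.apply, RAM.State.setReg]
    have h6 : ((loadBases k).foldl (RAM.Instr.apply w) σ).reg 28 = U := (h1 14).trans h28
    have h7 : (k + 1) * U < 2 ^ w ∨ U = 0 := by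
      rcases Nat.eq_zero_or_pos U with h | h
      · exact .inr h
      · exact .inl ((Nat.mul_lt_mul_of_pos_right hk h).trans_le hF)
    refine ⟨fun x => ?_, fun j hj => ?_, h4⟩
    · rw [Function.update_of_ne (by omega), h1]
    · rcases Nat.le_succ_iff.1 hj with hj | rfl
      · rw [Function.update_of_ne (by omega), h2 j hj]
      · rw [Function.update_self, h2 k le_rfl, h6, ← Nat.succ_mul, Nat.mod_eq_of_lt]
        rcases h7 with h | h
        · exact h
        · simp [h]

theorem loadInput_spec {m s t : ℕ} (hU : 4 * (n + m + 1) = U) (hF : numArrays * U ≤ 2 ^ w)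
    (σ : RAM.State) (hr : ∀ x, σ.reg x = 0) (h0 : σ.mem 0 = n) (h1 : σ.mem 1 = m)
    (h2 : σ.mem 2 = s) (h3 : σ.mem 3 = t) :
    let τ := loadInput.foldl (RAM.Instr.apply w) σ
    τ.mem = σ.mem ∧ τ.reg 0 = 0 ∧ τ.reg 2 = n ∧ τ.reg 4 = m ∧ τ.reg 6 = s ∧ τ.reg 8 = t ∧
      τ.reg 10 = 0 ∧ τ.reg 12 = 1 ∧ τ.reg 28 = U ∧ τ.reg 3 = 0 := by
  have hN : numArrays = 22 := rfl
  rw [hN] at hF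
  have e1 : 1 % 2 ^ w = 1 := Nat.mod_eq_of_lt (by omega)
  have e2 : (1 + 1) % 2 ^ w = 2 := Nat.mod_eq_of_lt (by omega)
  have e3 : (2 + 1) % 2 ^ w = 3 := Nat.mod_eq_of_lt (by omega)
  have e4 : (n + m) % 2 ^ w = n + m := Nat.mod_eq_of_lt (by omega)
  have e5 : (n + m + 1) % 2 ^ w = n + m + 1 := Nat.mod_eq_of_lt (by omega)
  have e6 : (n + m + 1 + (n + m + 1)) % 2 ^ w = n + m + 1 + (n + m + 1) :=
    Nat.mod_eq_of_lt (by omega)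
  have e7 : (n + m + 1 + (n + m + 1) + (n + m + 1 + (n + m + 1))) % 2 ^ w = U := by
    rw [Nat.mod_eq_of_lt (by omega)]
    omega
  simp [loadInput, RAM.Instr.apply, RAM.State.setReg, hr, h0, h1, h2, h3, e1, e2,
    e3, e4, e5, e6, e7]

/-! ### The input -/

theorem getD_flatMap {α : Type*} (f : α → List ℕ) (hf : ∀ a, (f a).length = 3) (d : α) {k : ℕ}
    (hk : k < 3) (l : List α) : ∀ i < l.length,
      (l.flatMap f).getD (3 * i + k) 0 = (f (l.getD i d)).getD k 0 := by
  induction l with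
  | nil => simp
  | cons x l ih =>
    intro i hi
    rw [List.flatMap_cons]
    cases i with
    | zero =>
      rw [List.getD_append _ _ _ _ (by rw [hf]; omega)]
      simp
    | succ i =>
      rw [List.getD_append_right _ _ _ _ (by rw [hf]; omega), hf,
        (by omega : 3 * (i + 1) + k - 3 = 3 * i + k), ih i (by simpa using hi)]
      simp

theorem length_edgeList {edges : List (Fin n × Fin n)} (h : IsEdgeList G edges) :
    edges.length = G.edgeSet.ncard := by
  have h1 : G.edgeSet = ((edges.map fun e => s(e.1, e.2)).toFinset : Set (Sym2 (Fin n))) := by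
    ext e
    rw [← h.2 e]
    simp
  rw [h1, Set.ncard_coe_finset, List.toFinset_card_of_nodup h.1, List.length_map]

theorem instance_edgeList {edges : List (Fin n × Fin n)} (h : IsEdgeList G edges) {s t : Fin n}
    (hst : s ≠ t) : Instance (NatAdj G) (natLabel F) n edges.length s t
      (fun i => (edges.getD i (s, t)).1) (fun i => (edges.getD i (s, t)).2)
      (fun i => if s((edges.getD i (s, t)).1, (edges.getD i (s, t)).2) ∈ F then 1 else 0) where
  graph := labelled G F
  s_lt := s.2
  t_lt := t.2
  ne h := hst (Fin.ext h)
  lt := fun _ _ ⟨hu, _⟩ => hu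
  adj i hi := by
    rw [natAdj_val, ← SimpleGraph.mem_edgeSet, ← h.2, List.getD_eq_getElem _ _ hi]
    exact List.mem_map.2 ⟨_, List.getElem_mem hi, rfl⟩
  lab i _ := by rw [natLabel_val]
  cover := by
    rintro u v ⟨hu, hv, huv⟩
    rw [← SimpleGraph.mem_edgeSet, ← h.2, List.mem_map] at huv
    obtain ⟨e, he, heq⟩ := huv
    obtain ⟨i, hi, rfl⟩ := List.mem_iff_getElem.1 he
    refine ⟨i, hi, ?_⟩
    rw [List.getD_eq_getElem _ _ hi]
    rw [Sym2.eq_iff] at heq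
    rcases heq with ⟨h1, h2⟩ | ⟨h1, h2⟩
    · left
      rw [h1, h2]
      exact ⟨rfl, rfl⟩
    · right
      rw [h1, h2]
      exact ⟨rfl, rfl⟩

/-- The machine program: initialization, the algorithm, and computing the address of the output. -/
def program : RAM.Program :=
  .seq (block (loadInput ++ loadBases 21)) (.seq (compile algorithm) (.instr (.add 1 43 48)))

theorem program_spec {edges : List (Fin n × Fin n)} (h : IsEdgeList G edges) (s t : Fin n)
    (hw : 2 ^ 7 * (n + edges.length + 1) ≤ 2 ^ w) :
    ∃ T ≤ 800 * edges.length + 600, ∃ σ,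
      RAM.Runs w program (RAM.State.init (encodeInput edges F s t)) T σ ∧
        IsCorrectOutput G F s t σ.output := by
  obtain ⟨m, hm⟩ : ∃ m, edges.length = m := ⟨_, rfl⟩
  obtain ⟨U, hU⟩ : ∃ U, 4 * (n + m + 1) = U := ⟨_, rfl⟩
  rw [hm] at hw ⊢
  have hF : Fits U w := ⟨by omega, by simp only [numArrays]; omega⟩
  obtain ⟨input, hinput⟩ : ∃ input, encodeInput edges F s t = input := ⟨_, rfl⟩
  have hlen : input.length = 4 + 3 * m := by
    rw [← hinput, ← hm]
    simp [encodeInput, List.length_flatMap]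
    omega
  -- the entries of the input
  have hedge : ∀ i < m, ∀ k < 3, input.getD (4 + 3 * i + k) 0 =
      [(edges.getD i (s, t)).1.val, (edges.getD i (s, t)).2.val,
        if s((edges.getD i (s, t)).1, (edges.getD i (s, t)).2) ∈ F then 1 else 0].getD k 0 := by
    intro i hi k hk
    rw [← hinput, encodeInput, List.getD_append_right _ _ _ _ (by simp; omega)]
    have : 4 + 3 * i + k - [n, edges.length, s.val, t.val].length = 3 * i + k := by
      simp
      omega
    rw [this]
    exact getD_flatMap (fun e : Fin n × Fin n =>
      [e.1.val, e.2.val, if s(e.1, e.2) ∈ F then 1 else 0]) (by simp) (s, t) hk edges i (by omega)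
  rw [hinput]
  obtain ⟨h1, h2, h3, h4, h5, h6, h7, h8, h9, h10⟩ := loadInput_spec (s := s) (t := t) hU hF.le
    (RAM.State.init input) (fun _ => rfl) (by simp [RAM.State.init, ← hinput, encodeInput])
    (by simp [RAM.State.init, ← hinput, encodeInput, hm])
    (by simp [RAM.State.init, ← hinput, encodeInput])
    (by simp [RAM.State.init, ← hinput, encodeInput])
  obtain ⟨g1, g2, g3⟩ := loadBases_spec hF.le _ h9 h10 21 (by norm_num)
  have hrun := runs_block w (loadInput ++ loadBases 21) (RAM.State.init input)
  rw [List.foldl_append] at hrun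
  generalize (loadBases 21).foldl (RAM.Instr.apply w)
    (loadInput.foldl (RAM.Instr.apply w) (RAM.State.init input)) = τ at g1 g2 g3 hrun
  rw [h1] at g3
  obtain ⟨H, hH⟩ : ∃ H : Store,
    H = ⟨fun x => τ.reg (2 * x), fun j i => if j = 0 then τ.mem i else 0⟩ := ⟨_, rfl⟩
  have hmem : ∀ i, τ.mem i = input.getD i 0 := fun i => by rw [g3]; rfl
  have hR : Rep U H τ := by
    refine ⟨fun x => by rw [hH], fun j hj => g2 j (Nat.le_of_lt_succ hj), fun j _ i hi => ?_⟩
    rw [hH]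
    by_cases hj : j = 0
    · simp [hj]
    · have : U ≤ j * U := Nat.le_mul_of_pos_left U (Nat.pos_of_ne_zero hj)
      simp only [hj, if_false, hmem]
      exact List.getD_eq_default _ _ (by omega)
  have hr : ∀ x, H.r x = (loadInput.foldl (RAM.Instr.apply w) (RAM.State.init input)).reg (2 * x) :=
    fun x => by rw [hH]; exact g1 x
  have h0 : ∀ i, H.A 0 i = input.getD i 0 := fun i => by rw [hH]; exact hmem i
  have hH0 : H.r 0 = 0 := (hr 0).trans h2
  have hspec : Halts U w algorithm H (800 * m + 501) (Correct G F s t U) := by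
    refine (Halts.cond (T := 800 * m + 500) (fun hb => ?_) fun hb => ?_).mono (by omega)
      fun _ h => h
    · have hb : (s : ℕ) = t := by
        have : H.r 3 = H.r 4 := hb
        rwa [hr, hr, h5, h6] at this
      refine (halts_of_wp hF .skip _ _ ?_).mono (by simp only [cost]; omega) fun _ h => h
      exact correct_of_not_exists (not_exists_of_eq (Fin.ext hb)) hH0
    · have hst : s ≠ t := fun h => hb (show H.r 3 = H.r 4 by rw [hr, hr, h5, h6, h])
      have I := instance_edgeList (F := F) h hst
      rw [hm] at I
      refine search_spec hF hU I ?_ fun j hj => ?_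
      · refine ⟨hH0, (hr 1).trans h3, (hr 2).trans h4, (hr 3).trans h5, (hr 4).trans h6,
          (hr 5).trans h7, (hr 6).trans h8, fun i hi => ?_, fun i hi => ?_, fun i hi => ?_⟩
        · exact (h0 _).trans (hedge i hi 0 (by norm_num))
        · exact (h0 _).trans (hedge i hi 1 (by norm_num))
        · exact (h0 _).trans (hedge i hi 2 (by norm_num))
      · rw [hH]
        simp [Nat.ne_of_gt hj]
  obtain ⟨H', ⟨hcorrect, hlt⟩, hspec⟩ := hspec
  obtain ⟨T, hT, σ, hσ, hR'⟩ := hspec τ hR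
  refine ⟨_, ?_, _, .seq hrun (.seq hσ (.instr _ _)), ?_⟩
  · simp only [List.length_append, loadInput, loadBases, List.length_map, List.length_range,
      List.length_cons, List.length_nil]
    omega
  · convert hcorrect using 1
    have hlength : (σ.setReg 1 ((σ.reg 43 + σ.reg 48) % 2 ^ w)).reg 0 = H'.r 0 := hR'.reg 0
    have hstart : (σ.setReg 1 ((σ.reg 43 + σ.reg 48) % 2 ^ w)).reg 1 =
        (20 * U + H'.r 24) % 2 ^ w := by
      rw [← hR'.base 20 (by norm_num), ← hR'.reg 24]
      simp [RAM.State.setReg]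
    rw [RAM.Instr.apply, RAM.State.output, hlength, hstart, segment, Nat.add_sub_cancel_left,
      List.range'_eq_map_range, List.map_map]
    refine List.map_congr_left fun i hi => ?_
    have hi := hlt i (List.mem_range.1 hi)
    have hle := hF.le
    simp only [numArrays] at hle
    have hmod : (20 * U + H'.r 24) % 2 ^ w = 20 * U + H'.r 24 := Nat.mod_eq_of_lt (by omega)
    rw [hmod, add_assoc]
    exact hR'.mem 20 (by norm_num) _ hi

end OddPath

/-- There is one RAM program that finds an `s`-`t`-path using an odd number of edges from `F`, or
correctly reports that none exists, in `O(m log n)` steps, on every graph with `n` vertices and `m`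
edges and for every word size of at least `log₂ (n + m + 1) + K` bits, `K` a constant. The summand
`1` in the time bound matters for edgeless graphs only: if `m ≥ 1`, then `m log n ≥ log 2`. -/
theorem mainTheorem2 :
    ∃ (P : RAM.Program) (C : ℝ) (K : ℕ),
      ∀ (n : ℕ) (G : SimpleGraph (Fin n)) (F : Finset (Sym2 (Fin n))) (s t : Fin n)
        (edges : List (Fin n × Fin n)) (w : ℕ),
        (F : Set (Sym2 (Fin n))) ⊆ G.edgeSet →
        IsEdgeList G edges →
        2 ^ K * (n + G.edgeSet.ncard + 1) ≤ 2 ^ w →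
        ∃ (T : ℕ) (σ : RAM.State),
          RAM.Runs w P (RAM.State.init (encodeInput edges F s t)) T σ ∧
          (T : ℝ) ≤ C * (G.edgeSet.ncard * Real.log n + 1) ∧
          IsCorrectOutput G F s t σ.output := by
  -- the 22 arrays occupy `22 * 4 * (n + m + 1) ≤ 2 ^ 7 * (n + m + 1)` cells
  refine ⟨OddPath.program, 1600, 7, fun n G F s t edges w _ hE hw => ?_⟩
  rw [← OddPath.length_edgeList hE] at hw ⊢
  obtain ⟨T, hT, σ, hrun, hσ⟩ := OddPath.program_spec (F := F) hE s t hw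
  refine ⟨T, σ, hrun, ?_, hσ⟩
  have hT' : (T : ℝ) ≤ 800 * (edges.length : ℝ) + 600 := by exact_mod_cast hT
  have h0 : (0 : ℝ) ≤ edges.length := Nat.cast_nonneg _
  -- a graph with an edge has at least two vertices
  have hlog : (edges.length : ℝ) * (1 / 2) ≤ edges.length * Real.log n := by
    rcases edges with _ | ⟨e, edges⟩
    · simp
    · have hadj : G.Adj e.1 e.2 := by
        rw [← SimpleGraph.mem_edgeSet, ← hE.2]
        simp
      have hn : 2 ≤ n := by
        have h1 := e.1.2
        have h2 := e.2.2
        have h3 : (e.1 : ℕ) ≠ e.2 := fun h => hadj.ne (Fin.ext h)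
        omega
      refine mul_le_mul_of_nonneg_left ?_ h0
      have h1 : Real.log 2 ≤ Real.log n := Real.log_le_log (by norm_num) (by exact_mod_cast hn)
      have h2 := Real.log_two_gt_d9
      linarith
  linarith
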